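/- **Setting.** Let $X$ be a compact metrizable space. A *Kuranishi chart* of $X$ is a tuple $(G,\ s:U\to E,\ \psi)$ where $G$ is a finite group acting smoothly and effectively on a finite-rank vector bundle $E\to U$ over a manifold with corners, $s$ is a smooth equivariant section, and $\psi$ induces a homeomorphism of $s^{-1}(0)/G$ onto an open subset of $X$, the *coverage* of the chart. For an invariant open $V\subset U$ the coverage of the restricted chart is $\psi(s^{-1}(0)\cap V)$. A *coordinate change* from a chart $y$ to a chart $x$ is an equivariant bundle embedding $\hat\phi_{xy}:E_y|_{U_{xy}}\to E_x$ over an embedding $\phi_{xy}:U_{xy}\to U_x$ of an open invariant $U_{xy}\subset U_y$, with an injective group homomorphism $\rho_{xy}:G_y\to G_x$, injective on orbit spaces and bijective on stabilizers, which intertwines the sections and the maps to $X$, satisfies the tangent bundle condition (at the zeros, $ds_x$ induces an isomorphism $TU_x/T\phi_{xy}(U_{xy})\to E_x/\hat\phi_{xy}(E_y)$), and whose domain contains all zeros of $s_y$ lying over the coverage of $x$. A *good coordinate system* $\mathcal A$ on $X$ consists of a finite set $S\subset X$ with a reflexive, transitive, total relation $\le$, charts $(G_x,s_x:A_x\to E_x,\psi_x)$,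 $x\in S$, with $x$ in the coverage of chart $x$, whose coverages cover $X$ and such that $\dim E_y<\dim E_x$ implies $y\le x$ and $x\not\le y$, and a coordinate change from $y$ to $x$ for each pair in $I=\{(y,x): y\le x \text{ and the coverages of } y,x \text{ meet}\}$. The coordinate changes are compatible ($\hat\phi_{xy}\hat\phi_{yz}=h\,\hat\phi_{xz}$ for some $h\in G_x$ over the common domain), maximal (if $z_1\in A_y$, $z_2\in A_x$ are identified through a chain of coordinate changes and group elements, and $(y,x)\in I$, then $z_1$ is in the domain and $z_2\in G_x\phi_{xy}(z_1)$), and satisfy topological matching (limits, among zeros, of sequences of identified points are identified). For a family $V=(V_x\subset A_x)$, $M(V)$ is the quotient of $\bigsqcup_xV_x$ by the equivalence relation generated by the group actions and the coordinate changes restricted to $V$. For $V\subset W$ the *relative topology* of $M(V)$ with respect to $W$ is the one induced by $M(V)\to M(W)$ from the quotient topology of $M(W)$. A *shrinking* $V$ of $W$ consists of open invariant $V_x\subset W_x$ such that $x$ stays in the coverage of the restricted chart $x$, the coverages still cover $X$, and coverages which meet for $W$ still meet for $V$. It is *precompact* if moreover $\overline{V_x}$ is compact, contained in $W_x$, and $V_x=\operatorname{int}\overline{V_x}$.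 Let $U$ be a shrinking of $\mathcal A$ with compact closures $\overline{U_x}\subset A_x$ that is *strongly intersecting* (if points of $U_y$ and $U_x$ are identified in $M(\mathcal A)$, the coverages of $U_y$ and $U_x$ meet) and *Hausdorff* ($M(U)$ is Hausdorff in the relative topology with respect to $\mathcal A$). **Level-1 structure.** Let $U'$ be a precompact shrinking of $U$, and put $U'_{xy}=\{z\in U'_y\cap\operatorname{dom}\phi_{xy}:\phi_{xy}(z)\in U'_x\}$; define $U_{xy}$ likewise from $U$. A level-1 structure on $U'$ for $U$ assigns to each $(y,x)\in I$: * an open neighbourhood $W'_{xy}\subset U'_x$ of $\phi_{xy}(U'_{xy})$ and a $G_y$-equivariant retraction $\pi_{xy}:W'_{xy}\to\phi_{xy}(U'_{xy})$ that is equivariantly diffeomorphic, over the base, to a smooth vector bundle with fibrewise linear action. $W'_{xy}$ contains no zeros of $s_x$ off $\phi_{xy}(U'_{xy})$, and the closures in $U'_x$ of the distinct $G_x$-translates of $W'_{xy}$ are disjoint. $W'_{xy}$ is a *strong open neighbourhood*: $\overline{U'_{xy}}$ is compact, $U'_{xy}$ is the interior of its closure, and $\pi_{xy}$ extends to such a vector-bundle-like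 retraction $\hat\pi:\hat W\to\phi_{xy}(V)$ with $\hat W\subset U_x$ open and $V$ open, $\overline{U'_{xy}}\subset V\subset U_{xy}$, so that $W'_{xy}=\hat\pi^{-1}(\phi_{xy}(U'_{xy}))$ and, over $\phi_{xy}(V\cap U'_y)$, $\hat W\cap U'_x=W'_{xy}$; * an invariant subbundle $\tilde E_{xy}\subset E_x|_{W'_{xy}}$ with $\tilde E_{xy}=\hat\phi_{xy}(E_y)$ over $\phi_{xy}(U'_{xy})$, and an equivariant fibrewise isomorphic bundle map $\tilde\pi_{xy}:\tilde E_{xy}\to\hat\phi_{xy}(E_y|_{U'_{xy}})$ covering $\pi_{xy}$ which is the identity over $\phi_{xy}(U'_{xy})$, such that the zero set of $s_x/\tilde E_{xy}$ on $W'_{xy}$ is exactly $\phi_{xy}(U'_{xy})$ and $s_x/\tilde E_{xy}$ is transverse there; * an equivariant smooth fibrewise projection $\hat\pi_{xy}:E_x|_{W'_{xy}}\to\tilde E_{xy}$. Whenever $(z,y),(y,x),(z,x)\in I$, there is $h\in G_x$ with $\hat\phi_{xy}\hat\phi_{yz}=h\hat\phi_{xz}$ over the common domain of the coordinate changes restricted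 to $U'$ and such that, where both sides are defined, and after translating the data of $(z,x)$ by $h$ and pushing those of $(z,y)$ forward by $\phi_{xy},\hat\phi_{xy}$: $\pi_{yz}\circ\pi_{xy}=\pi_{xz}$; $\tilde\pi_{xy}^{-1}(\tilde E_{yz})=\tilde E_{xz}$; $\tilde\pi_{yz}\circ\tilde\pi_{xy}=\tilde\pi_{xz}$ on it; $\pi_{xy}^{-1}\pi_{yz}^{-1}$ and $\pi_{xz}^{-1}$ of the image of $U'_{xz}\cap U'_{yz}$ coincide; and the pull-back of $\hat\pi_{yz}$ by $\tilde\pi_{xy}$, composed with $\hat\pi_{xy}$, is $\hat\pi_{xz}$. **Multisections.** A multisection of $E\to U$ over an open set is a function $\Lambda:E\to\mathbb Q$ locally of the form $\Lambda(e_z)=\sum_{i:\,t_i(z)=e_z}q_i$ with finitely many smooth local sections $t_i$ (the branches) and rational weights $q_i>0$, $\sum q_i=1$. The multisection $s+\Lambda$ is *transverse* if near every point it has branches $s+t_i$ whose linearizations at all of their zeros are surjective. The *lift* $(\pi_{xy},\tilde\pi_{xy})^*\Lambda$ of a multisection $\Lambda$ of $E_y|_{U'_{xy}}$ assigns to $e\in\tilde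 E_{xy}$ the weight $\Lambda(\hat\phi_{xy}^{-1}\tilde\pi_{xy}(e))$, and weight $0$ to the vectors of $E_x|_{W'_{xy}}$ outside $\tilde E_{xy}$. **Theorem.** Let $U'$ carry a level-1 structure for $U$ as above. 1. For every $(y,x)\in I$ and every multisection $\tau$ of $E_y|_{U'_{xy}}$: if $s_y+\tau$ is transverse over $U'_{xy}$, then $(\pi_{xy},\tilde\pi_{xy})^*\tau$ is a multisection over $W'_{xy}$ and $s_x+(\pi_{xy},\tilde\pi_{xy})^*\tau$ is transverse over $W'_{xy}$. 2. There is a precompact shrinking $U''$ of $U'$ which admits arbitrarily small compact invariant transverse multisectional perturbations lifted along the level-1 structure. That is, for any open neighbourhoods $O_x\subset E_x$ of the zero sections, $x\in S$, there are multisections $\Lambda_x$ of $E_x|_{U''_x}$ all of whose branches take values in $O_x$, such that (a) $\Lambda_x$ is $G_x$-invariant and $\Lambda_x\circ\hat\phi_{xy}=\Lambda_y$ over $U''_{xy}=\{z\in U''_y\cap\operatorname{dom}\phi_{xy}:\phi_{xy}(z)\in U''_x\}$ for all $(y,x)\in I$; (b) $s_x+\Lambda_x$ is transverse over $U''_x$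 for every $x$; (c) for every $(y,x)\in I$, $\Lambda_x=(\pi_{xy},\tilde\pi_{xy})^*\Lambda_y$ on an open neighbourhood $N\subset W'_{xy}\cap U''_x$ of $\phi_{xy}(U''_{xy})$ with $\pi_{xy}(N)\subset\phi_{xy}(U''_{xy})$; (d) the solution set, that is the set of classes in $M(U'')$ of the points $z\in U''_x$ at which some branch of $s_x+\Lambda_x$ vanishes, is compact in the relative topology of $M(U'')$ with respect to $U'$. No orientation is needed; in particular this applies to oriented good coordinate systems. -/

import Mathlib

open Bundle Set Filter Topology
open scoped Manifold ContDiff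

noncomputable section

namespace Kuranishi

universe u

/-! ### Manifolds with corners, smooth vector bundles, linearization at a zero -/

/-- The model of an `n`-manifold with corners: relatively open subsets of `[0,∞)^n`.
Relatively open subsets of `[0,∞)^m × ℝ^(n-m)` are locally of this form. -/
abbrev cornerModel (n : ℕ) :
    ModelWithCorners ℝ (EuclideanSpace ℝ (Fin n)) (EuclideanQuadrant n) :=
  modelWithCornersEuclideanQuadrant n

/-- A smooth real vector bundle of finite rank over an `n`-manifold with corners `M`. -/
structure SmoothVectorBundle (n : ℕ) (M : Type u) [TopologicalSpace M]
    [ChartedSpace (EuclideanQuadrant n) M] where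
  rank : ℕ
  Fib : M → Type u
  instAddCommGroup : ∀ z, AddCommGroup (Fib z)
  instModule : ∀ z, Module ℝ (Fib z)
  instTopFib : ∀ z, TopologicalSpace (Fib z)
  instTopTot : TopologicalSpace (TotalSpace (EuclideanSpace ℝ (Fin rank)) Fib)
  instFiberBundle : FiberBundle (EuclideanSpace ℝ (Fin rank)) Fib
  instVectorBundle : VectorBundle ℝ (EuclideanSpace ℝ (Fin rank)) Fib
  instSmooth : ContMDiffVectorBundle ∞ (EuclideanSpace ℝ (Fin rank)) Fib (cornerModel n)

attribute [instance] SmoothVectorBundle.instAddCommGroup SmoothVectorBundle.instModule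
  SmoothVectorBundle.instTopFib SmoothVectorBundle.instTopTot SmoothVectorBundle.instFiberBundle
  SmoothVectorBundle.instVectorBundle SmoothVectorBundle.instSmooth

section Bundles

variable {n : ℕ} {M : Type u} [TopologicalSpace M] [ChartedSpace (EuclideanQuadrant n) M]

/-- The model fibre. -/
abbrev SmoothVectorBundle.Model (B : SmoothVectorBundle n M) : Type :=
  EuclideanSpace ℝ (Fin B.rank)

/-- The total space. -/
abbrev SmoothVectorBundle.Tot (B : SmoothVectorBundle n M) : Type u :=
  TotalSpace B.Model B.Fib

/-- The model with corners of the total space. -/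
abbrev SmoothVectorBundle.totModel (B : SmoothVectorBundle n M) :
    ModelWithCorners ℝ (EuclideanSpace ℝ (Fin n) × B.Model)
      (ModelProd (EuclideanQuadrant n) B.Model) :=
  (cornerModel n).prod (modelWithCornersSelf ℝ B.Model)

/-- A section, regarded as a map into the total space. -/
def SmoothVectorBundle.toTot (B : SmoothVectorBundle n M) (s : ∀ z, B.Fib z) (z : M) : B.Tot :=
  ⟨z, s z⟩

/-- Smoothness of a section on a set. -/
def SmoothVectorBundle.SmoothOn (B : SmoothVectorBundle n M) (s : ∀ z, B.Fib z) (D : Set M) :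
    Prop :=
  ContMDiffOn (cornerModel n) B.totModel ∞ (B.toTot s) D

/-- The linearization `T_z M → E_z` of a section `s` at `z`, computed in the preferred local
trivialization around `z`. It is used only at points `z` with `s z = 0`, where it does not depend
on the trivialization. -/
def SmoothVectorBundle.linearization (B : SmoothVectorBundle n M) (s : ∀ z, B.Fib z) (z : M) :
    TangentSpace (cornerModel n) z → B.Fib z :=
  fun v => (trivializationAt B.Model B.Fib z).symmL ℝ z
    (mfderiv (cornerModel n) (modelWithCornersSelf ℝ B.Model)
      (fun w => ((trivializationAt B.Model B.Fib z) (B.toTot s w)).2) z v : B.Model)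

end Bundles

/-! ### Kuranishi charts and coordinate changes -/

/-- A Kuranishi chart of `X`: a finite group acting smoothly and effectively on a finite rank
vector bundle over a manifold with corners, an equivariant smooth section `s`, and a map `ψ` from
the zeros of `s` to `X` which descends to a homeomorphism from the orbit space of the zeros onto
an open subset of `X`. -/
structure KuranishiChart (X : Type u) [TopologicalSpace X] where
  dim : ℕ
  Base : Type u
  instTop : TopologicalSpace Base
  instT2 : T2Space Base
  instSecond : SecondCountableTopology Base
  instCharted : ChartedSpace (EuclideanQuadrant dim) Base
  instManifold : IsManifold (cornerModel dim) ∞ Base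
  bundle : SmoothVectorBundle dim Base
  Grp : Type u
  instGroup : Group Grp
  instFinite : Finite Grp
  actBase : MulAction Grp Base
  actTot : MulAction Grp bundle.Tot
  proj_smul : ∀ (g : Grp) (v : bundle.Tot), (g • v).proj = g • v.proj
  smul_linear : ∀ (g : Grp) (z : Base), ∃ L : bundle.Fib z →ₗ[ℝ] bundle.Fib (g • z),
    ∀ e, g • (⟨z, e⟩ : bundle.Tot) = ⟨g • z, L e⟩
  smul_smooth : ∀ g : Grp,
    ContMDiff (cornerModel dim) (cornerModel dim) ∞ (fun z : Base => g • z)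
  smul_smooth_tot : ∀ g : Grp,
    ContMDiff bundle.totModel bundle.totModel ∞ (fun v : bundle.Tot => g • v)
  effective : ∀ g : Grp, (∀ v : bundle.Tot, g • v = v) → g = 1
  s : ∀ z, bundle.Fib z
  s_smooth : bundle.SmoothOn s univ
  s_equivariant : ∀ (g : Grp) (z : Base), g • bundle.toTot s z = bundle.toTot s (g • z)
  ψ : {z : Base // s z = 0} → X
  ψ_continuous : Continuous ψ
  ψ_open : IsOpenMap ψ
  ψ_eq_iff : ∀ z w : {z : Base // s z = 0}, ψ z = ψ w ↔ ∃ g : Grp, w.1 = g • z.1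

attribute [instance] KuranishiChart.instTop KuranishiChart.instT2 KuranishiChart.instSecond
  KuranishiChart.instCharted KuranishiChart.instManifold KuranishiChart.instGroup
  KuranishiChart.instFinite KuranishiChart.actBase KuranishiChart.actTot

section Charts

variable {X : Type u} [TopologicalSpace X]

abbrev KuranishiChart.Fib (C : KuranishiChart X) : C.Base → Type u := C.bundle.Fib

abbrev KuranishiChart.Tot (C : KuranishiChart X) : Type u := C.bundle.Tot

/-- The dimension of the total space of the bundle. -/
def KuranishiChart.dimE (C : KuranishiChart X) : ℕ := C.dim + C.bundle.rank

/-- The coverage on `X` by the chart restricted to `V`. -/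
def KuranishiChart.footprint (C : KuranishiChart X) (V : Set C.Base) : Set X :=
  C.ψ '' {z | z.1 ∈ V}

/-- Invariance of a subset of the base under the group of the chart. -/
def KuranishiChart.Invariant (C : KuranishiChart X) (V : Set C.Base) : Prop :=
  ∀ (g : C.Grp), ∀ z ∈ V, g • z ∈ V

/-- A coordinate change `Cy → Cx` between charts of `X`. Outside `dom` the values of `φ` and `Φ`
are irrelevant. -/
structure CoordChange (Cy Cx : KuranishiChart X) where
  dom : Set Cy.Base
  dom_open : IsOpen dom
  dom_invariant : Cy.Invariant dom
  φ : Cy.Base → Cx.Base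
  Φ : ∀ z, Cy.Fib z →ₗ[ℝ] Cx.Fib (φ z)
  ρ : Cy.Grp →* Cx.Grp
  ρ_injective : Function.Injective ρ
  φ_smooth : ContMDiffOn (cornerModel Cy.dim) (cornerModel Cx.dim) ∞ φ dom
  φ_immersion : ∀ z ∈ dom,
    Function.Injective (mfderiv (cornerModel Cy.dim) (cornerModel Cx.dim) φ z)
  φ_embedding : IsEmbedding (dom.domRestrict φ)
  Φ_smooth : ContMDiffOn Cy.bundle.totModel Cx.bundle.totModel ∞
    (fun v : Cy.Tot => (⟨φ v.proj, Φ v.proj v.2⟩ : Cx.Tot)) {v | v.proj ∈ dom}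
  Φ_injective : ∀ z ∈ dom, Function.Injective (Φ z)
  φ_equivariant : ∀ (h : Cy.Grp), ∀ z ∈ dom, φ (h • z) = ρ h • φ z
  Φ_equivariant : ∀ (h : Cy.Grp) (v : Cy.Tot), v.proj ∈ dom →
    (⟨φ (h • v).proj, Φ (h • v).proj (h • v).2⟩ : Cx.Tot) =
      ρ h • (⟨φ v.proj, Φ v.proj v.2⟩ : Cx.Tot)
  quotient_injective : ∀ z ∈ dom, ∀ z' ∈ dom, ∀ g : Cx.Grp, φ z = g • φ z' →
    ∃ h : Cy.Grp, z = h • z'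
  stabilizer_surjective : ∀ z ∈ dom, ∀ g : Cx.Grp, g • φ z = φ z →
    ∃ h : Cy.Grp, h • z = z ∧ ρ h = g
  section_comp : ∀ z ∈ dom, Φ z (Cy.s z) = Cx.s (φ z)
  ψ_comp : ∀ (z : {z // Cy.s z = 0}) (w : {w // Cx.s w = 0}), z.1 ∈ dom → w.1 = φ z.1 →
    Cx.ψ w = Cy.ψ z
  overlap_subset_dom : ∀ z : {z // Cy.s z = 0}, Cy.ψ z ∈ Cx.footprint univ → z.1 ∈ dom
  /-- Tangent bundle condition, surjectivity of the normal linearization. -/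
  tangent_surjective : ∀ z ∈ dom, Cy.s z = 0 → ∀ e : Cx.Fib (φ z),
    ∃ (v : TangentSpace (cornerModel Cx.dim) (φ z)) (w : Cy.Fib z),
      e = Cx.bundle.linearization Cx.s (φ z) v + Φ z w
  /-- Tangent bundle condition, injectivity of the normal linearization. -/
  tangent_injective : ∀ z ∈ dom, Cy.s z = 0 → ∀ v : TangentSpace (cornerModel Cx.dim) (φ z),
    Cx.bundle.linearization Cx.s (φ z) v ∈ LinearMap.range (Φ z) →
      ∃ u : TangentSpace (cornerModel Cy.dim) z,
        mfderiv (cornerModel Cy.dim) (cornerModel Cx.dim) φ z u = v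

/-- The bundle embedding of a coordinate change as a map of total spaces. -/
def CoordChange.hat {Cy Cx : KuranishiChart X} (c : CoordChange Cy Cx) (v : Cy.Tot) : Cx.Tot :=
  ⟨c.φ v.proj, c.Φ v.proj v.2⟩

/-- The domain of the coordinate change restricted to the open sets `Vy` and `Vx`. -/
def CoordChange.domIn {Cy Cx : KuranishiChart X} (c : CoordChange Cy Cx) (Vy : Set Cy.Base)
    (Vx : Set Cx.Base) : Set Cy.Base :=
  {z | z ∈ Vy ∧ z ∈ c.dom ∧ c.φ z ∈ Vx}

end Charts

/-! ### Good coordinate systems -/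

/-- A finite set `S ⊆ X` with a non-antisymmetric total order, and Kuranishi charts indexed by
`S` which cover `X`. -/
structure ChartSystem (X : Type u) [TopologicalSpace X] where
  S : Set X
  S_finite : S.Finite
  le : S → S → Prop
  le_refl : ∀ x, le x x
  le_trans : ∀ x y z, le x y → le y z → le x z
  le_total : ∀ x y, le x y ∨ le y x
  chart : S → KuranishiChart X
  base_point : ∀ x : S, (x : X) ∈ (chart x).footprint univ
  cover : ∀ q : X, ∃ x : S, q ∈ (chart x).footprint univ
  le_of_dim_lt : ∀ y x : S, (chart y).dimE < (chart x).dimE → le y x ∧ ¬ le x y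

section Systems

variable {X : Type u} [TopologicalSpace X]

/-- The pairs of indices for which a coordinate change is given. -/
def ChartSystem.I (A : ChartSystem X) (y x : A.S) : Prop :=
  A.le y x ∧ ((A.chart y).footprint univ ∩ (A.chart x).footprint univ).Nonempty

/-- Points of the disjoint union of the bases. -/
abbrev ChartSystem.Pt (A : ChartSystem X) : Type u := Σ x : A.S, (A.chart x).Base

/-- A family of subsets of the bases. -/
abbrev ChartSystem.Fam (A : ChartSystem X) : Type u := ∀ x : A.S, Set (A.chart x).Base

/-- One elementary identification between points of `V`: by a group element of a chart, or by a
coordinate change. -/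
inductive Step (A : ChartSystem X) (chg : ∀ y x, A.I y x → CoordChange (A.chart y) (A.chart x))
    (V : A.Fam) : A.Pt → A.Pt → Prop
  | grp (x : A.S) (g : (A.chart x).Grp) (z : (A.chart x).Base) (hz : z ∈ V x)
      (hgz : g • z ∈ V x) : Step A chg V ⟨x, z⟩ ⟨x, g • z⟩
  | coord (y x : A.S) (h : A.I y x) (z : (A.chart y).Base) (hz : z ∈ V y)
      (hdom : z ∈ (chg y x h).dom) (hφ : (chg y x h).φ z ∈ V x) :
      Step A chg V ⟨y, z⟩ ⟨x, (chg y x h).φ z⟩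

/-- A good coordinate system for `X`. -/
structure GoodCoordinateSystem (X : Type u) [TopologicalSpace X] extends ChartSystem X where
  chg : ∀ y x, toChartSystem.I y x → CoordChange (chart y) (chart x)
  compatible : ∀ (z y x : S) (hzy : toChartSystem.I z y) (hyx : toChartSystem.I y x)
    (hzx : toChartSystem.I z x), ∃ h : (chart x).Grp, ∀ v : (chart z).Tot,
      v.proj ∈ (chg z x hzx).dom → v.proj ∈ (chg z y hzy).dom →
      (chg z y hzy).φ v.proj ∈ (chg y x hyx).dom →
      (chg y x hyx).hat ((chg z y hzy).hat v) = h • (chg z x hzx).hat v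
  maximality : ∀ (y x : S) (hyx : toChartSystem.I y x) (z₁ : (chart y).Base)
    (z₂ : (chart x).Base),
    Relation.EqvGen (Step toChartSystem chg (fun _ => univ)) ⟨y, z₁⟩ ⟨x, z₂⟩ →
      z₁ ∈ (chg y x hyx).dom ∧ ∃ g : (chart x).Grp, z₂ = g • (chg y x hyx).φ z₁
  topological_matching : ∀ (y x : S) (v : (chart y).Base) (v' : (chart x).Base),
    (chart y).s v = 0 → (chart x).s v' = 0 →
    (∃ (a : ℕ → (chart y).Base) (b : ℕ → (chart x).Base),
      Tendsto a atTop (𝓝 v) ∧ Tendsto b atTop (𝓝 v') ∧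
      ∀ k, Relation.EqvGen (Step toChartSystem chg (fun _ => univ)) ⟨y, a k⟩ ⟨x, b k⟩) →
    Relation.EqvGen (Step toChartSystem chg (fun _ => univ)) ⟨y, v⟩ ⟨x, v'⟩

namespace GoodCoordinateSystem

variable (A : GoodCoordinateSystem X)

/-- The family of all bases. -/
def full : A.Fam := fun _ => univ

/-- The identification of points of `V` generated by the group actions and the coordinate changes
restricted to `V`. -/
def Ident (V : A.Fam) : A.Pt → A.Pt → Prop :=
  Relation.EqvGen (Step A.toChartSystem A.chg V)

/-- Points of the disjoint union of the members of `V`. -/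
abbrev PtIn (V : A.Fam) : Type u := {p : A.Pt // p.2 ∈ V p.1}

/-- The identification on the points of `V`, as a setoid. -/
def identSetoid (V : A.Fam) : Setoid (A.PtIn V) where
  r p q := A.Ident V p.1 q.1
  iseqv := ⟨fun p => Relation.EqvGen.refl p.1, fun h => Relation.EqvGen.symm _ _ h,
    fun h h' => Relation.EqvGen.trans _ _ _ h h'⟩

/-- The identification space `M(V)`. -/
def IdSpace (V : A.Fam) : Type u := Quotient (A.identSetoid V)

/-- The class of a point of `V` in `M(V)`. -/
def toId (V : A.Fam) (p : A.PtIn V) : A.IdSpace V := Quotient.mk (A.identSetoid V) p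

theorem Step_mono {V W : A.Fam} (h : ∀ x, V x ⊆ W x) {p q : A.Pt}
    (hpq : Step A.toChartSystem A.chg V p q) : Step A.toChartSystem A.chg W p q := by
  cases hpq with
  | grp x g z hz hgz => exact Step.grp x g z (h x hz) (h x hgz)
  | coord y x hI z hz hd hφ => exact Step.coord y x hI z (h y hz) hd (h x hφ)

theorem Ident_mono {V W : A.Fam} (h : ∀ x, V x ⊆ W x) {p q : A.Pt} (hpq : A.Ident V p q) :
    A.Ident W p q := by
  induction hpq with
  | rel _ _ h' => exact Relation.EqvGen.rel _ _ (A.Step_mono h h')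
  | refl _ => exact Relation.EqvGen.refl _
  | symm _ _ _ ih => exact Relation.EqvGen.symm _ _ ih
  | trans _ _ _ _ _ ih₁ ih₂ => exact Relation.EqvGen.trans _ _ _ ih₁ ih₂

/-- The natural map `M(V) → M(W)` for `V ⊆ W`. -/
def natMap {V W : A.Fam} (h : ∀ x, V x ⊆ W x) : A.IdSpace V → A.IdSpace W :=
  Quotient.map (fun p : A.PtIn V => (⟨p.1, h p.1.1 p.2⟩ : A.PtIn W))
    (fun p q (hpq : A.Ident V p.1 q.1) => (Ident_mono A h hpq : A.Ident W p.1 q.1))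

/-- The quotient topology of `M(W)`. -/
abbrev quotTop (W : A.Fam) : TopologicalSpace (A.IdSpace W) :=
  TopologicalSpace.coinduced (A.toId W) inferInstance

/-- The relative topology of `M(V)` with respect to `W ⊇ V`: the one induced from the quotient
topology of `M(W)`. -/
abbrev relTop {V W : A.Fam} (h : ∀ x, V x ⊆ W x) : TopologicalSpace (A.IdSpace V) :=
  TopologicalSpace.induced (A.natMap h) (A.quotTop W)

/-- `V` is a shrinking of `W`; the charts restricted to `V`, with the restricted coordinate
changes, then form a good coordinate system with the same index pairs. -/
structure IsShrinking (V W : A.Fam) : Prop where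
  subset : ∀ x, V x ⊆ W x
  isOpen : ∀ x, IsOpen (V x)
  invariant : ∀ x, (A.chart x).Invariant (V x)
  base_point : ∀ x : A.S, (x : X) ∈ (A.chart x).footprint (V x)
  cover : ∀ q : X, ∃ x : A.S, q ∈ (A.chart x).footprint (V x)
  overlap : ∀ y x : A.S, ((A.chart y).footprint (W y) ∩ (A.chart x).footprint (W x)).Nonempty →
    ((A.chart y).footprint (V y) ∩ (A.chart x).footprint (V x)).Nonempty

/-- A precompact shrinking: moreover the closure of each `V x` in the base is compact and contained
in `W x`, and `V x` is the interior of its closure. -/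
structure IsPrecompactShrinking (V W : A.Fam) : Prop extends A.IsShrinking V W where
  compact : ∀ x, IsCompact (closure (V x))
  closure_subset : ∀ x, closure (V x) ⊆ W x
  regular : ∀ x, interior (closure (V x)) = V x

/-- `U` is strongly intersecting: if points of two charts of `U` are identified in `M(A)`, then the
coverages of the two charts meet. -/
def StronglyIntersecting (U : A.Fam) : Prop :=
  ∀ (y x : A.S), ∀ a ∈ U y, ∀ b ∈ U x, A.Ident A.full ⟨y, a⟩ ⟨x, b⟩ →
    ((A.chart y).footprint (U y) ∩ (A.chart x).footprint (U x)).Nonempty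

/-- `U` is Hausdorff: `M(U)` is Hausdorff in the relative topology with respect to `A`. -/
def IsHausdorff (U : A.Fam) : Prop :=
  @T2Space (A.IdSpace U) (A.relTop (V := U) (W := A.full) (fun _ => subset_univ _))

/-- The domain of the coordinate change restricted to `V`. -/
def domIn (V : A.Fam) (y x : A.S) (h : A.I y x) : Set (A.chart y).Base :=
  (A.chg y x h).domIn (V y) (V x)

end GoodCoordinateSystem

end Systems

/-! ### Level-1 coordinate changes -/

section LevelOne

variable {X : Type u} [TopologicalSpace X]

/-- `p : W → V` is a vector-bundle-like submersion, equivariantly with respect to `ρ`: a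
diffeomorphism over `V` identifies it with the projection of a smooth vector bundle `N → V` on
which the group acts fibrewise linearly. -/
def IsVectorBundleLike (Cy Cx : KuranishiChart X) (ρ : Cy.Grp →* Cx.Grp)
    (V : TopologicalSpace.Opens Cy.Base) (W : Set Cx.Base) (p : Cx.Base → Cy.Base) : Prop :=
  ∃ (N : SmoothVectorBundle Cy.dim V) (Θ : N.Tot → Cx.Base) (Ξ : Cx.Base → N.Tot),
    ContMDiff N.totModel (cornerModel Cx.dim) ∞ Θ ∧
    ContMDiffOn (cornerModel Cx.dim) N.totModel ∞ Ξ W ∧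
    (∀ v, Θ v ∈ W ∧ Ξ (Θ v) = v) ∧
    (∀ w ∈ W, Θ (Ξ w) = w) ∧
    (∀ v, p (Θ v) = (v.proj : Cy.Base)) ∧
    ∀ (h : Cy.Grp) (z : V), ∃ (hz : h • (z : Cy.Base) ∈ V)
      (L : N.Fib z →ₗ[ℝ] N.Fib ⟨h • (z : Cy.Base), hz⟩),
      ∀ e, ρ h • Θ ⟨z, e⟩ = Θ ⟨⟨h • (z : Cy.Base), hz⟩, L e⟩

/-- The data of a level-1 coordinate change over `c`: the neighbourhood `W` of the image of `φ`,
the composite `p = φ⁻¹ ∘ π` of the submersion `π` with the inverse of `φ`, the subbundle `sub = Ẽ`,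
the composite `T = Φ⁻¹ ∘ π̃` of `π̃ : Ẽ → im Φ` with the inverse of `Φ` (only its values on `sub`
matter), and the projection `Q = π̂` onto `sub`. -/
structure LevelOneData {Cy Cx : KuranishiChart X} (c : CoordChange Cy Cx) where
  W : Set Cx.Base
  p : Cx.Base → Cy.Base
  sub : ∀ w, Submodule ℝ (Cx.Fib w)
  T : ∀ w, Cx.Fib w →ₗ[ℝ] Cy.Fib (p w)
  Q : ∀ w, Cx.Fib w →ₗ[ℝ] Cx.Fib w

namespace LevelOneData

variable {Cy Cx : KuranishiChart X} {c : CoordChange Cy Cx} (L : LevelOneData c)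

/-- The vector `v` lies in the subbundle `Ẽ`. -/
def InSub (v : Cx.Tot) : Prop := v.proj ∈ L.W ∧ v.2 ∈ L.sub v.proj

/-- `T` as a map of total spaces. -/
def hatT (v : Cx.Tot) : Cy.Tot := ⟨L.p v.proj, L.T v.proj v.2⟩

/-- `Q` as a map of total spaces. -/
def hatQ (v : Cx.Tot) : Cx.Tot := ⟨v.proj, L.Q v.proj v.2⟩

open Classical in
/-- The lift of a multisection (given by its weight function) along the level-1 structure: the
weight of `e ∈ Ẽ` is the weight of `T e`, and vectors outside `Ẽ` have weight zero. A
single-valued section `τ` is lifted to `w ↦ (T w)⁻¹ (τ (p w)) ∈ Ẽ`. -/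
def lift (Λ : Cy.Tot → ℚ) (v : Cx.Tot) : ℚ := if L.InSub v then Λ (L.hatT v) else 0

end LevelOneData

/-- `(Ux', Ux, W)` is a strong open neighbourhood of `φ (dom')`, where `dom'` and `dom` are the
domains of the coordinate change restricted to `Uy', Ux'` and to `Uy, Ux`. -/
def IsStrongNeighborhood {Cy Cx : KuranishiChart X} {c : CoordChange Cy Cx} (L : LevelOneData c)
    (Uy Uy' : Set Cy.Base) (Ux Ux' : Set Cx.Base) : Prop :=
  IsCompact (closure (c.domIn Uy' Ux')) ∧
  interior (closure (c.domIn Uy' Ux')) = c.domIn Uy' Ux' ∧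
  ∃ (V : TopologicalSpace.Opens Cy.Base) (What : Set Cx.Base) (phat : Cx.Base → Cy.Base),
    closure (c.domIn Uy' Ux') ⊆ V ∧ (V : Set Cy.Base) ⊆ c.domIn Uy Ux ∧
    IsOpen What ∧ What ⊆ Ux ∧
    IsVectorBundleLike Cy Cx c.ρ V What phat ∧
    (∀ z ∈ V, c.φ z ∈ What ∧ phat (c.φ z) = z) ∧
    (∀ w ∈ L.W, phat w = L.p w) ∧
    L.W = {w | w ∈ What ∧ phat w ∈ c.domIn Uy' Ux'} ∧
    ∀ w ∈ What, phat w ∈ Uy' → (w ∈ Ux' ↔ phat w ∈ c.domIn Uy' Ux')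

/-- `L` is a level-1 coordinate change over the restriction of `c` to `Uy', Ux'`, where `Uy', Ux'`
is a precompact shrinking of `Uy, Ux`. -/
structure IsLevelOneChange {Cy Cx : KuranishiChart X} {c : CoordChange Cy Cx} (L : LevelOneData c)
    (Uy Uy' : Set Cy.Base) (Ux Ux' : Set Cx.Base) : Prop where
  W_open : IsOpen L.W
  W_subset : L.W ⊆ Ux'
  image_mem : ∀ z ∈ c.domIn Uy' Ux', c.φ z ∈ L.W ∧ L.p (c.φ z) = z
  p_mem : ∀ w ∈ L.W, L.p w ∈ c.domIn Uy' Ux'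
  W_invariant : ∀ (h : Cy.Grp), ∀ w ∈ L.W, c.ρ h • w ∈ L.W
  p_equivariant : ∀ (h : Cy.Grp), ∀ w ∈ L.W, L.p (c.ρ h • w) = h • L.p w
  vector_bundle_like : ∃ V : TopologicalSpace.Opens Cy.Base,
    (V : Set Cy.Base) = c.domIn Uy' Ux' ∧ IsVectorBundleLike Cy Cx c.ρ V L.W L.p
  strong : IsStrongNeighborhood L Uy Uy' Ux Ux'
  no_other_zeros : ∀ w ∈ L.W, Cx.s w = 0 → w ∈ c.φ '' c.domIn Uy' Ux'
  /-- The closures in `Ux'` of the distinct translates of `W` are disjoint. -/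
  sheets : ∀ g : Cx.Grp, g ∉ c.ρ.range →
    Disjoint (closure L.W ∩ Ux') (closure ((fun w => g • w) '' L.W) ∩ Ux')
  /-- `Q` is a smooth fibrewise projection onto `Ẽ`; so `Ẽ` is a smooth subbundle. -/
  Q_mem : ∀ w ∈ L.W, ∀ e, L.Q w e ∈ L.sub w
  Q_of_mem : ∀ w ∈ L.W, ∀ e ∈ L.sub w, L.Q w e = e
  Q_smooth : ContMDiffOn Cx.bundle.totModel Cx.bundle.totModel ∞ L.hatQ {v | v.proj ∈ L.W}
  Q_equivariant : ∀ (h : Cy.Grp) (v : Cx.Tot), v.proj ∈ L.W →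
    L.hatQ (c.ρ h • v) = c.ρ h • L.hatQ v
  sub_invariant : ∀ (h : Cy.Grp) (v : Cx.Tot), L.InSub v → L.InSub (c.ρ h • v)
  T_bijective : ∀ w ∈ L.W, Function.Bijective ((L.T w).domRestrict (L.sub w))
  T_smooth : ContMDiffOn Cx.bundle.totModel Cy.bundle.totModel ∞ (fun v => L.hatT (L.hatQ v))
    {v | v.proj ∈ L.W}
  T_equivariant : ∀ (h : Cy.Grp) (v : Cx.Tot), L.InSub v → L.hatT (c.ρ h • v) = h • L.hatT v
  sub_image : ∀ z ∈ c.domIn Uy' Ux', L.sub (c.φ z) = LinearMap.range (c.Φ z)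
  T_image : ∀ v : Cy.Tot, v.proj ∈ c.domIn Uy' Ux' → L.hatT (c.hat v) = v
  /-- The zero set of the quotient section `s / Ẽ` is exactly `φ (dom')`. -/
  quotient_zeros : ∀ w ∈ L.W, Cx.s w ∈ L.sub w ↔ w ∈ c.φ '' c.domIn Uy' Ux'
  /-- The linearization of `s / Ẽ` at its zeros is surjective. The quotient `E / Ẽ` is identified
  with the kernel of `Q`, and `s / Ẽ` with the section `s - Q s`. -/
  quotient_transverse : ∀ z ∈ c.domIn Uy' Ux', ∀ e : Cx.Fib (c.φ z),
    ∃ v : TangentSpace (cornerModel Cx.dim) (c.φ z),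
      e - Cx.bundle.linearization (fun w => Cx.s w - L.Q w (Cx.s w)) (c.φ z) v ∈ L.sub (c.φ z)

/-- Compatibility of three level-1 coordinate changes `Cz → Cy`, `Cy → Cx` and `Cz → Cx` over the
restrictions of the coordinate changes to `Uz, Uy, Ux`. -/
def LevelOneCompatible {Cz Cy Cx : KuranishiChart X} {czy : CoordChange Cz Cy}
    {cyx : CoordChange Cy Cx} {czx : CoordChange Cz Cx} (Lzy : LevelOneData czy)
    (Lyx : LevelOneData cyx) (Lzx : LevelOneData czx)
    (Uz : Set Cz.Base) (Uy : Set Cy.Base) (Ux : Set Cx.Base) : Prop :=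
  ∃ h : Cx.Grp,
    (∀ v : Cz.Tot, v.proj ∈ czx.domIn Uz Ux → v.proj ∈ czy.domIn Uz Uy →
      czy.φ v.proj ∈ cyx.domIn Uy Ux → cyx.hat (czy.hat v) = h • czx.hat v) ∧
    (∀ w ∈ Lyx.W, h⁻¹ • w ∈ Lzx.W → Lyx.p w ∈ Lzy.W →
      Lzy.p (Lyx.p w) = Lzx.p (h⁻¹ • w)) ∧
    (∀ v : Cx.Tot, v.proj ∈ Lyx.W → h⁻¹ • v.proj ∈ Lzx.W → Lyx.p v.proj ∈ Lzy.W →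
      ((Lyx.InSub v ∧ Lzy.InSub (Lyx.hatT v)) ↔ Lzx.InSub (h⁻¹ • v)) ∧
      (Lzx.InSub (h⁻¹ • v) → Lzy.hatT (Lyx.hatT v) = Lzx.hatT (h⁻¹ • v)) ∧
      Lyx.hatT (h • Lzx.hatQ (h⁻¹ • v)) = Lzy.hatQ (Lyx.hatT (Lyx.hatQ v))) ∧
    (∀ w : Cx.Base,
      (w ∈ Lyx.W ∧ Lyx.p w ∈ Lzy.W ∧ Lzy.p (Lyx.p w) ∈ czx.domIn Uz Ux) ↔
        (h⁻¹ • w ∈ Lzx.W ∧ Lzx.p (h⁻¹ • w) ∈ czy.domIn Uz Uy))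

/-- `L` makes `U'` a level-1 good coordinate system for `U`. -/
structure IsLevelOneSystem (A : GoodCoordinateSystem X) (U U' : A.Fam)
    (L : ∀ (y x : A.S) (h : A.I y x), LevelOneData (A.chg y x h)) : Prop where
  shrinking : A.IsPrecompactShrinking U' U
  change : ∀ (y x : A.S) (h : A.I y x), IsLevelOneChange (L y x h) (U y) (U' y) (U x) (U' x)
  compatible : ∀ (z y x : A.S) (hzy : A.I z y) (hyx : A.I y x) (hzx : A.I z x),
    LevelOneCompatible (L z y hzy) (L y x hyx) (L z x hzx) (U' z) (U' y) (U' x)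

end LevelOne

/-! ### Multisections -/

section Multisections

variable {n : ℕ} {M : Type u} [TopologicalSpace M] [ChartedSpace (EuclideanQuadrant n) M]

open Classical in
/-- On `O`, the weight function `Λ` is given by finitely many smooth branches `t i` with positive
rational weights `q i` of sum `1`. -/
def IsBranching (B : SmoothVectorBundle n M) (Λ : B.Tot → ℚ) (O : Set M) {k : ℕ}
    (t : Fin k → ∀ z, B.Fib z) (q : Fin k → ℚ) : Prop :=
  (∀ i, 0 < q i) ∧ ∑ i, q i = 1 ∧ (∀ i, B.SmoothOn (t i) O) ∧
  ∀ z ∈ O, ∀ e : B.Fib z, Λ ⟨z, e⟩ = ∑ i, if t i z = e then q i else 0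

/-- A smooth multisection over `D`: a rational weight function on the total space that is locally
given by finitely many weighted smooth branches. -/
def IsMultisectionOn (B : SmoothVectorBundle n M) (Λ : B.Tot → ℚ) (D : Set M) : Prop :=
  ∀ z ∈ D, ∃ (O : Set M) (k : ℕ) (t : Fin k → ∀ z, B.Fib z) (q : Fin k → ℚ),
    IsOpen O ∧ z ∈ O ∧ O ⊆ D ∧ IsBranching B Λ O t q

/-- The perturbed section `s + Λ` is transverse over `D`: it has local branches `s + t i` whose
linearizations are surjective at all of their zeros. -/
def IsTransverseOn (B : SmoothVectorBundle n M) (s : ∀ z, B.Fib z) (Λ : B.Tot → ℚ) (D : Set M) :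
    Prop :=
  ∀ z ∈ D, ∃ (O : Set M) (k : ℕ) (t : Fin k → ∀ z, B.Fib z) (q : Fin k → ℚ),
    IsOpen O ∧ z ∈ O ∧ O ⊆ D ∧ IsBranching B Λ O t q ∧
    ∀ w ∈ O, ∀ i, s w + t i w = 0 →
      Function.Surjective (B.linearization (fun w' => s w' + t i w') w)

end Multisections

section Perturbations

variable {X : Type u} [TopologicalSpace X]

/-- A family of weight functions, one on the bundle of each chart. -/
abbrev WeightFamily (A : GoodCoordinateSystem X) : Type u := ∀ x : A.S, (A.chart x).Tot → ℚ

/-- An invariant multisectional perturbation of the good coordinate system `V`: a multisection in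
each chart, invariant under the group of the chart, with weights preserved by the coordinate
changes. -/
structure IsInvariantPerturbation (A : GoodCoordinateSystem X) (V : A.Fam)
    (Λ : WeightFamily A) : Prop where
  multisection : ∀ x, IsMultisectionOn (A.chart x).bundle (Λ x) (V x)
  invariant : ∀ (x : A.S) (g : (A.chart x).Grp) (v : (A.chart x).Tot), v.proj ∈ V x →
    Λ x (g • v) = Λ x v
  coherent : ∀ (y x : A.S) (h : A.I y x) (v : (A.chart y).Tot), v.proj ∈ A.domIn V y x h →
    Λ x ((A.chg y x h).hat v) = Λ y v

/-- The perturbation is lifted along the level-1 structure `L` near the images of the coordinate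
changes of `V`. -/
def IsLiftedNearImages (A : GoodCoordinateSystem X) (V : A.Fam)
    (L : ∀ (y x : A.S) (h : A.I y x), LevelOneData (A.chg y x h)) (Λ : WeightFamily A) : Prop :=
  ∀ (y x : A.S) (h : A.I y x), ∃ N : Set (A.chart x).Base, IsOpen N ∧ N ⊆ (L y x h).W ∧
    N ⊆ V x ∧ (A.chg y x h).φ '' A.domIn V y x h ⊆ N ∧ (∀ w ∈ N, (L y x h).p w ∈ A.domIn V y x h) ∧
    ∀ v : (A.chart x).Tot, v.proj ∈ N → Λ x v = (L y x h).lift (Λ y) v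

/-- The values over `V` of all branches of the perturbation lie in the sets `O x`. -/
def IsControlledBy (A : GoodCoordinateSystem X) (V : A.Fam) (Λ : WeightFamily A)
    (O : ∀ x : A.S, Set (A.chart x).Tot) : Prop :=
  ∀ (x : A.S) (v : (A.chart x).Tot), v.proj ∈ V x → Λ x v ≠ 0 → v ∈ O x

/-- The solution set in `M(V)` of the perturbed sections `s + Λ`: the classes of the points at
which some branch of `s + Λ` vanishes. -/
def solutionSet (A : GoodCoordinateSystem X) (V : A.Fam) (Λ : WeightFamily A) :
    Set (A.IdSpace V) :=
  A.toId V '' {p | Λ p.1.1 ⟨p.1.2, -(A.chart p.1.1).s p.1.2⟩ ≠ 0}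

end Perturbations

end Kuranishi

end

/-!
# Transverse perturbations lifted along a level-1 structure

**Lifts.** Let `w` be a zero of `s_x` plus the lift of a branch `t`. The lift has values in `Ẽ`,
hence so has `s_x w`; since `φ (U'_{xy})` is the zero set of `s_x / Ẽ`, the point is `w = φ z` with
`s_y z + t z = 0`. The linearization at a zero is natural under bundle maps
(`IsBundleMapOn.linearization_apply`). Hence the image of the linearization at `w` contains the
image under `Φ` of that of `s_y + t` at `z`, which is `Φ (E_y) = Ẽ` if `s_y + t` is transverse.
Modulo `Ẽ` the linearization at `w` is that of `s_x / Ẽ`, which is surjective by assumption. So the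
lift is transverse: `IsLevelOneChange.linearization_liftSec_surjective`.

**Perturbations.** Let `U''` be any precompact shrinking of `U'` and `K x` the closure of `U'' x`.
The charts are enumerated by a rank compatible with `≤`. Instead of a single perturbation, the
recursion over the rank constructs a family `Λ a` of multisections whose parameter `a` lies in a
space `ℝ^ι` and whose branches are *linear* in `a` (`IsLinearFamilyOn`, `IsLiftedFamily`). In this
way both smallness and transversality are statements about `a`, which can be met at the very end:
for small `a` the branches are small, and almost every `a` gives a transverse perturbation. It is
not necessary to preserve smallness or transversality quantitatively from chart to chart.

In one step of the recursion (`IsLevelOneSystem.exists_isLiftedFamily_update`) the families on the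
charts of smaller rank are lifted to the chart `x`. Near the compact set of the points which come
from `K y` and from `K y'` the two lifts agree, because the family of one of `y`, `y'` is already
the lift of the family of the other one, and the level-1 structure is compatible; for `y = y'`
distinct translates of the neighbourhood `W` are disjoint (`eventually_liftsAgree`). These sets are
compact since the identification of points is a closed relation, by the Hausdorff property
(`IsHausdorff.isClosed_ident`). So the lifts form a family near the union of the images, which is
cut off and extended over the chart (`KuranishiChart.exists_linearFamily_extension`). Away from a
neighbourhood of the images one adds a linear combination of sections whose `1`-jets span at every
point, with new parameters as coefficients, and averages the result over the group. The added
sections carry the square `η²` of a function vanishing exactly on that neighbourhood, so that they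
do not affect the linearization there.

**Generic parameters.** That almost every parameter is transverse does not need Sard's theorem.
Since the `1`-jets span, the condition that `s + τ a` vanishes at `z` and that a covector `l`,
normalized by `l e = 1`, annihilates its linearization is a system of linear equations in `a` of
full rank. There is one more equation than there are unknowns `(z, l)`. So the set of exceptional
`a` is locally contained in a `C¹` image of a space of dimension smaller than that of `ℝ^ι`, and it
is a null set (`SmoothVectorBundle.volume_not_transverse_eq_zero`). The argument is insensitive to
the presence of corners.

**Opposite coordinate changes.** For two charts with `y ≤ x` and `x ≤ y` the rank orders only one
of the coordinate changes. The two are inverse to each other up to a group element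
(`exists_hat_hat`), and then `W` is only the image of the coordinate change (`W_subset_image`).
Hence invariance and coherence in one direction already give coherence and the lifting property in
the other one (`coherent_symm`, `lift_eq_of_mutual`).

**Compactness.** Near a zero of `s_x` in `K x` every solution is identified with a solution in
`U''`: the zero is also covered by some `U'' x'`, and either it maps to that chart by a coordinate
change, or it comes from there, in which case the family is lifted and solutions near it lie in the
image of the coordinate change (`IsLevelOneSystem.eventually_exists_solution`). Away from the zeros
there are no solutions for small `a`. So the solution set has the same image in `M(U')` as the
compact sets of solutions over `K x` (`GoodCoordinateSystem.isCompact_solutionSet`).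
-/

noncomputable section

namespace Kuranishi

universe u

/-! ### Smooth sections in local trivializations -/

section Calculus

variable {n : ℕ} {M : Type u} [TopologicalSpace M] [ChartedSpace (EuclideanQuadrant n) M]

/-- Smoothness of a section at a point. -/
def SmoothVectorBundle.SmoothAt (B : SmoothVectorBundle n M) (s : ∀ z, B.Fib z) (z : M) : Prop :=
  ContMDiffAt (cornerModel n) B.totModel ∞ (B.toTot s) z

/-- The principal part of a section in a local trivialization. -/
def SmoothVectorBundle.coord (B : SmoothVectorBundle n M)
    (e : Trivialization B.Model (π B.Model B.Fib)) (s : ∀ z, B.Fib z) (z : M) : B.Model :=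
  (e (B.toTot s z)).2

/-- The preferred trivialization around `z`. -/
abbrev SmoothVectorBundle.triv (B : SmoothVectorBundle n M) (z : M) :
    Trivialization B.Model (π B.Model B.Fib) :=
  trivializationAt B.Model B.Fib z

variable (B : SmoothVectorBundle n M)

theorem SmoothVectorBundle.smoothOn_iff {s : ∀ z, B.Fib z} {O : Set M} (hO : IsOpen O) :
    B.SmoothOn s O ↔ ∀ z ∈ O, B.SmoothAt s z :=
  ⟨fun h z hz => (h z hz).contMDiffAt (hO.mem_nhds hz), fun h z hz => (h z hz).contMDiffWithinAt⟩

theorem SmoothVectorBundle.smoothAt_iff_coord {s : ∀ z, B.Fib z} {z : M}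
    (e : Trivialization B.Model (π B.Model B.Fib)) [MemTrivializationAtlas e]
    (hz : z ∈ e.baseSet) :
    B.SmoothAt s z ↔ ContMDiffAt (cornerModel n) 𝓘(ℝ, B.Model) ∞ (B.coord e s) z :=
  e.contMDiffAt_section_iff hz

variable {B}

theorem SmoothVectorBundle.SmoothAt.coord {s : ∀ z, B.Fib z} {z : M} (h : B.SmoothAt s z)
    (e : Trivialization B.Model (π B.Model B.Fib)) [MemTrivializationAtlas e]
    (hz : z ∈ e.baseSet) :
    ContMDiffAt (cornerModel n) 𝓘(ℝ, B.Model) ∞ (B.coord e s) z :=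
  (B.smoothAt_iff_coord e hz).1 h

theorem SmoothVectorBundle.SmoothAt.congr {s t : ∀ z, B.Fib z} {z : M} (h : B.SmoothAt s z)
    (hst : ∀ᶠ w in 𝓝 z, t w = s w) : B.SmoothAt t z :=
  ContMDiffAt.congr_of_eventuallyEq h (hst.mono fun w hw => by
    simp only [SmoothVectorBundle.toTot, hw])

theorem SmoothVectorBundle.SmoothAt.add {s t : ∀ z, B.Fib z} {z : M} (hs : B.SmoothAt s z)
    (ht : B.SmoothAt t z) : B.SmoothAt (fun w => s w + t w) z :=
  ContMDiffAt.add_section hs ht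

theorem SmoothVectorBundle.SmoothAt.sub {s t : ∀ z, B.Fib z} {z : M} (hs : B.SmoothAt s z)
    (ht : B.SmoothAt t z) : B.SmoothAt (fun w => s w - t w) z :=
  ContMDiffAt.sub_section hs ht

theorem SmoothVectorBundle.SmoothAt.smul {s : ∀ z, B.Fib z} {f : M → ℝ} {z : M}
    (hf : ContMDiffAt (cornerModel n) 𝓘(ℝ, ℝ) ∞ f z) (hs : B.SmoothAt s z) :
    B.SmoothAt (fun w => f w • s w) z :=
  ContMDiffAt.smul_section hf hs

theorem SmoothVectorBundle.SmoothAt.const_smul {s : ∀ z, B.Fib z} {z : M} (c : ℝ)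
    (hs : B.SmoothAt s z) : B.SmoothAt (fun w => c • s w) z :=
  ContMDiffAt.const_smul_section (a := c) hs

theorem SmoothVectorBundle.SmoothAt.sum {ι : Type*} {F : Finset ι} {s : ι → ∀ z, B.Fib z} {z : M}
    (hs : ∀ i ∈ F, B.SmoothAt (s i) z) : B.SmoothAt (fun w => ∑ i ∈ F, s i w) z :=
  ContMDiffAt.sum_section hs

theorem SmoothVectorBundle.smoothAt_zero (z : M) : B.SmoothAt (fun _ => 0) z :=
  Bundle.contMDiffAt_zeroSection ℝ B.Fib

theorem SmoothVectorBundle.mem_triv (z : M) : z ∈ (B.triv z).baseSet :=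
  mem_baseSet_trivializationAt B.Model B.Fib z

variable (B)

theorem SmoothVectorBundle.coord_add (e : Trivialization B.Model (π B.Model B.Fib))
    [MemTrivializationAtlas e] {s t : ∀ z, B.Fib z} {z : M} (hz : z ∈ e.baseSet) :
    B.coord e (fun w => s w + t w) z = B.coord e s z + B.coord e t z :=
  (e.linear ℝ hz).map_add _ _

theorem SmoothVectorBundle.coord_sub (e : Trivialization B.Model (π B.Model B.Fib))
    [MemTrivializationAtlas e] {s t : ∀ z, B.Fib z} {z : M} (hz : z ∈ e.baseSet) :
    B.coord e (fun w => s w - t w) z = B.coord e s z - B.coord e t z :=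
  (e.linear ℝ hz).mk' _ |>.map_sub _ _

theorem SmoothVectorBundle.coord_smul (e : Trivialization B.Model (π B.Model B.Fib))
    [MemTrivializationAtlas e] {s : ∀ z, B.Fib z} {f : M → ℝ} {z : M} (hz : z ∈ e.baseSet) :
    B.coord e (fun w => f w • s w) z = f z • B.coord e s z :=
  (e.linear ℝ hz).map_smul _ _

theorem SmoothVectorBundle.coord_eq (e : Trivialization B.Model (π B.Model B.Fib))
    [MemTrivializationAtlas e] {s : ∀ z, B.Fib z} {z : M} (hz : z ∈ e.baseSet) :
    B.coord e s z = e.continuousLinearEquivAt ℝ z hz (s z) := rfl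

theorem SmoothVectorBundle.coord_eq_zero_iff (e : Trivialization B.Model (π B.Model B.Fib))
    [MemTrivializationAtlas e] {s : ∀ z, B.Fib z} {z : M} (hz : z ∈ e.baseSet) :
    B.coord e s z = 0 ↔ s z = 0 := by
  rw [B.coord_eq e hz]
  exact (e.continuousLinearEquivAt ℝ z hz).map_eq_zero_iff

theorem SmoothVectorBundle.symm_coord (e : Trivialization B.Model (π B.Model B.Fib))
    [MemTrivializationAtlas e] {s : ∀ z, B.Fib z} {z : M} (hz : z ∈ e.baseSet) :
    e.symm z (B.coord e s z) = s z := by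
  have := (e.continuousLinearEquivAt ℝ z hz).symm_apply_apply (s z)
  exact this

theorem SmoothVectorBundle.coord_symm (e : Trivialization B.Model (π B.Model B.Fib))
    [MemTrivializationAtlas e] {f : M → B.Model} {z : M} (hz : z ∈ e.baseSet) :
    B.coord e (fun w => e.symm w (f w)) z = f z := by
  have := (e.continuousLinearEquivAt ℝ z hz).apply_symm_apply (f z)
  exact this

theorem SmoothVectorBundle.smoothAt_symm (e : Trivialization B.Model (π B.Model B.Fib))
    [MemTrivializationAtlas e] {f : M → B.Model} {z : M} (hz : z ∈ e.baseSet)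
    (hf : ContMDiffAt (cornerModel n) 𝓘(ℝ, B.Model) ∞ f z) :
    B.SmoothAt (fun w => e.symm w (f w)) z := by
  rw [B.smoothAt_iff_coord e hz]
  refine hf.congr_of_eventuallyEq ?_
  filter_upwards [e.open_baseSet.mem_nhds hz] with w hw
  exact B.coord_symm e hw

section Derivatives

variable (n) in
/-- The derivative of a vector-valued function on a manifold with corners, with the tangent spaces
identified with the model space by the preferred charts. -/
def mder {F : Type*} [NormedAddCommGroup F] [NormedSpace ℝ F] (f : M → F) (w : M) :
    EuclideanSpace ℝ (Fin n) →L[ℝ] F :=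
  mfderiv (cornerModel n) 𝓘(ℝ, F) f w

variable {F F' : Type*} [NormedAddCommGroup F] [NormedSpace ℝ F] [NormedAddCommGroup F']
  [NormedSpace ℝ F']

/-- At a zero of `f`, the product rule for `A · f` has a single term. -/
theorem mder_clm_apply_of_eq_zero {A : M → F →L[ℝ] F'} {f : M → F} {w : M}
    (hA : MDifferentiableAt (cornerModel n) 𝓘(ℝ, F →L[ℝ] F') A w)
    (hf : MDifferentiableAt (cornerModel n) 𝓘(ℝ, F) f w) (h0 : f w = 0) :
    mder n (fun z => A z (f z)) w = (A w).comp (mder n f w) := by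
  have hA' := hA.hasMFDerivAt
  have hf' := hf.hasMFDerivAt
  have key : HasMFDerivAt (cornerModel n) 𝓘(ℝ, F') (fun z => A z (f z)) w
      ((A w).comp (mfderiv (cornerModel n) 𝓘(ℝ, F) f w : _ →L[ℝ] F)) := by
    refine ⟨hA'.1.clm_apply hf'.1, ?_⟩
    have h1 := HasFDerivWithinAt.clm_apply hA'.2 hf'.2
    have e1 : writtenInExtChartAt (cornerModel n) 𝓘(ℝ, F →L[ℝ] F') w A
        (extChartAt (cornerModel n) w w) = A w := by
      simp only [writtenInExtChartAt, Function.comp, extChartAt_to_inv]; rfl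
    have e2 : writtenInExtChartAt (cornerModel n) 𝓘(ℝ, F) w f
        (extChartAt (cornerModel n) w w) = 0 := by
      simp only [writtenInExtChartAt, Function.comp, extChartAt_to_inv]; exact h0
    rw [e1, e2, map_zero, add_zero] at h1
    exact h1
  exact key.mfderiv

end Derivatives

variable {B}

/-- The linearization at a zero can be computed in every local trivialization. -/
theorem SmoothVectorBundle.linearization_eq [IsManifold (cornerModel n) ∞ M]
    {s : ∀ z, B.Fib z} {w : M}
    (hs : B.SmoothAt s w) (h0 : s w = 0) (e : Trivialization B.Model (π B.Model B.Fib))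
    [MemTrivializationAtlas e] (hw : w ∈ e.baseSet) (v : EuclideanSpace ℝ (Fin n)) :
    B.linearization s w v = e.symm w (mder n (B.coord e s) w v) := by
  have hev : B.coord (B.triv w) s =ᶠ[𝓝 w]
      fun z => (e.coordChangeL ℝ (B.triv w) z : B.Model →L[ℝ] B.Model) (B.coord e s z) := by
    filter_upwards [e.open_baseSet.mem_nhds hw,
      (B.triv w).open_baseSet.mem_nhds (B.mem_triv w)] with z hz hz'
    change _ = e.coordChangeL ℝ (B.triv w) z _
    rw [e.coordChangeL_apply (B.triv w) ⟨hz, hz'⟩]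
    change _ = B.coord (B.triv w) (fun z => e.symm z (B.coord e s z)) z
    simp only [SmoothVectorBundle.coord, SmoothVectorBundle.toTot]
    congr 3
    exact (B.symm_coord e hz).symm
  have hA : MDifferentiableAt (cornerModel n) 𝓘(ℝ, B.Model →L[ℝ] B.Model)
      (fun z => (e.coordChangeL ℝ (B.triv w) z : B.Model →L[ℝ] B.Model)) w :=
    (contMDiffAt_coordChangeL (n := ∞) hw (B.mem_triv w)).mdifferentiableAt (by simp)
  have hf := (hs.coord e hw).mdifferentiableAt (by simp)
  have h0' : B.coord e s w = 0 := (B.coord_eq_zero_iff e hw).2 h0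
  have h1 : mder n (B.coord (B.triv w) s) w =
      (e.coordChangeL ℝ (B.triv w) w : B.Model →L[ℝ] B.Model).comp (mder n (B.coord e s) w) := by
    rw [← mder_clm_apply_of_eq_zero hA hf h0']
    exact hev.mfderiv_eq
  have h2 : B.linearization s w v = (B.triv w).symmL ℝ w (mder n (B.coord (B.triv w) s) w v) := rfl
  rw [h2, h1, Trivialization.symmL_apply _ (B.mem_triv w), ContinuousLinearMap.comp_apply]
  change (B.triv w).symm w (e.coordChangeL ℝ (B.triv w) w _) = _
  rw [e.coordChangeL_apply (B.triv w) ⟨hw, B.mem_triv w⟩]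
  exact (B.triv w).symm_apply_apply_mk (B.mem_triv w) _

end Calculus

/-! ### Smooth bundle maps -/

section BundleMaps

variable {n n' : ℕ} {M M' : Type u} [TopologicalSpace M] [ChartedSpace (EuclideanQuadrant n) M]
  [TopologicalSpace M'] [ChartedSpace (EuclideanQuadrant n') M']

/-- The map of total spaces given by fibrewise linear maps over `f`. -/
def totMap (B : SmoothVectorBundle n M) (B' : SmoothVectorBundle n' M') {f : M → M'}
    (F : ∀ z, B.Fib z →ₗ[ℝ] B'.Fib (f z)) (v : B.Tot) : B'.Tot :=
  ⟨f v.proj, F v.proj v.2⟩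

/-- The fibrewise linear maps `F` over `f` form a smooth bundle map over `D`. -/
def IsBundleMapOn (B : SmoothVectorBundle n M) (B' : SmoothVectorBundle n' M') {f : M → M'}
    (F : ∀ z, B.Fib z →ₗ[ℝ] B'.Fib (f z)) (D : Set M) : Prop :=
  ContMDiffOn B.totModel B'.totModel ∞ (totMap B B' F) {v | v.proj ∈ D}

variable {B : SmoothVectorBundle n M} {B' : SmoothVectorBundle n' M'} {f : M → M'}
  {F : ∀ z, B.Fib z →ₗ[ℝ] B'.Fib (f z)} {D : Set M} {z : M}

theorem isOpen_proj_preimage (B : SmoothVectorBundle n M) {D : Set M} (hD : IsOpen D) :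
    IsOpen {v : B.Tot | v.proj ∈ D} :=
  hD.preimage (FiberBundle.continuous_proj B.Model B.Fib)

theorem IsBundleMapOn.contMDiffAt_comp (hF : IsBundleMapOn B B' F D) (hD : IsOpen D) (hz : z ∈ D)
    {u : ∀ z, B.Fib z} (hu : B.SmoothAt u z) :
    ContMDiffAt (cornerModel n) B'.totModel ∞ (fun w => totMap B B' F (B.toTot u w)) z :=
  ((hF _ hz).contMDiffAt ((isOpen_proj_preimage B hD).mem_nhds hz)).comp z hu

theorem IsBundleMapOn.contMDiffAt_base [IsManifold (cornerModel n') ∞ M']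
    (hF : IsBundleMapOn B B' F D) (hD : IsOpen D) (hz : z ∈ D) :
    ContMDiffAt (cornerModel n) (cornerModel n') ∞ f z :=
  (Bundle.contMDiff_proj B'.Fib).contMDiffAt.comp z
    (hF.contMDiffAt_comp hD hz (SmoothVectorBundle.smoothAt_zero z))

variable (F) in
/-- The matrix of a bundle map in local trivializations. -/
def bundleMatrix (e : Trivialization B.Model (π B.Model B.Fib))
    (e' : Trivialization B'.Model (π B'.Model B'.Fib)) (w : M) : B.Model →L[ℝ] B'.Model :=
  ∑ i, (EuclideanSpace.proj i : B.Model →L[ℝ] ℝ).smulRight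
    (e' (totMap B B' F ⟨w, e.symm w (EuclideanSpace.single i 1)⟩)).2

theorem bundleMatrix_apply (e : Trivialization B.Model (π B.Model B.Fib))
    [MemTrivializationAtlas e] (e' : Trivialization B'.Model (π B'.Model B'.Fib))
    [MemTrivializationAtlas e'] {w : M} (hw : w ∈ e.baseSet) (hw' : f w ∈ e'.baseSet)
    (ξ : B.Model) :
    bundleMatrix F e e' w ξ = (e' ⟨f w, F w (e.symm w ξ)⟩).2 := by
  let A : B.Model →ₗ[ℝ] B'.Model :=
    ((e'.continuousLinearEquivAt ℝ (f w) hw').toLinearEquiv.toLinearMap).comp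
      ((F w).comp (e.continuousLinearEquivAt ℝ w hw).symm.toLinearEquiv.toLinearMap)
  have hA : ∀ ξ, A ξ = (e' ⟨f w, F w (e.symm w ξ)⟩).2 := fun ξ => rfl
  have hξ : A ξ = ∑ i, ξ i • A (EuclideanSpace.single i 1) := by
    conv_lhs => rw [← (EuclideanSpace.basisFun (Fin B.rank) ℝ).sum_repr ξ]
    rw [map_sum]
    simp only [map_smul, EuclideanSpace.basisFun_repr, EuclideanSpace.basisFun_apply]
  rw [← hA, hξ]
  simp only [bundleMatrix, sum_apply, ContinuousLinearMap.smulRight_apply, hA]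
  rfl

theorem bundleMatrix_coord (e : Trivialization B.Model (π B.Model B.Fib))
    [MemTrivializationAtlas e] (e' : Trivialization B'.Model (π B'.Model B'.Fib))
    [MemTrivializationAtlas e'] {w : M} (hw : w ∈ e.baseSet) (hw' : f w ∈ e'.baseSet)
    (u : ∀ z, B.Fib z) :
    bundleMatrix F e e' w (B.coord e u w) = (e' ⟨f w, F w (u w)⟩).2 := by
  rw [bundleMatrix_apply e e' hw hw', B.symm_coord e hw]

theorem IsBundleMapOn.contMDiffAt_matrix (hF : IsBundleMapOn B B' F D) (hD : IsOpen D)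
    (hz : z ∈ D) (e : Trivialization B.Model (π B.Model B.Fib))
    [MemTrivializationAtlas e] (e' : Trivialization B'.Model (π B'.Model B'.Fib))
    [MemTrivializationAtlas e'] (hw : z ∈ e.baseSet) (hw' : f z ∈ e'.baseSet) :
    ContMDiffAt (cornerModel n) 𝓘(ℝ, B.Model →L[ℝ] B'.Model) ∞ (bundleMatrix F e e') z := by
  have h1 : ∀ i, ContMDiffAt (cornerModel n) 𝓘(ℝ, B.Model →L[ℝ] B'.Model) ∞
      (fun w => (EuclideanSpace.proj i : B.Model →L[ℝ] ℝ).smulRight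
        (e' (totMap B B' F ⟨w, e.symm w (EuclideanSpace.single i 1)⟩)).2) z := by
    intro i
    have h2 := hF.contMDiffAt_comp hD hz
      (B.smoothAt_symm e (f := fun _ => EuclideanSpace.single i (1 : ℝ)) hw contMDiffAt_const)
    have h3 := ((e'.contMDiffAt_iff (by rw [e'.mem_source]; exact hw')).1 h2).2
    exact ((ContinuousLinearMap.smulRightL ℝ B.Model B'.Model
      (EuclideanSpace.proj i : B.Model →L[ℝ] ℝ)).contMDiff.contMDiffAt).comp z h3
  exact contMDiffAt_finsetSum (fun i _ => h1 i)

/-- Naturality of the linearization at a zero under bundle maps. -/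
theorem IsBundleMapOn.linearization_apply [IsManifold (cornerModel n) ∞ M]
    [IsManifold (cornerModel n') ∞ M']
    (hF : IsBundleMapOn B B' F D) (hD : IsOpen D) (hz : z ∈ D)
    {u : ∀ z, B.Fib z} {u' : ∀ z, B'.Fib z} (hu : B.SmoothAt u z) (hu' : B'.SmoothAt u' (f z))
    (h0 : u z = 0) (hev : ∀ᶠ w in 𝓝 z, u' (f w) = F w (u w))
    (v : TangentSpace (cornerModel n) z) :
    B'.linearization u' (f z) (mfderiv (cornerModel n) (cornerModel n') f z v) =
      F z (B.linearization u z v) := by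
  have hf := hF.contMDiffAt_base hD hz
  have h0' : u' (f z) = 0 := by rw [hev.self_of_nhds, h0, map_zero]
  have hev' : (fun w => B'.coord (B'.triv (f z)) u' (f w)) =ᶠ[𝓝 z]
      fun w => bundleMatrix F (B.triv z) (B'.triv (f z)) w (B.coord (B.triv z) u w) := by
    filter_upwards [hev, (B.triv z).open_baseSet.mem_nhds (SmoothVectorBundle.mem_triv z),
      hf.continuousAt.preimage_mem_nhds
        ((B'.triv (f z)).open_baseSet.mem_nhds (SmoothVectorBundle.mem_triv (f z)))] with w h1 h2 h3
    rw [bundleMatrix_coord _ _ h2 h3, ← h1]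
    rfl
  have hA := (hF.contMDiffAt_matrix hD hz (B.triv z) (B'.triv (f z)) (SmoothVectorBundle.mem_triv z)
    (SmoothVectorBundle.mem_triv (f z))).mdifferentiableAt (by simp)
  have hc := (hu.coord (B.triv z) (SmoothVectorBundle.mem_triv z)).mdifferentiableAt (by simp)
  have hc' := (hu'.coord (B'.triv (f z))
    (SmoothVectorBundle.mem_triv (f z))).mdifferentiableAt (by simp)
  have h1 : mder n (fun w => B'.coord (B'.triv (f z)) u' (f w)) z =
      (bundleMatrix F (B.triv z) (B'.triv (f z)) z).comp (mder n (B.coord (B.triv z) u) z) := by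
    rw [← mder_clm_apply_of_eq_zero hA hc
      ((B.coord_eq_zero_iff _ (SmoothVectorBundle.mem_triv z)).2 h0)]
    exact hev'.mfderiv_eq
  have h2 : mder n (fun w => B'.coord (B'.triv (f z)) u' (f w)) z v =
      mder n' (B'.coord (B'.triv (f z)) u') (f z)
        (mfderiv (cornerModel n) (cornerModel n') f z v) :=
    mfderiv_comp_apply z hc' (hf.mdifferentiableAt (by simp)) v
  refine (SmoothVectorBundle.linearization_eq hu' h0' _ (SmoothVectorBundle.mem_triv (f z)) _).trans
    (Eq.trans ?_ (congrArg (F z) (SmoothVectorBundle.linearization_eq hu h0 _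
      (SmoothVectorBundle.mem_triv z) v)).symm)
  refine (congrArg ((B'.triv (f z)).symm (f z))
    (h2.symm.trans (congrArg (fun T => T v) h1))).trans ?_
  refine (congrArg ((B'.triv (f z)).symm (f z)) (bundleMatrix_apply (F := F) (B.triv z)
    (B'.triv (f z)) (SmoothVectorBundle.mem_triv z) (SmoothVectorBundle.mem_triv (f z)) _)).trans ?_
  exact (B'.triv (f z)).symm_apply_apply_mk (SmoothVectorBundle.mem_triv (f z)) _

/-- A section which solves the smooth linear equation `F ℓ = t ∘ f` in the image of a smooth
projection `Q` complementary to the kernel of `F` is smooth. -/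
theorem IsBundleMapOn.smoothAt_of_solution [IsManifold (cornerModel n) ∞ M]
    [IsManifold (cornerModel n') ∞ M']
    (hF : IsBundleMapOn B B' F D) (hD : IsOpen D) (hz : z ∈ D)
    {Q : ∀ z, B.Fib z →ₗ[ℝ] B.Fib z}
    (hQ : ContMDiffOn B.totModel B.totModel ∞ (fun v : B.Tot => (⟨v.proj, Q v.proj v.2⟩ : B.Tot))
      {v | v.proj ∈ D})
    (hFQ : ∀ w ∈ D, ∀ e, F w (Q w e) = F w e)
    (hinj : ∀ w ∈ D, ∀ e e', F w (Q w e) = F w (Q w e') → Q w e = Q w e')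
    (hsurj : Function.Surjective (F z))
    {t : ∀ z, B'.Fib z} (ht : B'.SmoothAt t (f z)) {ℓ : ∀ z, B.Fib z}
    (hℓQ : ∀ᶠ w in 𝓝 z, Q w (ℓ w) = ℓ w) (hℓ : ∀ᶠ w in 𝓝 z, F w (ℓ w) = t (f w)) :
    B.SmoothAt ℓ z := by
  have hf := hF.contMDiffAt_base hD hz
  set e := B.triv z
  set e' := B'.triv (f z)
  have he : z ∈ e.baseSet := SmoothVectorBundle.mem_triv z
  have he' : f z ∈ e'.baseSet := SmoothVectorBundle.mem_triv (f z)
  set A := bundleMatrix F e e'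
  have hA : ContMDiffAt (cornerModel n) 𝓘(ℝ, B.Model →L[ℝ] B'.Model) ∞ A z :=
    hF.contMDiffAt_matrix hD hz e e' he he'
  have hAsurj : Function.Surjective (A z) := by
    intro η
    obtain ⟨y, hy⟩ := hsurj (e'.symm (f z) η)
    refine ⟨(e ⟨z, y⟩).2, ?_⟩
    rw [bundleMatrix_apply e e' he he', e.symm_apply_apply_mk he, hy]
    exact congrArg Prod.snd (e'.apply_mk_symm he' η)
  obtain ⟨R, hR⟩ := (A z).toLinearMap.exists_rightInverse_of_surjective
    (LinearMap.range_eq_top.2 hAsurj)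
  set R' : B'.Model →L[ℝ] B.Model := LinearMap.toContinuousLinearMap R
  have hR' : (A z).comp R' = 1 := by
    ext1 x
    exact LinearMap.congr_fun hR x
  -- `R'` is a right inverse of `A` at `z` only; `R' (K w)⁻¹` is one at every point near `z`
  set K : M → B'.Model →L[ℝ] B'.Model := fun w => (A w).comp R'
  have hK : ContMDiffAt (cornerModel n) 𝓘(ℝ, B'.Model →L[ℝ] B'.Model) ∞ K z :=
    hA.clm_comp contMDiffAt_const
  have hKz : K z = ((1 : (B'.Model →L[ℝ] B'.Model)ˣ) : B'.Model →L[ℝ] B'.Model) := hR'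
  have hKinv : ContMDiffAt (cornerModel n) 𝓘(ℝ, B'.Model →L[ℝ] B'.Model) ∞
      (fun w => Ring.inverse (K w)) z := by
    have h1 := contDiffAt_ringInverse ℝ (n := ∞) (1 : (B'.Model →L[ℝ] B'.Model)ˣ)
    rw [← hKz] at h1
    exact h1.contMDiffAt.comp z hK
  have hτ : ContMDiffAt (cornerModel n) 𝓘(ℝ, B'.Model) ∞ (fun w => B'.coord e' t (f w)) z :=
    (ht.coord e' he').comp z hf
  have hsol : ContMDiffAt (cornerModel n) 𝓘(ℝ, B.Model) ∞
      (fun w => R' (Ring.inverse (K w) (B'.coord e' t (f w)))) z :=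
    R'.contMDiff.contMDiffAt.comp z (hKinv.clm_apply hτ)
  have hsec := B.smoothAt_symm e he hsol
  have hQs : B.SmoothAt (fun w => Q w (e.symm w (R' (Ring.inverse (K w)
      (B'.coord e' t (f w)))))) z :=
    ((hQ _ hz).contMDiffAt ((isOpen_proj_preimage B hD).mem_nhds hz)).comp z hsec
  refine hQs.congr ?_
  have hunit : ∀ᶠ w in 𝓝 z, IsUnit (K w) := by
    have : IsOpen {a : B'.Model →L[ℝ] B'.Model | IsUnit a} := Units.isOpen
    refine hK.continuousAt.eventually (this.mem_nhds ?_)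
    change IsUnit (K z)
    rw [hKz]
    exact Units.isUnit _
  filter_upwards [hℓQ, hℓ, hunit, hD.mem_nhds hz, e.open_baseSet.mem_nhds he,
    hf.continuousAt.preimage_mem_nhds (e'.open_baseSet.mem_nhds he')] with w h1 h2 h3 h4 h5 h6
  rw [← h1]
  refine hinj w h4 _ _ ?_
  rw [hFQ w h4, hFQ w h4, h2]
  have h7 : A w (R' (Ring.inverse (K w) (B'.coord e' t (f w)))) = B'.coord e' t (f w) := by
    change (K w * Ring.inverse (K w)) _ = _
    rw [Ring.mul_inverse_cancel _ h3]
    rfl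
  rw [bundleMatrix_apply e e' h5 h6] at h7
  have h8 := congrArg (e'.symm (f w)) h7
  rw [e'.symm_apply_apply_mk h6, B'.symm_coord e' h6] at h8
  exact h8.symm

end BundleMaps

/-! ### Null sets of parameters -/

section Genericity

open MeasureTheory

/-- A subset of the image of a `C¹` map from a space of smaller dimension is a null set. -/
theorem volume_eq_zero_of_subset_image {ι : Type*} [Fintype ι] {G : Type*} [NormedAddCommGroup G]
    [NormedSpace ℝ G] [FiniteDimensional ℝ G] {f : G → ι → ℝ} {s : Set G} {t : Set (ι → ℝ)}
    (hs : Convex ℝ s) (hf : ContDiffOn ℝ 1 f s) (hG : Module.finrank ℝ G < Fintype.card ι)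
    (ht : t ⊆ f '' s) : volume t = 0 := by
  have h1 : dimH t < (Fintype.card ι : NNReal) := by
    calc dimH t ≤ dimH (f '' s) := dimH_mono ht
      _ ≤ dimH s := hf.dimH_image_le hs Subset.rfl
      _ ≤ dimH (univ : Set G) := dimH_mono (subset_univ _)
      _ = Module.finrank ℝ G := Real.dimH_univ_eq_finrank G
      _ < _ := by
        rw [ENNReal.coe_natCast]
        exact_mod_cast hG
  have h2 := hausdorffMeasure_of_dimH_lt h1
  rw [← hausdorffMeasure_pi_real]
  simpa using h2

variable {ι : Type*} [Fintype ι] {Y V : Type*} [NormedAddCommGroup Y] [NormedSpace ℝ Y]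
  [FiniteDimensional ℝ Y] [NormedAddCommGroup V] [NormedSpace ℝ V] [FiniteDimensional ℝ V]

/-- Parametric transversality by dimension count: a `C¹` family of surjective linear equations on
`ℝ^ι`, parametrized by fewer variables than there are equations, is solvable for some value of the
parameter only on a null set. -/
theorem volume_setOf_exists_solution_eq_zero {R O : Set Y} (hR : Convex ℝ R) (hO : IsOpen O)
    {J : Y → (ι → ℝ) →L[ℝ] V} {c : Y → V} (hJ : ContDiffOn ℝ 1 J (R ∩ O))
    (hc : ContDiffOn ℝ 1 c (R ∩ O)) (hsurj : ∀ y ∈ R ∩ O, Function.Surjective (J y))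
    (hdim : Module.finrank ℝ Y < Module.finrank ℝ V) :
    volume {a : ι → ℝ | ∃ y ∈ R ∩ O, J y a = c y} = 0 := by
  have loc : ∀ y₀ ∈ R ∩ O, ∃ W ∈ 𝓝[R ∩ O] y₀, volume {a : ι → ℝ | ∃ y ∈ W, J y a = c y} = 0 := by
    intro y₀ hy₀
    obtain ⟨T, hT⟩ := (J y₀).toLinearMap.exists_rightInverse_of_surjective
      (LinearMap.range_eq_top.2 (hsurj y₀ hy₀))
    set T' : V →L[ℝ] (ι → ℝ) := LinearMap.toContinuousLinearMap T
    have hT' : ∀ v, J y₀ (T' v) = v := fun v => LinearMap.congr_fun hT v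
    -- `Φ y` is invertible near `y₀` and turns the equation at `y` into the equation at `y₀`.
    set Φ : Y → (ι → ℝ) →L[ℝ] (ι → ℝ) := fun y => 1 + T'.comp (J y - J y₀)
    have hΦ : ContDiffOn ℝ 1 Φ (R ∩ O) :=
      contDiffOn_const.add (contDiffOn_const.clm_comp (hJ.sub contDiffOn_const))
    have hΦ₀ : Φ y₀ = 1 := by simp [Φ]
    have hJΦ : ∀ y a, J y₀ (Φ y a) = J y a := by
      intro y a
      simp [Φ, hT']
    have hunit : ∀ᶠ y in 𝓝[R ∩ O] y₀, IsUnit (Φ y) := by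
      have : IsOpen {a : (ι → ℝ) →L[ℝ] (ι → ℝ) | IsUnit a} := Units.isOpen
      refine (hΦ.continuousOn y₀ hy₀).eventually (this.mem_nhds ?_)
      change IsUnit (Φ y₀)
      rw [hΦ₀]
      exact isUnit_one
    obtain ⟨ε, hε, hball⟩ := Metric.mem_nhdsWithin_iff.1 hunit
    obtain ⟨δ, hδ, hball'⟩ := Metric.isOpen_iff.1 hO y₀ hy₀.2
    set B := Metric.ball y₀ (min ε δ)
    have hBO : R ∩ B ⊆ R ∩ O := fun y hy =>
      ⟨hy.1, hball' (Metric.ball_subset_ball (min_le_right _ _) hy.2)⟩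
    have hBu : ∀ y ∈ R ∩ B, IsUnit (Φ y) := fun y hy =>
      hball ⟨Metric.ball_subset_ball (min_le_left _ _) hy.2, hBO hy⟩
    refine ⟨R ∩ B, ?_, ?_⟩
    · rw [mem_nhdsWithin]
      exact ⟨B, Metric.isOpen_ball, Metric.mem_ball_self (lt_min hε hδ), fun y hy => ⟨hy.2.1, hy.1⟩⟩
    · set K := LinearMap.ker (J y₀).toLinearMap
      -- the solutions at `y` are parametrized by the kernel of the equation at `y₀`
      let Ψ : Y × K → ι → ℝ := fun p => Ring.inverse (Φ p.1) (T' (c p.1) + p.2)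
      have hΨ : ContDiffOn ℝ 1 Ψ ((R ∩ B) ×ˢ univ) := by
        have h1 : ContDiffOn ℝ 1 (fun y => Ring.inverse (Φ y)) (R ∩ B) := by
          intro y hy
          obtain ⟨x, hx⟩ := hBu y hy
          have h2 := contDiffAt_ringInverse ℝ (n := 1) x
          rw [hx] at h2
          exact h2.comp_contDiffWithinAt y (hΦ.mono hBO y hy)
        have h3 : ContDiffOn ℝ 1 (fun p : Y × K => Ring.inverse (Φ p.1)) ((R ∩ B) ×ˢ univ) :=
          h1.comp contDiffOn_fst (fun p hp => hp.1)
        have h4 : ContDiffOn ℝ 1 (fun p : Y × K => c p.1) ((R ∩ B) ×ˢ univ) :=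
          (hc.mono hBO).comp contDiffOn_fst (fun p hp => hp.1)
        exact h3.clm_apply ((T'.contDiff.comp_contDiffOn h4).add
          (K.subtypeL.contDiff.comp_contDiffOn contDiffOn_snd))
      refine volume_eq_zero_of_subset_image ((hR.inter (convex_ball _ _)).prod convex_univ) hΨ ?_ ?_
      · have h1 := LinearMap.finrank_range_add_finrank_ker (J y₀).toLinearMap
        rw [LinearMap.range_eq_top.2 (hsurj y₀ hy₀), finrank_top,
          Module.finrank_fintype_fun_eq_card] at h1
        change _ + Module.finrank ℝ K = _ at h1
        rw [Module.finrank_prod]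
        omega
      · rintro a ⟨y, hy, hya⟩
        refine ⟨(y, ⟨Φ y a - T' (c y), ?_⟩), ⟨hy, mem_univ _⟩, ?_⟩
        · change J y₀ (Φ y a - T' (c y)) = 0
          rw [map_sub, hJΦ, hT', hya, sub_self]
        · change Ring.inverse (Φ y) (T' (c y) + (Φ y a - T' (c y))) = a
          rw [add_sub_cancel]
          change (Ring.inverse (Φ y) * Φ y) a = a
          rw [Ring.inverse_mul_cancel _ (hBu y hy)]
          rfl
  choose! W hW hW0 using loc
  obtain ⟨C, hC, hcC, hcov⟩ := TopologicalSpace.countable_cover_nhdsWithin hW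
  refine measure_mono_null ?_ ((measure_biUnion_null_iff hcC).2 fun y hy => hW0 y (hC hy))
  rintro a ⟨y, hy, hya⟩
  obtain ⟨y', hy', hyy'⟩ := mem_iUnion₂.1 (hcov hy)
  exact mem_iUnion₂.2 ⟨y', hy', y, hyy', hya⟩

variable {E F : Type*} [NormedAddCommGroup E] [NormedSpace ℝ E] [FiniteDimensional ℝ E]
  [NormedAddCommGroup F] [NormedSpace ℝ F] [FiniteDimensional ℝ F]

theorem finrank_continuousDual (H : Type*) [NormedAddCommGroup H] [NormedSpace ℝ H]
    [FiniteDimensional ℝ H] : Module.finrank ℝ (H →L[ℝ] ℝ) = Module.finrank ℝ H := by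
  rw [← (LinearMap.toContinuousLinearMap (𝕜 := ℝ) (E := H) (F' := ℝ)).finrank_eq,
    Module.finrank_linearMap_self]

/-- The zeros of `f + τ a` at which a covector `l` with the normalization `l e = 1` annihilates the
derivative: the unknowns are the point and `l`, one fewer than the number of equations. -/
theorem volume_setOf_exists_covector_eq_zero {R O : Set E} (hR : Convex ℝ R)
    (hO : IsOpen O) {f : E → F} {τ : E → (ι → ℝ) →L[ℝ] F}
    {f' : E → E →L[ℝ] F} {τ' : E → (ι → ℝ) →ₗ[ℝ] E →L[ℝ] F}
    (hf : ContDiffOn ℝ 1 f (R ∩ O)) (hτ : ContDiffOn ℝ 1 τ (R ∩ O))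
    (hf' : ContDiffOn ℝ 1 f' (R ∩ O)) (hτ' : ∀ a, ContDiffOn ℝ 1 (fun x => τ' x a) (R ∩ O))
    (hspan : ∀ x ∈ R ∩ O, ∀ (b : F) (β : E →L[ℝ] F), ∃ a, τ x a = b ∧ τ' x a = β)
    {e : F} (he : e ≠ 0) :
    volume {a : ι → ℝ | ∃ x ∈ R ∩ O, ∃ l : F →L[ℝ] ℝ, l e = 1 ∧ f x + τ x a = 0 ∧
      l.comp (f' x + τ' x a) = 0} = 0 := by
  obtain ⟨l₀, hl₀⟩ := (SeparatingDual.exists_eq_one (R := ℝ) he)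
  let ev : Module.Dual ℝ F →ₗ[ℝ] ℝ := Module.Dual.eval ℝ F e
  let H : Submodule ℝ (Module.Dual ℝ F) := LinearMap.ker ev
  have hdimH : Module.finrank ℝ H + 1 = Module.finrank ℝ F := by
    have hev : Function.Surjective ev := fun c => ⟨c • (l₀ : F →ₗ[ℝ] ℝ), by simp [ev, hl₀]⟩
    have h1 := LinearMap.finrank_range_add_finrank_ker ev
    rw [LinearMap.range_eq_top.2 hev, finrank_top, Module.finrank_self,
      Subspace.dual_finrank_eq] at h1
    change _ + Module.finrank ℝ H = _ at h1
    omega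
  have : Module.Free ℝ H := Module.Free.of_divisionRing ℝ H
  let bH := Module.finBasis ℝ H
  let Z := Fin (Module.finrank ℝ H) → ℝ
  -- coordinates on the affine hyperplane of the covectors `l` with `l e = 1`
  let lam : Z → F →L[ℝ] ℝ := fun ν =>
    l₀ + ∑ j, ν j • LinearMap.toContinuousLinearMap (bH j : F →ₗ[ℝ] ℝ)
  let J : E × Z → (ι → ℝ) →L[ℝ] F × (E →L[ℝ] ℝ) := fun p => LinearMap.toContinuousLinearMap
    { toFun := fun a => (τ p.1 a, (lam p.2).comp (τ' p.1 a))
      map_add' := fun a b => by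
        rw [map_add, map_add, ContinuousLinearMap.comp_add, Prod.mk_add_mk]
      map_smul' := fun t a => by
        rw [map_smul, map_smul, ContinuousLinearMap.comp_smul, RingHom.id_apply, Prod.smul_mk] }
  let c : E × Z → F × (E →L[ℝ] ℝ) := fun p => (-f p.1, -((lam p.2).comp (f' p.1)))
  have hset : (R ×ˢ (univ : Set Z)) ∩ (O ×ˢ (univ : Set Z)) = (R ∩ O) ×ˢ univ := by
    rw [prod_inter_prod, inter_univ]
  have hlam : ContDiffOn ℝ 1 (fun p : E × Z => lam p.2) ((R ∩ O) ×ˢ univ) := by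
    refine contDiffOn_const.add (ContDiff.contDiffOn (ContDiff.sum fun j _ => ?_))
    have h0 : ContDiff ℝ 1 fun p : E × Z => p.2 j := (contDiff_apply ℝ ℝ j).comp contDiff_snd
    exact h0.smul contDiff_const
  have hfst : MapsTo Prod.fst ((R ∩ O) ×ˢ (univ : Set Z)) (R ∩ O) := fun p hp => hp.1
  have hJ : ContDiffOn ℝ 1 J ((R ∩ O) ×ˢ univ) := by
    refine contDiffOn_clm_apply.2 fun a => ?_
    exact ((hτ.comp contDiffOn_fst hfst).clm_apply contDiffOn_const).prodMk
      (hlam.clm_comp ((hτ' a).comp contDiffOn_fst hfst))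
  have hc : ContDiffOn ℝ 1 c ((R ∩ O) ×ˢ univ) :=
    (hf.comp contDiffOn_fst hfst).neg.prodMk (hlam.clm_comp (hf'.comp contDiffOn_fst hfst)).neg
  refine measure_mono_null ?_ (volume_setOf_exists_solution_eq_zero (R := R ×ˢ (univ : Set Z))
    (O := O ×ˢ (univ : Set Z)) (hR.prod convex_univ) (hO.prod isOpen_univ)
    (J := J) (c := c) (by rwa [hset]) (by rwa [hset]) ?_ ?_)
  · rintro a ⟨x, hx, l, hl1, hl2, hl3⟩
    rw [hset]
    have hmem : (l : F →ₗ[ℝ] ℝ) - l₀ ∈ H := by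
      change l e - l₀ e = 0
      rw [hl1, hl₀, sub_self]
    refine ⟨(x, bH.repr ⟨_, hmem⟩), ⟨hx, mem_univ _⟩, ?_⟩
    have h4 : lam (bH.repr ⟨_, hmem⟩) = l := by
      have h5 := congrArg (Subtype.val) (bH.sum_repr ⟨_, hmem⟩)
      rw [Submodule.coe_sum] at h5
      ext y
      have h6 := LinearMap.congr_fun h5 y
      simp only [LinearMap.sum_apply, LinearMap.sub_apply, Submodule.coe_smul,
        LinearMap.smul_apply] at h6
      simp only [lam, add_apply, sum_apply, smul_apply]
      change l₀ y + ∑ j, _ • (bH j : F →ₗ[ℝ] ℝ) y = l y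
      rw [h6]
      exact add_sub_cancel (l₀ y) (l y)
    refine Prod.ext ?_ ?_
    · exact (neg_eq_of_add_eq_zero_right hl2).symm
    · change (lam _).comp (τ' x a) = -((lam _).comp (f' x))
      rw [h4]
      rw [ContinuousLinearMap.comp_add] at hl3
      exact (neg_eq_of_add_eq_zero_right hl3).symm
  · rw [hset]
    rintro ⟨x, ν⟩ ⟨hx, -⟩ ⟨b, γ⟩
    obtain ⟨a, ha1, ha2⟩ := hspan x hx b (γ.smulRight e)
    refine ⟨a, Prod.ext ha1 ?_⟩
    change (lam ν).comp (τ' x a) = γ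
    rw [ha2]
    have h6 : lam ν e = 1 := by
      have h7 : ∀ j, (bH j : F →ₗ[ℝ] ℝ) e = 0 := fun j => (bH j).2
      simp [lam, hl₀, h7, sum_apply]
    ext y
    simp [h6]
  · rw [Module.finrank_prod, Module.finrank_prod, finrank_continuousDual,
      Module.finrank_fin_fun]
    omega

/-- If the `1`-jets of the linear family `a ↦ τ · a` span at every point, then for almost every `a`
the map `f + τ a` has surjective derivative at all of its zeros. -/
theorem volume_setOf_not_transverse_eq_zero {R O : Set E} (hR : Convex ℝ R)
    (hRi : (interior R).Nonempty) (hO : IsOpen O) {f : E → F} {τ : E → (ι → ℝ) →L[ℝ] F}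
    (hf : ContDiffOn ℝ ∞ f (R ∩ O)) (hτ : ContDiffOn ℝ ∞ τ (R ∩ O))
    (hspan : ∀ x ∈ R ∩ O, ∀ (b : F) (β : E →L[ℝ] F),
      ∃ a, τ x a = b ∧ fderivWithin ℝ (fun y => τ y a) R x = β) :
    volume {a : ι → ℝ | ∃ x ∈ R ∩ O, f x + τ x a = 0 ∧
      ¬ Function.Surjective (fderivWithin ℝ (fun y => f y + τ y a) R x)} = 0 := by
  have hU : UniqueDiffOn ℝ (R ∩ O) := (uniqueDiffOn_convex hR hRi).inter hO
  have hfd : ∀ g : E → F, ∀ x ∈ R ∩ O, fderivWithin ℝ g (R ∩ O) x = fderivWithin ℝ g R x :=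
    fun g x hx => fderivWithin_inter (hO.mem_nhds hx.2)
  have hf' : ContDiffOn ℝ 1 (fun x => fderivWithin ℝ f (R ∩ O) x) (R ∩ O) :=
    hf.fderivWithin hU (m := 1) (by norm_cast)
  have hfdiff : ∀ x ∈ R ∩ O, DifferentiableWithinAt ℝ f (R ∩ O) x :=
    fun x hx => hf.differentiableOn (by simp) x hx
  have hτdiff : ∀ x ∈ R ∩ O, DifferentiableWithinAt ℝ τ (R ∩ O) x :=
    fun x hx => hτ.differentiableOn (by simp) x hx
  have hτa : ∀ x ∈ R ∩ O, ∀ a, fderivWithin ℝ (fun y => τ y a) R x =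
      (fderivWithin ℝ τ (R ∩ O) x).flip a := by
    intro x hx a
    rw [← hfd _ x hx, fderivWithin_clm_apply (hU x hx) (hτdiff x hx)
      (differentiableWithinAt_const a)]
    simp
  have hτ' : ∀ a, ContDiffOn ℝ 1 (fun x => (fderivWithin ℝ τ (R ∩ O) x).flip a) (R ∩ O) := by
    intro a
    have h1 : ContDiffOn ℝ ∞ (fun y => τ y a) (R ∩ O) := hτ.clm_apply contDiffOn_const
    refine (h1.fderivWithin hU (m := 1) (by norm_cast)).congr fun x hx => ?_
    rw [← hτa x hx, hfd _ x hx]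
  have key : ∀ i : Fin (Module.finrank ℝ F), volume {a : ι → ℝ | ∃ x ∈ R ∩ O, ∃ l : F →L[ℝ] ℝ,
      l (Module.finBasis ℝ F i) = 1 ∧ f x + τ x a = 0 ∧
      l.comp (fderivWithin ℝ f (R ∩ O) x + (fderivWithin ℝ τ (R ∩ O) x).flip a) = 0} = 0 := by
    intro i
    refine volume_setOf_exists_covector_eq_zero hR hO (hf.of_le (by norm_cast))
      (hτ.of_le (by norm_cast)) hf'
      (τ' := fun x => (fderivWithin ℝ τ (R ∩ O) x).flip.toLinearMap) hτ'
      (fun x hx b β => ?_) ((Module.finBasis ℝ F).ne_zero i)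
    obtain ⟨a, h1, h2⟩ := hspan x hx b β
    exact ⟨a, h1, (hτa x hx a).symm.trans h2⟩
  refine measure_mono_null ?_ (measure_iUnion_null key)
  rintro a ⟨x, hx, h0, hns⟩
  have h5 : fderivWithin ℝ (fun y => f y + τ y a) R x =
      fderivWithin ℝ f (R ∩ O) x + (fderivWithin ℝ τ (R ∩ O) x).flip a := by
    rw [← hτa x hx, ← hfd _ x hx, ← hfd _ x hx]
    exact fderivWithin_fun_add (hU x hx) (hfdiff x hx)
      ((hτdiff x hx).clm_apply (differentiableWithinAt_const a))
  rw [h5] at hns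
  -- a covector which annihilates the image is nonzero on some vector of the basis
  have hlt : LinearMap.range (fderivWithin ℝ f (R ∩ O) x +
      (fderivWithin ℝ τ (R ∩ O) x).flip a).toLinearMap < ⊤ :=
    lt_top_iff_ne_top.2 fun h => hns (LinearMap.range_eq_top.1 h)
  obtain ⟨g, hg0, hg⟩ := Submodule.exists_le_ker_of_lt_top _ hlt
  obtain ⟨i, hi⟩ : ∃ i, g (Module.finBasis ℝ F i) ≠ 0 := by
    by_contra! h
    exact hg0 ((Module.finBasis ℝ F).ext fun i => by simpa using h i)
  refine mem_iUnion.2 ⟨i, x, hx, LinearMap.toContinuousLinearMap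
    ((g (Module.finBasis ℝ F i))⁻¹ • g), ?_, h0, ?_⟩
  · exact inv_mul_cancel₀ hi
  · ext v
    have h6 : g ((fderivWithin ℝ f (R ∩ O) x + (fderivWithin ℝ τ (R ∩ O) x).flip a) v) = 0 :=
      hg ⟨v, rfl⟩
    exact (congrArg ((g (Module.finBasis ℝ F i))⁻¹ • ·) h6).trans (smul_zero _)

end Genericity

/-! ### Families of sections with spanning jets -/

section Jets

open MeasureTheory

variable {n : ℕ} {M : Type u} [TopologicalSpace M] [ChartedSpace (EuclideanQuadrant n) M]

/-- Derivatives in a chart and derivatives in the preferred charts differ by an isomorphism. -/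
theorem exists_equiv_fderivWithin_eq [IsManifold (cornerModel n) ∞ M] {F : Type*}
    [NormedAddCommGroup F] [NormedSpace ℝ F] (w₀ : M) {x : EuclideanSpace ℝ (Fin n)}
    (hx : x ∈ (extChartAt (cornerModel n) w₀).target) :
    ∃ T : EuclideanSpace ℝ (Fin n) ≃L[ℝ] EuclideanSpace ℝ (Fin n), ∀ h : M → F,
      MDifferentiableAt (cornerModel n) 𝓘(ℝ, F) h ((extChartAt (cornerModel n) w₀).symm x) →
      fderivWithin ℝ (fun y => h ((extChartAt (cornerModel n) w₀).symm y))
        (range (cornerModel n)) x =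
        (mder n h ((extChartAt (cornerModel n) w₀).symm x)).comp
          (T : EuclideanSpace ℝ (Fin n) →L[ℝ] EuclideanSpace ℝ (Fin n)) := by
  have : IsManifold (cornerModel n) 1 M := IsManifold.of_le (n := ∞) (by norm_cast)
  obtain ⟨T, hT⟩ := isInvertible_mfderivWithin_extChartAt_symm (I := cornerModel n) hx
  refine ⟨T, fun h hh => ?_⟩
  have hxr : x ∈ range (cornerModel n) := extChartAt_target_subset_range w₀ hx
  have hu : UniqueMDiffWithinAt 𝓘(ℝ, EuclideanSpace ℝ (Fin n)) (range (cornerModel n)) x :=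
    (cornerModel n).uniqueMDiffOn x hxr
  have h1 := mfderiv_comp_mfderivWithin (x := x) hh
    (mdifferentiableWithinAt_extChartAt_symm (I := cornerModel n) hx) hu
  rw [← hT] at h1
  rw [← mfderivWithin_eq_fderivWithin]
  exact h1

variable (B : SmoothVectorBundle n M)

/-- The `1`-jets at `w` of the sections in the span of `𝒯` are all the `1`-jets of sections: every
section agrees at `w` to first order with a linear combination of elements of `𝒯`. -/
def SmoothVectorBundle.SpansJets (𝒯 : Set (∀ z, B.Fib z)) (w : M) : Prop :=
  ∀ u : ∀ z, B.Fib z, B.SmoothAt u w → ∃ t ∈ Submodule.span ℝ 𝒯,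
    u w - t w = 0 ∧ ∀ v : EuclideanSpace ℝ (Fin n), B.linearization (fun z => u z - t z) w v = 0

variable {B}

theorem SmoothVectorBundle.SpansJets.mono {𝒯 𝒯' : Set (∀ z, B.Fib z)} {w : M}
    (h : B.SpansJets 𝒯 w) (hs : 𝒯 ⊆ 𝒯') : B.SpansJets 𝒯' w := fun u hu => by
  obtain ⟨t, ht, h1⟩ := h u hu
  exact ⟨t, Submodule.span_mono hs ht, h1⟩

theorem SmoothVectorBundle.SmoothAt.of_mem_span {𝒯 : Set (∀ z, B.Fib z)} {w : M}
    (h : ∀ t ∈ 𝒯, B.SmoothAt t w) {t : ∀ z, B.Fib z} (ht : t ∈ Submodule.span ℝ 𝒯) :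
    B.SmoothAt t w := by
  induction ht using Submodule.span_induction with
  | mem t ht => exact h t ht
  | zero => exact SmoothVectorBundle.smoothAt_zero w
  | add s t _ _ hs ht => exact hs.add ht
  | smul c t _ ht => exact ht.const_smul c

theorem SmoothVectorBundle.symm_injective (e : Trivialization B.Model (π B.Model B.Fib))
    [MemTrivializationAtlas e] {w : M} (hw : w ∈ e.baseSet) :
    Function.Bijective (e.symm w) :=
  (e.continuousLinearEquivAt ℝ w hw).symm.bijective

theorem SmoothVectorBundle.symm_zero (e : Trivialization B.Model (π B.Model B.Fib))
    [MemTrivializationAtlas e] {w : M} (hw : w ∈ e.baseSet) : e.symm w 0 = 0 :=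
  (e.continuousLinearEquivAt ℝ w hw).symm.map_zero

/-- Surjectivity of the linearization at a zero, in a local trivialization. -/
theorem SmoothVectorBundle.linearization_surjective_iff [IsManifold (cornerModel n) ∞ M]
    {s : ∀ z, B.Fib z} {w : M} (hs : B.SmoothAt s w) (h0 : s w = 0)
    (e : Trivialization B.Model (π B.Model B.Fib)) [MemTrivializationAtlas e]
    (hw : w ∈ e.baseSet) :
    Function.Surjective (B.linearization s w) ↔ Function.Surjective (mder n (B.coord e s) w) := by
  have h : B.linearization s w =
      e.symm w ∘ (mder n (B.coord e s) w : EuclideanSpace ℝ (Fin n) → B.Model) :=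
    funext fun v => SmoothVectorBundle.linearization_eq hs h0 e hw v
  rw [h]
  constructor
  · intro h1 y
    obtain ⟨v, hv⟩ := h1 (e.symm w y)
    exact ⟨v, (SmoothVectorBundle.symm_injective e hw).1 hv⟩
  · exact fun h1 => (SmoothVectorBundle.symm_injective e hw).2.comp h1

theorem SmoothVectorBundle.linearization_eq_zero_iff [IsManifold (cornerModel n) ∞ M]
    {s : ∀ z, B.Fib z} {w : M} (hs : B.SmoothAt s w) (h0 : s w = 0)
    (e : Trivialization B.Model (π B.Model B.Fib)) [MemTrivializationAtlas e]
    (hw : w ∈ e.baseSet) :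
    (∀ v : EuclideanSpace ℝ (Fin n), B.linearization s w v = 0) ↔ mder n (B.coord e s) w = 0 := by
  have h : ∀ v : EuclideanSpace ℝ (Fin n), B.linearization s w v =
      e.symm w (mder n (B.coord e s) w v) :=
    fun v => SmoothVectorBundle.linearization_eq hs h0 e hw v
  constructor
  · intro h1
    ext1 v
    apply (SmoothVectorBundle.symm_injective e hw).1
    rw [← h v, h1 v]
    exact (SmoothVectorBundle.symm_zero e hw).symm
  · intro h1 v
    rw [h v, h1]
    exact SmoothVectorBundle.symm_zero e hw

/-- The principal part of a section in a trivialization and a chart. -/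
def SmoothVectorBundle.chartCoord (e : Trivialization B.Model (π B.Model B.Fib)) (w₀ : M)
    (s : ∀ z, B.Fib z) (y : EuclideanSpace ℝ (Fin n)) : B.Model :=
  B.coord e s ((extChartAt (cornerModel n) w₀).symm y)

theorem SmoothVectorBundle.contDiffOn_chartCoord [IsManifold (cornerModel n) ∞ M]
    (e : Trivialization B.Model (π B.Model B.Fib)) [MemTrivializationAtlas e] (w₀ : M)
    {s : ∀ z, B.Fib z} {D : Set (EuclideanSpace ℝ (Fin n))}
    (hD : ∀ y ∈ D, y ∈ (extChartAt (cornerModel n) w₀).target ∧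
      (extChartAt (cornerModel n) w₀).symm y ∈ e.baseSet ∧
      B.SmoothAt s ((extChartAt (cornerModel n) w₀).symm y)) :
    ContDiffOn ℝ ∞ (SmoothVectorBundle.chartCoord e w₀ s) D := by
  rw [← contMDiffOn_iff_contDiffOn]
  intro y hy
  have h1 := (contMDiffOn_extChartAt_symm (I := cornerModel n) (n := ∞) w₀ y (hD y hy).1).mono
    (fun y hy => (hD y hy).1 : D ⊆ _)
  exact ((hD y hy).2.2.coord e (hD y hy).2.1).comp_contMDiffWithinAt y h1

/-- Around every point, a relatively open subset of the model lies in a given open set. -/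
theorem exists_isOpen_extChartAt_symm (w₀ : M) {O : Set M} (hO : IsOpen O) (hw : w₀ ∈ O) :
    ∃ D : Set (EuclideanSpace ℝ (Fin n)), IsOpen D ∧ extChartAt (cornerModel n) w₀ w₀ ∈ D ∧
      ∀ y ∈ range (cornerModel n) ∩ D, y ∈ (extChartAt (cornerModel n) w₀).target ∧
        (extChartAt (cornerModel n) w₀).symm y ∈ O := by
  have h1 : (extChartAt (cornerModel n) w₀).target ∩
      (extChartAt (cornerModel n) w₀).symm ⁻¹' O ∈
      𝓝[range (cornerModel n)] (extChartAt (cornerModel n) w₀ w₀) := by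
    refine inter_mem (extChartAt_target_mem_nhdsWithin w₀) ?_
    refine mem_nhdsWithin_of_mem_nhds ?_
    have := (continuousAt_extChartAt_symm (I := cornerModel n) w₀)
    exact this.preimage_mem_nhds (by rw [extChartAt_to_inv]; exact hO.mem_nhds hw)
  obtain ⟨D, hD, hwD, hsub⟩ := mem_nhdsWithin.1 h1
  exact ⟨D, hD, hwD, fun y hy => hsub ⟨hy.2, hy.1⟩⟩

variable {ι : Type*} [Fintype ι]

/-- Generic transversality: if the `1`-jets of the linear family `a ↦ τ a` of sections span
at every point of `O`, then `u + τ a` is transverse over `O` for almost every `a`. -/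
theorem SmoothVectorBundle.volume_not_transverse_eq_zero [IsManifold (cornerModel n) ∞ M]
    [SecondCountableTopology M] {O : Set M} (hO : IsOpen O) {u : ∀ z, B.Fib z}
    (hu : ∀ z ∈ O, B.SmoothAt u z) {τ : ∀ z, (ι → ℝ) →ₗ[ℝ] B.Fib z}
    (hτ : ∀ a, ∀ z ∈ O, B.SmoothAt (fun w => τ w a) z)
    (hspan : ∀ z ∈ O, B.SpansJets (range fun a => fun w => τ w a) z) :
    volume {a : ι → ℝ | ∃ z ∈ O, u z + τ z a = 0 ∧
      ¬ Function.Surjective (B.linearization (fun w => u w + τ w a) z)} = 0 := by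
  have hspan' : ∀ z ∈ O, ∀ s : ∀ z, B.Fib z, B.SmoothAt s z → ∃ a, s z - τ z a = 0 ∧
      ∀ v : EuclideanSpace ℝ (Fin n), B.linearization (fun w => s w - τ w a) z v = 0 := by
    intro z hz s hs
    obtain ⟨t, ht, h1⟩ := hspan z hz s hs
    let T : (ι → ℝ) →ₗ[ℝ] ∀ z, B.Fib z := LinearMap.pi τ
    have hT : (range fun a => fun w => τ w a) = (LinearMap.range T : Set (∀ z, B.Fib z)) := rfl
    rw [hT, Submodule.span_eq] at ht
    obtain ⟨a, rfl⟩ := ht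
    exact ⟨a, h1⟩
  have loc : ∀ w₀ ∈ O, ∃ N ∈ 𝓝[O] w₀, volume {a : ι → ℝ | ∃ z ∈ N, z ∈ O ∧ u z + τ z a = 0 ∧
      ¬ Function.Surjective (B.linearization (fun w => u w + τ w a) z)} = 0 := by
    intro w₀ hw₀
    let e := B.triv w₀
    obtain ⟨D, hD, hwD, hsub⟩ := exists_isOpen_extChartAt_symm (n := n) w₀
      (hO.inter e.open_baseSet) ⟨hw₀, SmoothVectorBundle.mem_triv w₀⟩
    set φ := extChartAt (cornerModel n) w₀ with hφ
    let R := range (cornerModel n)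
    let f : EuclideanSpace ℝ (Fin n) → B.Model := SmoothVectorBundle.chartCoord e w₀ u
    let τ' : EuclideanSpace ℝ (Fin n) → (ι → ℝ) →L[ℝ] B.Model := fun y =>
      LinearMap.toContinuousLinearMap ((e.linearMapAt ℝ (φ.symm y)).comp (τ (φ.symm y)))
    have hτ' : ∀ y ∈ R ∩ D, ∀ a, τ' y a =
        SmoothVectorBundle.chartCoord e w₀ (fun w => τ w a) y := by
      intro y hy a
      change e.linearMapAt ℝ (φ.symm y) (τ (φ.symm y) a) = (e ⟨φ.symm y, τ (φ.symm y) a⟩).2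
      rw [e.linearMapAt_apply, if_pos (hsub y hy).2.2]
    have hf : ContDiffOn ℝ ∞ f (R ∩ D) := SmoothVectorBundle.contDiffOn_chartCoord e w₀
      fun y hy => ⟨(hsub y hy).1, (hsub y hy).2.2, hu _ (hsub y hy).2.1⟩
    have hτd : ContDiffOn ℝ ∞ τ' (R ∩ D) := contDiffOn_clm_apply.2 fun a =>
      (SmoothVectorBundle.contDiffOn_chartCoord e w₀ fun y hy => ⟨(hsub y hy).1, (hsub y hy).2.2,
        hτ a _ (hsub y hy).2.1⟩).congr fun y hy => hτ' y hy a
    have hRu : ∀ x ∈ R, UniqueDiffWithinAt ℝ R x := fun x hx => (cornerModel n).uniqueDiffOn x hx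
    have hnull := volume_setOf_not_transverse_eq_zero (R := R) (O := D) (cornerModel n).convex_range
      (cornerModel n).nonempty_interior hD hf hτd ?_
    · refine ⟨φ.source ∩ φ ⁻¹' D, mem_nhdsWithin_of_mem_nhds ?_, measure_mono_null ?_ hnull⟩
      · exact inter_mem (extChartAt_source_mem_nhds w₀)
          ((continuousAt_extChartAt w₀).preimage_mem_nhds (hD.mem_nhds hwD))
      · rintro a ⟨z, ⟨hz1, hz2⟩, hzO, h0, hns⟩
        have hx : φ z ∈ R ∩ D := ⟨extChartAt_target_subset_range w₀ (φ.map_source hz1), hz2⟩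
        have hxz : φ.symm (φ z) = z := φ.left_inv hz1
        refine ⟨φ z, hx, ?_, fun hs => hns ?_⟩
        · rw [hτ' _ hx]
          change B.coord e u (φ.symm (φ z)) + B.coord e (fun w => τ w a) (φ.symm (φ z)) = 0
          rw [hxz, ← B.coord_add e (by simpa [hxz] using (hsub _ hx).2.2),
            B.coord_eq_zero_iff e (by simpa [hxz] using (hsub _ hx).2.2)]
          exact h0
        · have hze : z ∈ e.baseSet := by simpa [hxz] using (hsub _ hx).2.2
          have hsm := (hu z hzO).add (hτ a z hzO)
          rw [SmoothVectorBundle.linearization_surjective_iff hsm h0 e hze]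
          obtain ⟨T, hT⟩ := exists_equiv_fderivWithin_eq (F := B.Model) w₀ (hsub _ hx).1
          have h1 := hT (B.coord e fun w => u w + τ w a) (by
            rw [hxz]
            exact (hsm.coord e hze).mdifferentiableAt (by simp))
          have h2 : fderivWithin ℝ (fun y => f y + τ' y a) R (φ z) =
              fderivWithin ℝ (fun y => B.coord e (fun w => u w + τ w a) (φ.symm y)) R (φ z) := by
            refine Filter.EventuallyEq.fderivWithin_eq_of_mem ?_ hx.1
            filter_upwards [inter_mem_nhdsWithin R (hD.mem_nhds hx.2)] with y hy
            rw [hτ' y hy, B.coord_add e (hsub y hy).2.2]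
            rfl
          rw [h2, h1, hxz] at hs
          intro y
          obtain ⟨v, hv⟩ := hs y
          exact ⟨T v, hv⟩
    · intro x hx b β
      set z := φ.symm x with hz
      have hzO : z ∈ O := (hsub x hx).2.1
      have hze : z ∈ e.baseSet := (hsub x hx).2.2
      have hφz : φ z = x := φ.right_inv (hsub x hx).1
      have hzs : z ∈ φ.source := φ.map_target (hsub x hx).1
      have hsm : B.SmoothAt (fun w => e.symm w (b + β (φ w - x))) z := by
        refine B.smoothAt_symm e hze ?_
        have h1 : ContMDiffAt (cornerModel n) 𝓘(ℝ, EuclideanSpace ℝ (Fin n)) ∞ φ z :=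
          contMDiffAt_extChartAt' (by rwa [hφ, extChartAt_source] at hzs)
        exact contMDiffAt_const.add (β.contMDiff.contMDiffAt.comp z (h1.sub contMDiffAt_const))
      obtain ⟨a, ha0, ha1⟩ := hspan' z hzO _ hsm
      have hda := hsm.sub (hτ a z hzO)
      refine ⟨a, ?_, ?_⟩
      · rw [hτ' x hx]
        change B.coord e (fun w => τ w a) z = b
        have h1 := (B.coord_eq_zero_iff e (s := fun w => e.symm w (b + β (φ w - x)) - τ w a)
          hze).2 ha0
        rw [B.coord_sub e hze, B.coord_symm e hze, hφz, sub_self, map_zero, add_zero,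
          sub_eq_zero] at h1
        exact h1.symm
      · rw [SmoothVectorBundle.linearization_eq_zero_iff hda ha0 e hze] at ha1
        obtain ⟨T, hT⟩ := exists_equiv_fderivWithin_eq (F := B.Model) w₀ (hsub _ hx).1
        have h1 := hT _ ((hda.coord e hze).mdifferentiableAt (by simp))
        rw [ha1, ContinuousLinearMap.zero_comp] at h1
        have h2 : fderivWithin ℝ (fun y => (b + β (y - x)) - τ' y a) R x = 0 := by
          rw [← h1]
          refine Filter.EventuallyEq.fderivWithin_eq_of_mem ?_ hx.1
          filter_upwards [inter_mem_nhdsWithin R (hD.mem_nhds hx.2)] with y hy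
          rw [hτ' y hy, B.coord_sub e (hsub y hy).2.2, B.coord_symm e (hsub y hy).2.2,
            φ.right_inv (hsub y hy).1]
          rfl
        have h3 : HasFDerivWithinAt (fun y => b + β (y - x)) β R x := by
          have := (β.hasFDerivAt (x := x - x)).comp (f := fun y => y - x) x
            ((hasFDerivAt_id x).sub_const x)
          exact (this.const_add b).hasFDerivWithinAt
        have h4 : DifferentiableWithinAt ℝ (fun y => τ' y a) R x := by
          have h5 : ContDiffOn ℝ ∞ (fun y => τ' y a) (R ∩ D) := hτd.clm_apply contDiffOn_const
          have h6 := h5.differentiableOn (by simp) x hx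
          exact (differentiableWithinAt_inter (hD.mem_nhds hx.2)).1 h6
        rw [fderivWithin_fun_sub (hRu x hx.1) h3.differentiableWithinAt h4,
          h3.fderivWithin (hRu x hx.1), sub_eq_zero] at h2
        exact h2.symm
  choose! N hN hN0 using loc
  obtain ⟨C, hC, hcC, hcov⟩ := TopologicalSpace.countable_cover_nhdsWithin hN
  refine measure_mono_null ?_ ((measure_biUnion_null_iff hcC).2 fun y hy => hN0 y (hC hy))
  rintro a ⟨z, hz, h⟩
  obtain ⟨y', hy', hyy'⟩ := mem_iUnion₂.1 (hcov hz)
  exact mem_iUnion₂.2 ⟨y', hy', z, hyy', hz, h⟩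

end Jets

/-! ### Existence of spanning families -/

section SpanningFamilies

variable {n : ℕ} {M : Type u} [TopologicalSpace M] [ChartedSpace (EuclideanQuadrant n) M]
variable {B : SmoothVectorBundle n M}

theorem SmoothVectorBundle.linearization_congr {s t : ∀ z, B.Fib z} {w : M}
    (h : ∀ᶠ z in 𝓝 w, s z = t z) : B.linearization s w = B.linearization t w := by
  have h1 : (fun z => ((B.triv w) (B.toTot s z)).2) =ᶠ[𝓝 w]
      fun z => ((B.triv w) (B.toTot t z)).2 := by
    filter_upwards [h] with z hz
    simp only [SmoothVectorBundle.toTot, hz]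
  have h2 : mder n (fun z => ((B.triv w) (B.toTot s z)).2) w =
      mder n (fun z => ((B.triv w) (B.toTot t z)).2) w := h1.mfderiv_eq
  funext v
  exact congrArg (fun T => (B.triv w).symmL ℝ w (T v)) h2

variable [IsManifold (cornerModel n) ∞ M]

theorem SmoothVectorBundle.linearization_add {s t : ∀ z, B.Fib z} {w : M} (hs : B.SmoothAt s w)
    (ht : B.SmoothAt t w) (hs0 : s w = 0) (ht0 : t w = 0) (v : EuclideanSpace ℝ (Fin n)) :
    B.linearization (fun z => s z + t z) w v = B.linearization s w v + B.linearization t w v := by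
  have hw := SmoothVectorBundle.mem_triv (B := B) w
  have h : mder n (B.coord (B.triv w) fun z => s z + t z) w =
      mder n (B.coord (B.triv w) s) w + mder n (B.coord (B.triv w) t) w := by
    have h1 : B.coord (B.triv w) (fun z => s z + t z) =ᶠ[𝓝 w]
        B.coord (B.triv w) s + B.coord (B.triv w) t := by
      filter_upwards [(B.triv w).open_baseSet.mem_nhds hw] with z hz
      exact B.coord_add _ hz
    exact h1.mfderiv_eq.trans (mfderiv_add ((hs.coord _ hw).mdifferentiableAt (by simp))
      ((ht.coord _ hw).mdifferentiableAt (by simp)))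
  rw [SmoothVectorBundle.linearization_eq (hs.add ht) (by simp [hs0, ht0]) _ hw, h,
    SmoothVectorBundle.linearization_eq hs hs0 _ hw,
    SmoothVectorBundle.linearization_eq ht ht0 _ hw]
  exact ((B.triv w).continuousLinearEquivAt ℝ w hw).symm.map_add _ _

theorem SmoothVectorBundle.linearization_smul {s : ∀ z, B.Fib z} {f : M → ℝ} {w : M}
    (hf : ContMDiffAt (cornerModel n) 𝓘(ℝ, ℝ) ∞ f w) (hs : B.SmoothAt s w) (hs0 : s w = 0)
    (v : EuclideanSpace ℝ (Fin n)) :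
    B.linearization (fun z => f z • s z) w v = f w • B.linearization s w v := by
  have hw := SmoothVectorBundle.mem_triv (B := B) w
  have hid : ContMDiff 𝓘(ℝ, ℝ) 𝓘(ℝ, B.Model →L[ℝ] B.Model) ∞
      (fun c : ℝ => c • (1 : B.Model →L[ℝ] B.Model)) :=
    (contDiff_id.smul contDiff_const).contMDiff
  have hA : MDifferentiableAt (cornerModel n) 𝓘(ℝ, B.Model →L[ℝ] B.Model)
      (fun z => f z • (1 : B.Model →L[ℝ] B.Model)) w :=
    ((hid.contMDiffAt).comp w hf).mdifferentiableAt (by simp)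
  have h : mder n (B.coord (B.triv w) fun z => f z • s z) w =
      (f w • (1 : B.Model →L[ℝ] B.Model)).comp (mder n (B.coord (B.triv w) s) w) := by
    rw [← mder_clm_apply_of_eq_zero hA ((hs.coord _ hw).mdifferentiableAt (by simp))
      ((B.coord_eq_zero_iff _ hw).2 hs0)]
    refine Filter.EventuallyEq.mfderiv_eq ?_
    filter_upwards [(B.triv w).open_baseSet.mem_nhds hw] with z hz
    rw [B.coord_smul _ hz]
    rfl
  rw [SmoothVectorBundle.linearization_eq (hs.smul hf) (by simp [hs0]) _ hw, h,
    SmoothVectorBundle.linearization_eq hs hs0 _ hw]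
  exact ((B.triv w).continuousLinearEquivAt ℝ w hw).symm.map_smul _ _

/-- Multiplication by a function preserves the spanning property where the function is nonzero. -/
theorem SmoothVectorBundle.SpansJets.smul {𝒯 : Set (∀ z, B.Fib z)} {w : M}
    (h : B.SpansJets 𝒯 w) (h𝒯 : ∀ t ∈ 𝒯, B.SmoothAt t w) {f : M → ℝ}
    (hf : ContMDiffAt (cornerModel n) 𝓘(ℝ, ℝ) ∞ f w) (hfw : f w ≠ 0) :
    B.SpansJets ((fun t z => f z • t z) '' 𝒯) w := by
  intro u hu
  have hfi : ContMDiffAt (cornerModel n) 𝓘(ℝ, ℝ) ∞ (fun z => (f z)⁻¹) w := hf.inv₀ hfw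
  obtain ⟨t, ht, h0, h1⟩ := h _ (hu.smul hfi)
  have hts := SmoothVectorBundle.SmoothAt.of_mem_span h𝒯 ht
  let m : (∀ z, B.Fib z) →ₗ[ℝ] ∀ z, B.Fib z :=
    { toFun := fun t z => f z • t z
      map_add' := fun s t => funext fun z => smul_add _ _ _
      map_smul' := fun c t => funext fun z => smul_comm _ _ _ }
  have hev : ∀ᶠ z in 𝓝 w, u z - f z • t z = f z • ((f z)⁻¹ • u z - t z) := by
    filter_upwards [hf.continuousAt.eventually_ne hfw] with z hz
    rw [smul_sub, smul_inv_smul₀ hz]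
  refine ⟨fun z => f z • t z, ?_, ?_, fun v => ?_⟩
  · have h2 : Submodule.span ℝ ((fun t z => f z • t z) '' 𝒯) =
        (Submodule.span ℝ 𝒯).map m := (Submodule.map_span m 𝒯).symm
    rw [h2]
    exact ⟨t, ht, rfl⟩
  · rw [hev.self_of_nhds, h0, smul_zero]
  · rw [SmoothVectorBundle.linearization_congr hev,
      SmoothVectorBundle.linearization_smul hf ((hu.smul hfi).sub hts) h0, h1 v, smul_zero]

variable [T2Space M] [SecondCountableTopology M]

theorem locallyCompactSpace_of_corners (m : ℕ) (N : Type*) [TopologicalSpace N]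
    [ChartedSpace (EuclideanQuadrant m) N] : LocallyCompactSpace N := by
  have : LocallyCompactSpace (EuclideanQuadrant m) := (cornerModel m).locallyCompactSpace
  exact ChartedSpace.locallyCompactSpace (EuclideanQuadrant m) N

variable (n) in
/-- A smooth function with values in `[0, 1]`, equal to `1` near the closed set `s` and to `0` near
every point outside the open set `O ⊇ s`. -/
theorem exists_smooth_cutoff {s O : Set M} (hs : IsClosed s) (hO : IsOpen O) (hsO : s ⊆ O) :
    ∃ f : M → ℝ, ContMDiff (cornerModel n) 𝓘(ℝ, ℝ) ∞ f ∧ (∀ z ∈ s, ∀ᶠ w in 𝓝 z, f w = 1) ∧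
      (∀ z ∉ O, ∀ᶠ w in 𝓝 z, f w = 0) ∧ ∀ z, f z ∈ Icc (0 : ℝ) 1 := by
  have := locallyCompactSpace_of_corners n M
  obtain ⟨f, h0, h1, h2⟩ := exists_contMDiffMap_zero_one_nhds_of_isClosed (cornerModel n)
    (n := ⊤) hO.isClosed_compl hs (disjoint_compl_left_iff_subset.2 hsO)
  exact ⟨f, f.contMDiff, fun z hz => h1.filter_mono (nhds_le_nhdsSet hz),
    fun z hz => h0.filter_mono (nhds_le_nhdsSet hz), h2⟩

/-- Near every point the `1`-jets are spanned by finitely many globally smooth sections: those which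
are affine in a chart and a trivialization, cut off. -/
theorem SmoothVectorBundle.exists_spansJets_nhds (B : SmoothVectorBundle n M) (z₀ : M) :
    ∃ 𝒯 : Set (∀ z, B.Fib z), 𝒯.Finite ∧ (∀ t ∈ 𝒯, ∀ z, B.SmoothAt t z) ∧
      ∀ᶠ w in 𝓝 z₀, B.SpansJets 𝒯 w := by
  let e := B.triv z₀
  set φ := extChartAt (cornerModel n) z₀ with hφ
  have hO : IsOpen (e.baseSet ∩ φ.source) :=
    e.open_baseSet.inter (isOpen_extChartAt_source z₀)
  have hz₀ : z₀ ∈ e.baseSet ∩ φ.source :=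
    ⟨SmoothVectorBundle.mem_triv z₀, mem_extChartAt_source z₀⟩
  obtain ⟨ψ, hψ, hψ1, hψ0, -⟩ := exists_smooth_cutoff n (isClosed_singleton (x := z₀)) hO
    (singleton_subset_iff.2 hz₀)
  let E := EuclideanSpace ℝ (Fin n)
  let m : B.Model × (E →L[ℝ] B.Model) →ₗ[ℝ] ∀ z, B.Fib z :=
    { toFun := fun p z => ψ z • e.symmL ℝ z (p.1 + p.2 (φ z))
      map_add' := fun p q => funext fun z => by
        simp only [Prod.fst_add, Prod.snd_add, add_apply, Pi.add_apply]
        rw [← smul_add, ← map_add, add_add_add_comm]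
      map_smul' := fun c p => funext fun z => by
        simp only [Prod.smul_fst, Prod.smul_snd, smul_apply, Pi.smul_apply, RingHom.id_apply]
        rw [← smul_add, map_smul, smul_comm] }
  have hφs : ∀ z ∈ φ.source, ContMDiffAt (cornerModel n) 𝓘(ℝ, E) ∞ φ z := fun z hz =>
    contMDiffAt_extChartAt' (by rwa [hφ, extChartAt_source] at hz)
  have hsm : ∀ p : B.Model × (E →L[ℝ] B.Model), ∀ z ∈ e.baseSet ∩ φ.source,
      B.SmoothAt (fun w => e.symm w (p.1 + p.2 (φ w))) z := fun p z hz =>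
    B.smoothAt_symm e hz.1 (contMDiffAt_const.add (p.2.contMDiff.contMDiffAt.comp z (hφs z hz.2)))
  have hm : ∀ p z, B.SmoothAt (m p) z := by
    intro p z
    by_cases hz : z ∈ e.baseSet ∩ φ.source
    · refine ((hsm p z hz).smul hψ.contMDiffAt).congr ?_
      filter_upwards [hO.mem_nhds hz] with w hw
      change ψ w • e.symmL ℝ w _ = _
      rw [e.symmL_apply hw.1]
    · refine (SmoothVectorBundle.smoothAt_zero z).congr ?_
      filter_upwards [hψ0 z hz] with w hw
      change ψ w • e.symmL ℝ w _ = _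
      rw [hw, zero_smul]
  let b := Module.finBasis ℝ (B.Model × (E →L[ℝ] B.Model))
  refine ⟨m '' range b, (finite_range b).image m, ?_, ?_⟩
  · rintro t ⟨p, -, rfl⟩ z
    exact hm p z
  · have hspan : Submodule.span ℝ (m '' range b) = LinearMap.range m := by
      rw [← Submodule.map_span, b.span_eq, Submodule.map_top]
    filter_upwards [(hψ1 z₀ rfl).eventually_nhds, hO.mem_nhds hz₀] with w hw1 hw2
    intro u hu
    obtain ⟨D, hD, hwD, hsub⟩ := exists_isOpen_extChartAt_symm (n := n) w hO hw2
    let R := range (cornerModel n)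
    let x := φ w
    have hxt : x ∈ φ.target := φ.map_source hw2.2
    have hxw : φ.symm x = w := φ.left_inv hw2.2
    have hxR : x ∈ R := extChartAt_target_subset_range z₀ hxt
    let û : E → B.Model := fun y => B.coord e u (φ.symm y)
    let β : E →L[ℝ] B.Model := fderivWithin ℝ û R x
    let p : B.Model × (E →L[ℝ] B.Model) := (B.coord e u w - β x, β)
    have hev : ∀ᶠ z in 𝓝 w, m p z = e.symm z (p.1 + p.2 (φ z)) := by
      filter_upwards [hw1, hO.mem_nhds hw2] with z hz1 hz2
      change ψ z • e.symmL ℝ z _ = _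
      rw [e.symmL_apply hz2.1, hz1, one_smul]
    have hd := hu.sub (hsm p w hw2)
    have h0 : u w - e.symm w (p.1 + p.2 (φ w)) = 0 := by
      rw [← B.coord_eq_zero_iff e (s := fun z => u z - e.symm z (p.1 + p.2 (φ z))) hw2.1,
        B.coord_sub e hw2.1, B.coord_symm e hw2.1]
      change B.coord e u w - (B.coord e u w - β x + β x) = 0
      rw [sub_add_cancel, sub_self]
    refine ⟨m p, by rw [hspan]; exact ⟨p, rfl⟩, by rw [hev.self_of_nhds, h0], ?_⟩
    have hev' : ∀ᶠ z in 𝓝 w, u z - m p z = u z - e.symm z (p.1 + p.2 (φ z)) := by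
      filter_upwards [hev] with z hz
      rw [hz]
    rw [SmoothVectorBundle.linearization_congr hev',
      SmoothVectorBundle.linearization_eq_zero_iff hd h0 e hw2.1]
    obtain ⟨T, hT⟩ := exists_equiv_fderivWithin_eq (F := B.Model) z₀ hxt
    have hu' := (hu.coord e hw2.1).mdifferentiableAt (n := ∞) (by simp)
    have hd' := (hd.coord e hw2.1).mdifferentiableAt (n := ∞) (by simp)
    have h1 := hT _ (by rw [hxw]; exact hd')
    rw [hxw] at h1
    have hxr : UniqueDiffWithinAt ℝ R x := (cornerModel n).uniqueDiffOn x hxR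
    have hûd : DifferentiableWithinAt ℝ û R x := by
      have h2 : MDifferentiableWithinAt 𝓘(ℝ, E) 𝓘(ℝ, B.Model) û R x :=
        MDifferentiableAt.comp_mdifferentiableWithinAt (g := B.coord e u) (f := φ.symm) x
          (by rw [hxw]; exact hu')
          (mdifferentiableWithinAt_extChartAt_symm (I := cornerModel n) hxt)
      exact mdifferentiableWithinAt_iff_differentiableWithinAt.1 h2
    have h3 : HasFDerivWithinAt (fun y => û y - (p.1 + β y)) (β - β) R x :=
      hûd.hasFDerivWithinAt.sub ((β.hasFDerivAt.const_add p.1).hasFDerivWithinAt)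
    have hnhd : φ.target ∩ φ.symm ⁻¹' (e.baseSet ∩ φ.source) ∈ 𝓝[R] x := by
      refine inter_mem (extChartAt_target_mem_nhdsWithin' hw2.2) (mem_nhdsWithin_of_mem_nhds ?_)
      exact (continuousAt_extChartAt_symm' hw2.2).preimage_mem_nhds
        (by rw [← hφ, hxw]; exact hO.mem_nhds hw2)
    have h4 : fderivWithin ℝ (fun y => B.coord e (fun z => u z - e.symm z (p.1 + p.2 (φ z)))
        (φ.symm y)) R x = 0 := by
      rw [← sub_self β, ← h3.fderivWithin hxr]
      refine Filter.EventuallyEq.fderivWithin_eq_of_mem ?_ hxR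
      filter_upwards [hnhd] with y hy
      rw [B.coord_sub e hy.2.1, B.coord_symm e hy.2.1, φ.right_inv hy.1]
    rw [h4] at h1
    ext1 v
    have h5 := congrArg (fun S => S (T.symm v)) h1
    simp only [ContinuousLinearMap.comp_apply, ContinuousLinearEquiv.coe_coe,
      ContinuousLinearEquiv.apply_symm_apply, zero_apply] at h5
    exact h5.symm

/-- The `1`-jets over a compact set are spanned by finitely many globally smooth sections. -/
theorem SmoothVectorBundle.exists_finite_spansJets (B : SmoothVectorBundle n M) {K : Set M}
    (hK : IsCompact K) :
    ∃ 𝒯 : Set (∀ z, B.Fib z), 𝒯.Finite ∧ (∀ t ∈ 𝒯, ∀ z, B.SmoothAt t z) ∧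
      ∀ w ∈ K, B.SpansJets 𝒯 w := by
  refine hK.induction_on (p := fun K => ∃ 𝒯 : Set (∀ z, B.Fib z), 𝒯.Finite ∧
    (∀ t ∈ 𝒯, ∀ z, B.SmoothAt t z) ∧ ∀ w ∈ K, B.SpansJets 𝒯 w) ?_ ?_ ?_ ?_
  · exact ⟨∅, finite_empty, by simp, by simp⟩
  · rintro s t hst ⟨𝒯, h1, h2, h3⟩
    exact ⟨𝒯, h1, h2, fun w hw => h3 w (hst hw)⟩
  · rintro s t ⟨𝒯, h1, h2, h3⟩ ⟨𝒯', h1', h2', h3'⟩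
    refine ⟨𝒯 ∪ 𝒯', h1.union h1', ?_, ?_⟩
    · rintro t (ht | ht)
      exacts [h2 t ht, h2' t ht]
    · rintro w (hw | hw)
      exacts [(h3 w hw).mono subset_union_left, (h3' w hw).mono subset_union_right]
  · intro z _
    obtain ⟨𝒯, h1, h2, h3⟩ := B.exists_spansJets_nhds z
    exact ⟨_, mem_nhdsWithin_of_mem_nhds h3, 𝒯, h1, h2, fun w hw => hw⟩

end SpanningFamilies

/-! ### Lifting sections along a level-1 structure -/

section LiftedSections

variable {X : Type u} [TopologicalSpace X] {Cy Cx : KuranishiChart X} {c : CoordChange Cy Cx}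

open Classical in
/-- The inverse of the fibrewise isomorphism `T w : Ẽ → E_y`, with values in `E_x`. -/
def LevelOneData.liftVec (L : LevelOneData c) (w : Cx.Base) : Cy.Fib (L.p w) →ₗ[ℝ] Cx.Fib w :=
  if h : Function.Bijective ((L.T w).domRestrict (L.sub w)) then
    (L.sub w).subtype.comp (LinearEquiv.ofBijective _ h).symm.toLinearMap
  else 0

/-- The lift of a single-valued section. -/
def LevelOneData.liftSec (L : LevelOneData c) (t : ∀ z, Cy.Fib z) (w : Cx.Base) : Cx.Fib w :=
  L.liftVec w (t (L.p w))

theorem CoordChange.isBundleMapOn (c : CoordChange Cy Cx) :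
    IsBundleMapOn Cy.bundle Cx.bundle c.Φ c.dom := c.Φ_smooth

theorem KuranishiChart.s_smoothAt (C : KuranishiChart X) (z : C.Base) :
    C.bundle.SmoothAt C.s z :=
  (C.bundle.smoothOn_iff isOpen_univ).1 C.s_smooth z (mem_univ z)

section Change

variable {L : LevelOneData c} {Uy Uy' : Set Cy.Base} {Ux Ux' : Set Cx.Base}
  (hL : IsLevelOneChange L Uy Uy' Ux Ux')

include hL

theorem IsLevelOneChange.isOpen_domIn : IsOpen (c.domIn Uy' Ux') := by
  rw [← hL.strong.2.1]
  exact isOpen_interior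

theorem IsLevelOneChange.liftVec_mem {w : Cx.Base} (hw : w ∈ L.W) (f : Cy.Fib (L.p w)) :
    L.liftVec w f ∈ L.sub w := by
  simp only [LevelOneData.liftVec, dif_pos (hL.T_bijective w hw), LinearMap.comp_apply,
    Submodule.subtype_apply]
  exact Subtype.property _

theorem IsLevelOneChange.T_liftVec {w : Cx.Base} (hw : w ∈ L.W) (f : Cy.Fib (L.p w)) :
    L.T w (L.liftVec w f) = f := by
  simp only [LevelOneData.liftVec, dif_pos (hL.T_bijective w hw), LinearMap.comp_apply,
    Submodule.subtype_apply]
  exact (LinearEquiv.ofBijective _ (hL.T_bijective w hw)).apply_symm_apply f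

theorem IsLevelOneChange.T_injective {w : Cx.Base} (hw : w ∈ L.W) {e e' : Cx.Fib w}
    (he : e ∈ L.sub w) (he' : e' ∈ L.sub w) (h : L.T w e = L.T w e') : e = e' :=
  congrArg Subtype.val ((hL.T_bijective w hw).1 (a₁ := ⟨e, he⟩) (a₂ := ⟨e', he'⟩) h)

theorem IsLevelOneChange.liftVec_eq_iff {w : Cx.Base} (hw : w ∈ L.W) {e : Cx.Fib w}
    (he : e ∈ L.sub w) (f : Cy.Fib (L.p w)) : L.liftVec w f = e ↔ f = L.T w e := by
  constructor
  · rintro rfl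
    exact (hL.T_liftVec hw f).symm
  · intro h
    exact hL.T_injective hw (hL.liftVec_mem hw f) he ((hL.T_liftVec hw f).trans h)

theorem IsLevelOneChange.isBundleMapOn_TQ :
    IsBundleMapOn Cx.bundle Cy.bundle (fun w => (L.T w).comp (L.Q w)) L.W := hL.T_smooth

theorem IsLevelOneChange.isBundleMapOn_Q :
    IsBundleMapOn Cx.bundle Cx.bundle (f := fun w => w) L.Q L.W := hL.Q_smooth

theorem IsLevelOneChange.contMDiffAt_p {w : Cx.Base} (hw : w ∈ L.W) :
    ContMDiffAt (cornerModel Cx.dim) (cornerModel Cy.dim) ∞ L.p w :=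
  hL.isBundleMapOn_TQ.contMDiffAt_base hL.W_open hw

theorem IsLevelOneChange.continuousOn_p : ContinuousOn L.p L.W := fun _ hw =>
  (hL.contMDiffAt_p hw).continuousAt.continuousWithinAt

theorem IsLevelOneChange.smoothAt_liftSec {w : Cx.Base} (hw : w ∈ L.W) {t : ∀ z, Cy.Fib z}
    (ht : Cy.bundle.SmoothAt t (L.p w)) : Cx.bundle.SmoothAt (L.liftSec t) w := by
  refine hL.isBundleMapOn_TQ.smoothAt_of_solution hL.W_open hw hL.Q_smooth ?_ ?_ ?_ ht ?_ ?_
  · intro w hw e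
    simp only [LinearMap.comp_apply]
    rw [hL.Q_of_mem w hw _ (hL.Q_mem w hw e)]
  · intro w hw e e' h
    simp only [LinearMap.comp_apply] at h
    rw [hL.Q_of_mem w hw _ (hL.Q_mem w hw e), hL.Q_of_mem w hw _ (hL.Q_mem w hw e')] at h
    exact hL.T_injective hw (hL.Q_mem w hw e) (hL.Q_mem w hw e') h
  · intro f
    refine ⟨L.liftVec w f, ?_⟩
    simp only [LinearMap.comp_apply]
    rw [hL.Q_of_mem w hw _ (hL.liftVec_mem hw f), hL.T_liftVec hw]
  · filter_upwards [hL.W_open.mem_nhds hw] with w' hw'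
    exact hL.Q_of_mem w' hw' _ (hL.liftVec_mem hw' _)
  · filter_upwards [hL.W_open.mem_nhds hw] with w' hw'
    simp only [LinearMap.comp_apply, LevelOneData.liftSec]
    rw [hL.Q_of_mem w' hw' _ (hL.liftVec_mem hw' _), hL.T_liftVec hw']

/-- Over the image of the coordinate change the lift of `t` is the image of `t`. -/
theorem IsLevelOneChange.liftSec_image {z : Cy.Base} (hz : z ∈ c.domIn Uy' Ux')
    (t : ∀ z, Cy.Fib z) : L.liftSec t (c.φ z) = c.Φ z (t z) := by
  have h1 := hL.T_image ⟨z, t z⟩ hz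
  have hmem : c.Φ z (t z) ∈ L.sub (c.φ z) := by
    rw [hL.sub_image z hz]
    exact ⟨_, rfl⟩
  refine (hL.liftVec_eq_iff (hL.image_mem z hz).1 hmem _).2 ?_
  have h2 : Cy.bundle.toTot t (L.p (c.φ z)) = Cy.bundle.toTot t z := by
    rw [(hL.image_mem z hz).2]
  have h3 : (⟨L.p (c.φ z), t (L.p (c.φ z))⟩ : Cy.Tot) =
      ⟨L.p (c.φ z), L.T (c.φ z) (c.Φ z (t z))⟩ := h2.trans h1.symm
  exact eq_of_heq (TotalSpace.mk.inj h3).2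

/-- The lift of a transverse section is transverse. At a zero `φ z` the image of the linearization
contains `Ẽ = Φ (E_y)`, since it contains the image of the linearization at `z`; and modulo `Ẽ` the
linearization is that of `s_x / Ẽ`, because the lift takes values in `Ẽ`. -/
theorem IsLevelOneChange.linearization_liftSec_surjective {w : Cx.Base} (hw : w ∈ L.W)
    {t : ∀ z, Cy.Fib z} (ht : Cy.bundle.SmoothAt t (L.p w))
    (htr : Cy.s (L.p w) + t (L.p w) = 0 →
      Function.Surjective (Cy.bundle.linearization (fun z => Cy.s z + t z) (L.p w)))
    (h0 : Cx.s w + L.liftSec t w = 0) :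
    Function.Surjective (Cx.bundle.linearization (fun w => Cx.s w + L.liftSec t w) w) := by
  have hsub : Cx.s w ∈ L.sub w := by
    rw [eq_neg_of_add_eq_zero_left h0]
    exact (L.sub w).neg_mem (hL.liftVec_mem hw _)
  obtain ⟨z, hz, rfl⟩ := (hL.quotient_zeros w hw).1 hsub
  rw [(hL.image_mem z hz).2] at ht htr
  have hsm := (Cx.s_smoothAt (c.φ z)).add
    (hL.smoothAt_liftSec hw (t := t) (by rwa [(hL.image_mem z hz).2]))
  have hsmy := (Cy.s_smoothAt z).add ht
  have hz0 : Cy.s z + t z = 0 := by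
    apply c.Φ_injective z hz.2.1
    rw [map_add, c.section_comp z hz.2.1, ← hL.liftSec_image hz, h0, map_zero]
  have hrange : ∀ v, Cx.bundle.linearization (fun w => Cx.s w + L.liftSec t w) (c.φ z)
      (mfderiv (cornerModel Cy.dim) (cornerModel Cx.dim) c.φ z v) =
        c.Φ z (Cy.bundle.linearization (fun z => Cy.s z + t z) z v) := by
    refine c.isBundleMapOn.linearization_apply c.dom_open hz.2.1 hsmy hsm hz0 ?_
    filter_upwards [hL.isOpen_domIn.mem_nhds hz] with z' hz'
    rw [map_add, c.section_comp z' hz'.2.1, hL.liftSec_image hz']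
  have hQsm : Cx.bundle.SmoothAt (fun w => L.Q w (Cx.s w + L.liftSec t w)) (c.φ z) :=
    hL.isBundleMapOn_Q.contMDiffAt_comp hL.W_open hw hsm
  have hQ : ∀ v : EuclideanSpace ℝ (Fin Cx.dim),
      Cx.bundle.linearization (fun w => L.Q w (Cx.s w + L.liftSec t w)) (c.φ z) v =
        L.Q (c.φ z) (Cx.bundle.linearization (fun w => Cx.s w + L.liftSec t w) (c.φ z) v) := by
    intro v
    have h1 := hL.isBundleMapOn_Q.linearization_apply hL.W_open hw hsm hQsm h0
      (Eventually.of_forall fun _ => rfl) v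
    have h2 : mfderiv (cornerModel Cx.dim) (cornerModel Cx.dim) (fun w : Cx.Base => w) (c.φ z) v
        = v := by
      change mfderiv (cornerModel Cx.dim) (cornerModel Cx.dim) id (c.φ z) v = v
      rw [mfderiv_id]
      rfl
    rw [h2] at h1
    exact h1
  have hquot : ∀ v : EuclideanSpace ℝ (Fin Cx.dim),
      Cx.bundle.linearization (fun w => Cx.s w - L.Q w (Cx.s w)) (c.φ z) v =
        Cx.bundle.linearization (fun w => Cx.s w + L.liftSec t w) (c.φ z) v -
          L.Q (c.φ z) (Cx.bundle.linearization (fun w => Cx.s w + L.liftSec t w) (c.φ z) v) := by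
    intro v
    have hQ0 : L.Q (c.φ z) (Cx.s (c.φ z) + L.liftSec t (c.φ z)) = 0 := by rw [h0, map_zero]
    have h1 : Cx.bundle.linearization (fun w => Cx.s w - L.Q w (Cx.s w)) (c.φ z) =
        Cx.bundle.linearization (fun w => (Cx.s w + L.liftSec t w) +
          (-1 : ℝ) • L.Q w (Cx.s w + L.liftSec t w)) (c.φ z) := by
      refine SmoothVectorBundle.linearization_congr ?_
      filter_upwards [hL.W_open.mem_nhds hw] with w' hw'
      have hq : L.Q w' (L.liftSec t w') = L.liftSec t w' :=
        hL.Q_of_mem w' hw' _ (hL.liftVec_mem hw' _)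
      rw [map_add, hq]
      module
    rw [h1, SmoothVectorBundle.linearization_add hsm (hQsm.const_smul (-1)) h0
      (by rw [hQ0, smul_zero]),
      SmoothVectorBundle.linearization_smul (f := fun _ => (-1 : ℝ)) contMDiffAt_const hQsm hQ0, hQ]
    module
  intro e
  obtain ⟨v, hv⟩ := hL.quotient_transverse z hz e
  have hv' := hquot v
  have h2 : e - Cx.bundle.linearization (fun w => Cx.s w + L.liftSec t w) (c.φ z) v ∈
      LinearMap.range (c.Φ z) := by
    rw [← hL.sub_image z hz]
    have h3 := (L.sub (c.φ z)).sub_mem hv (hL.Q_mem _ hw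
      (Cx.bundle.linearization (fun w => Cx.s w + L.liftSec t w) (c.φ z) v))
    have h4 := congrArg (fun y => e - y - L.Q (c.φ z)
      (Cx.bundle.linearization (fun w => Cx.s w + L.liftSec t w) (c.φ z) v)) hv'
    have h5 : e - Cx.bundle.linearization (fun w => Cx.s w + L.liftSec t w) (c.φ z) v =
        e - Cx.bundle.linearization (fun w => Cx.s w - L.Q w (Cx.s w)) (c.φ z) v - L.Q (c.φ z)
          (Cx.bundle.linearization (fun w => Cx.s w + L.liftSec t w) (c.φ z) v) := by
      refine Eq.trans ?_ h4.symm
      abel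
    rw [h5]
    exact h3
  obtain ⟨f, hf⟩ := h2
  obtain ⟨v', hv'⟩ := htr hz0 f
  refine ⟨v + mfderiv (cornerModel Cy.dim) (cornerModel Cx.dim) c.φ z v', ?_⟩
  have h6 := hrange v'
  rw [hv', hf] at h6
  have hadd : ∀ v v' : TangentSpace (cornerModel Cx.dim) (c.φ z),
      Cx.bundle.linearization (fun w => Cx.s w + L.liftSec t w) (c.φ z) (v + v') =
      Cx.bundle.linearization (fun w => Cx.s w + L.liftSec t w) (c.φ z) v +
      Cx.bundle.linearization (fun w => Cx.s w + L.liftSec t w) (c.φ z) v' := by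
    intro v v'
    simp only [SmoothVectorBundle.linearization]
    rw [map_add]
    exact map_add _ _ _
  rw [hadd, h6]
  abel

open Classical in
/-- The branches of a lifted multisection are the lifts of the branches. -/
theorem IsLevelOneChange.lift_apply {w : Cx.Base} (hw : w ∈ L.W) {Λ : Cy.Tot → ℚ} {κ : Type*}
    [Fintype κ] {f : κ → Cy.Fib (L.p w)} {q : κ → ℚ}
    (h : ∀ e, Λ ⟨L.p w, e⟩ = ∑ i, if f i = e then q i else 0) (e : Cx.Fib w) :
    L.lift Λ ⟨w, e⟩ = ∑ i, if L.liftVec w (f i) = e then q i else 0 := by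
  by_cases he : e ∈ L.sub w
  · have hin : L.InSub ⟨w, e⟩ := ⟨hw, he⟩
    rw [LevelOneData.lift, if_pos hin]
    change Λ ⟨L.p w, L.T w e⟩ = _
    rw [h]
    exact Finset.sum_congr rfl fun i _ => by rw [hL.liftVec_eq_iff hw he]
  · have hin : ¬ L.InSub ⟨w, e⟩ := fun h => he h.2
    rw [LevelOneData.lift, if_neg hin]
    refine (Finset.sum_eq_zero fun i _ => if_neg ?_).symm
    rintro rfl
    exact he (hL.liftVec_mem hw _)

/-- The lift of a transverse multisection is a transverse multisection. -/
theorem IsLevelOneChange.isTransverseOn_lift {τ : Cy.Tot → ℚ}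
    (hτ : IsTransverseOn Cy.bundle Cy.s τ (c.domIn Uy' Ux')) :
    IsTransverseOn Cx.bundle Cx.s (L.lift τ) L.W := by
  intro w hw
  obtain ⟨O, k, t, q, hO, hwO, -, ⟨hq, hq1, hts, hτt⟩, htr⟩ := hτ (L.p w) (hL.p_mem w hw)
  have hopen : IsOpen (L.W ∩ L.p ⁻¹' O) := hL.continuousOn_p.isOpen_inter_preimage hL.W_open hO
  have hsm : ∀ i, ∀ w' ∈ L.W ∩ L.p ⁻¹' O, Cy.bundle.SmoothAt (t i) (L.p w') := fun i w' hw' =>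
    (Cy.bundle.smoothOn_iff hO).1 (hts i) _ hw'.2
  refine ⟨L.W ∩ L.p ⁻¹' O, k, fun i => L.liftSec (t i), q, hopen, ⟨hw, hwO⟩, inter_subset_left,
    ⟨hq, hq1, fun i => ?_, fun w' hw' e => ?_⟩, fun w' hw' i h0 => ?_⟩
  · exact (Cx.bundle.smoothOn_iff hopen).2 fun w' hw' => hL.smoothAt_liftSec hw'.1 (hsm i w' hw')
  · exact hL.lift_apply hw'.1 (hτt _ hw'.2) e
  · exact hL.linearization_liftSec_surjective hw'.1 (hsm i w' hw')
      (fun h => htr _ hw'.2 i h) h0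

end Change

end LiftedSections

/-! ### Coordinate changes in opposite directions -/

section Groupoid

theorem SmoothVectorBundle.finrank_fib {n : ℕ} {M : Type u} [TopologicalSpace M]
    [ChartedSpace (EuclideanQuadrant n) M] (B : SmoothVectorBundle n M) (z : M) :
    FiniteDimensional ℝ (B.Fib z) ∧ Module.finrank ℝ (B.Fib z) = B.rank := by
  have e := ((trivializationAt B.Model B.Fib z).continuousLinearEquivAt ℝ z
    (FiberBundle.mem_baseSet_trivializationAt' z)).toLinearEquiv
  refine ⟨Module.Finite.equiv e.symm, ?_⟩
  rw [e.finrank_eq]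
  simp

variable {X : Type u} [TopologicalSpace X]

theorem CoordChange.rank_le {Cy Cx : KuranishiChart X} (c : CoordChange Cy Cx) {z : Cy.Base}
    (hz : z ∈ c.dom) : Cy.bundle.rank ≤ Cx.bundle.rank := by
  obtain ⟨-, h1⟩ := Cy.bundle.finrank_fib z
  obtain ⟨_, h2⟩ := Cx.bundle.finrank_fib (c.φ z)
  rw [← h1, ← h2]
  exact LinearMap.finrank_le_finrank_of_injective (c.Φ_injective z hz)

namespace GoodCoordinateSystem

variable (A : GoodCoordinateSystem X)

theorem I_refl (x : A.S) : A.I x x :=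
  ⟨A.le_refl x, ⟨x, A.base_point x, A.base_point x⟩⟩

variable {A}

/-- By maximality the identification is a single coordinate change followed by a group element. -/
theorem ident_full_iff {y x : A.S} (h : A.I y x) {a : (A.chart y).Base} {b : (A.chart x).Base} :
    A.Ident A.full ⟨y, a⟩ ⟨x, b⟩ ↔
      a ∈ (A.chg y x h).dom ∧ ∃ g : (A.chart x).Grp, b = g • (A.chg y x h).φ a := by
  constructor
  · exact A.maximality y x h a b
  · rintro ⟨ha, g, rfl⟩
    exact Relation.EqvGen.trans _ _ _
      (Relation.EqvGen.rel _ _ (Step.coord y x h a trivial ha trivial))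
      (Relation.EqvGen.rel _ _ (Step.grp x g _ trivial trivial))

theorem ident_φ {V : A.Fam} {y x : A.S} (h : A.I y x) {z : (A.chart y).Base}
    (hz : z ∈ A.domIn V y x h) : A.Ident V ⟨y, z⟩ ⟨x, (A.chg y x h).φ z⟩ :=
  Relation.EqvGen.rel _ _ (Step.coord y x h z hz.1 hz.2.1 hz.2.2)

theorem ident_smul {V : A.Fam} {x : A.S} (g : (A.chart x).Grp) {z : (A.chart x).Base}
    (hz : z ∈ V x) (hgz : g • z ∈ V x) : A.Ident V ⟨x, z⟩ ⟨x, g • z⟩ :=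
  Relation.EqvGen.rel _ _ (Step.grp x g z hz hgz)

theorem mem_dom_φ {y x : A.S} (h : A.I y x) (h' : A.I x y) {z : (A.chart y).Base}
    (hz : z ∈ (A.chg y x h).dom) : (A.chg y x h).φ z ∈ (A.chg x y h').dom := by
  have h1 : A.Ident A.full ⟨y, z⟩ ⟨x, (A.chg y x h).φ z⟩ :=
    (ident_full_iff h).2 ⟨hz, 1, (one_smul _ _).symm⟩
  exact ((ident_full_iff h').1 (Relation.EqvGen.symm _ _ h1)).1

theorem ρ_bijective {y x : A.S} (h : A.I y x) (h' : A.I x y) :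
    Function.Bijective (A.chg y x h).ρ :=
  (Nat.bijective_iff_injective_and_card _).2 ⟨(A.chg y x h).ρ_injective,
    le_antisymm (Nat.card_le_card_of_injective _ (A.chg y x h).ρ_injective)
      (Nat.card_le_card_of_injective _ (A.chg x y h').ρ_injective)⟩

theorem Φ_bijective {y x : A.S} (h : A.I y x) (h' : A.I x y) {z : (A.chart y).Base}
    (hz : z ∈ (A.chg y x h).dom) : Function.Bijective ((A.chg y x h).Φ z) := by
  obtain ⟨_, h1⟩ := (A.chart y).bundle.finrank_fib z
  obtain ⟨_, h2⟩ := (A.chart x).bundle.finrank_fib ((A.chg y x h).φ z)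
  have h3 := (A.chg y x h).Φ_injective z hz
  refine ⟨h3, (LinearMap.injective_iff_surjective_of_finrank_eq_finrank ?_).1 h3⟩
  rw [h1, h2]
  exact le_antisymm ((A.chg y x h).rank_le hz) ((A.chg x y h').rank_le (mem_dom_φ h h' hz))

theorem exists_φ_eq {y x : A.S} (h : A.I y x) (h' : A.I x y) {w : (A.chart x).Base}
    (hw : w ∈ (A.chg x y h').dom) : ∃ z ∈ (A.chg y x h).dom, (A.chg y x h).φ z = w := by
  have h1 : A.Ident A.full ⟨x, w⟩ ⟨y, (A.chg x y h').φ w⟩ :=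
    (ident_full_iff h').2 ⟨hw, 1, (one_smul _ _).symm⟩
  obtain ⟨hd, g, hg⟩ := (ident_full_iff h).1 (Relation.EqvGen.symm _ _ h1)
  obtain ⟨m, rfl⟩ := (ρ_bijective h h').2 g
  exact ⟨_, (A.chg y x h).dom_invariant m _ hd, ((A.chg y x h).φ_equivariant m _ hd).trans hg.symm⟩

theorem exists_hat_eq {y x : A.S} (h : A.I y x) (h' : A.I x y) {v : (A.chart x).Tot}
    (hv : v.proj ∈ (A.chg x y h').dom) :
    ∃ u : (A.chart y).Tot, u.proj ∈ (A.chg y x h).dom ∧ (A.chg y x h).hat u = v := by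
  obtain ⟨w, e⟩ := v
  obtain ⟨z, hz, rfl⟩ := exists_φ_eq h h' hv
  obtain ⟨f, rfl⟩ := (Φ_bijective h h' hz).2 e
  exact ⟨⟨z, f⟩, hz, rfl⟩

theorem mem_dom_self {x : A.S} (h : A.I x x) (z : (A.chart x).Base) : z ∈ (A.chg x x h).dom :=
  ((ident_full_iff h).1 (Relation.EqvGen.refl _)).1

/-- The coordinate change from a chart to itself is the action of a group element. -/
theorem exists_hat_self {x : A.S} (h : A.I x x) : ∃ k : (A.chart x).Grp,
    ∀ v : (A.chart x).Tot, (A.chg x x h).hat v = k • v := by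
  obtain ⟨k, hk⟩ := A.compatible x x x h h h
  refine ⟨k, fun v => ?_⟩
  obtain ⟨u, -, rfl⟩ := exists_hat_eq h h (mem_dom_self h v.proj)
  exact hk u (mem_dom_self h _) (mem_dom_self h _) (mem_dom_self h _)

/-- Coordinate changes in opposite directions are inverse to each other up to a group element. -/
theorem exists_hat_hat {y x : A.S} (h : A.I y x) (h' : A.I x y) : ∃ k : (A.chart y).Grp,
    ∀ v : (A.chart y).Tot, v.proj ∈ (A.chg y x h).dom →
      (A.chg x y h').hat ((A.chg y x h).hat v) = k • v := by
  obtain ⟨k, hk⟩ := exists_hat_self (A.I_refl y)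
  obtain ⟨m, hm⟩ := A.compatible y x y h h' (A.I_refl y)
  refine ⟨m * k, fun v hv => ?_⟩
  rw [hm v (mem_dom_self _ _) hv (mem_dom_φ h h' hv), hk, mul_smul]

theorem exists_φ_φ {y x : A.S} (h : A.I y x) (h' : A.I x y) : ∃ k : (A.chart y).Grp,
    ∀ z ∈ (A.chg y x h).dom, (A.chg x y h').φ ((A.chg y x h).φ z) = k • z := by
  obtain ⟨k, hk⟩ := exists_hat_hat h h'
  refine ⟨k, fun z hz => ?_⟩
  have h1 := congrArg TotalSpace.proj (hk ⟨z, 0⟩ hz)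
  rw [(A.chart y).proj_smul] at h1
  exact h1

/-- Coherence along a coordinate change passes to the coordinate change in the other direction. -/
theorem coherent_symm {V : A.Fam} (hV : ∀ x, (A.chart x).Invariant (V x)) {Λ : WeightFamily A}
    {y x : A.S} (h : A.I y x) (h' : A.I x y)
    (hinv : ∀ (g : (A.chart x).Grp) (v : (A.chart x).Tot), v.proj ∈ V x → Λ x (g • v) = Λ x v)
    (hcoh : ∀ v : (A.chart y).Tot, v.proj ∈ A.domIn V y x h → Λ x ((A.chg y x h).hat v) = Λ y v)
    (v : (A.chart x).Tot) (hv : v.proj ∈ A.domIn V x y h') :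
    Λ y ((A.chg x y h').hat v) = Λ x v := by
  obtain ⟨k, hk⟩ := exists_hat_hat h' h
  have h1 := hk v hv.2.1
  have h2 : (A.chg y x h).φ ((A.chg x y h').φ v.proj) = k • v.proj := by
    have h3 := congrArg TotalSpace.proj h1
    rwa [(A.chart x).proj_smul] at h3
  rw [← hinv k v hv.1, ← h1]
  refine (hcoh _ ⟨hv.2.2, mem_dom_φ h' h hv.2.1, ?_⟩).symm
  change (A.chg y x h).φ ((A.chg x y h').φ v.proj) ∈ V x
  rw [h2]
  exact hV x k _ hv.1

theorem coherent_self {V : A.Fam} {Λ : WeightFamily A} {x : A.S} (h : A.I x x)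
    (hinv : ∀ (g : (A.chart x).Grp) (v : (A.chart x).Tot), v.proj ∈ V x → Λ x (g • v) = Λ x v)
    (v : (A.chart x).Tot) (hv : v.proj ∈ A.domIn V x x h) :
    Λ x ((A.chg x x h).hat v) = Λ x v := by
  obtain ⟨k, hk⟩ := exists_hat_self h
  rw [hk, hinv k v hv.1]

end GoodCoordinateSystem

namespace IsLevelOneSystem

open GoodCoordinateSystem

variable {A : GoodCoordinateSystem X} {U U' : A.Fam}
  {L : ∀ (y x : A.S) (h : A.I y x), LevelOneData (A.chg y x h)} (hL : IsLevelOneSystem A U U' L)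

include hL

/-- For the coordinate change from a chart to itself the neighbourhood is the whole chart, and the
projection is the action of a group element. -/
theorem p_self {x : A.S} (h : A.I x x) : ∃ k : (A.chart x).Grp, ∀ w ∈ U' x,
    w ∈ (L x x h).W ∧ (L x x h).p w = k • w := by
  obtain ⟨k, hk⟩ := exists_hat_self h
  refine ⟨k⁻¹, fun w hw => ?_⟩
  have h1 : (A.chg x x h).φ (k⁻¹ • w) = w := by
    have h2 := congrArg TotalSpace.proj (hk ⟨k⁻¹ • w, 0⟩)
    rw [(A.chart x).proj_smul, smul_inv_smul] at h2
    exact h2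
  have h3 := (hL.change x x h).image_mem (k⁻¹ • w)
    ⟨hL.shrinking.invariant x _ _ hw, mem_dom_self h _, h1.symm ▸ hw⟩
  rwa [h1] at h3

/-- If there are coordinate changes in both directions, then the neighbourhood of the image of the
coordinate change is the image itself. -/
theorem W_subset_image {y x : A.S} (h : A.I y x) (h' : A.I x y) {w : (A.chart x).Base}
    (hw : w ∈ (L y x h).W) : ∃ z ∈ A.domIn U' y x h, (A.chg y x h).φ z = w := by
  have hinv := hL.shrinking.invariant
  have hz := (hL.change y x h).p_mem w hw
  obtain ⟨k, hk⟩ := exists_φ_φ h h'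
  obtain ⟨k', hk'⟩ := exists_φ_φ h' h
  obtain ⟨l, hl⟩ := hL.p_self (A.I_refl x)
  obtain ⟨m, -, hm, -⟩ := hL.compatible x y x h' h (A.I_refl x)
  have hwx := (hL.change y x h).W_subset hw
  -- the point `p w` lies in the image of the opposite coordinate change
  obtain ⟨u, hu, hpu⟩ : ∃ u ∈ A.domIn U' x y h', (A.chg x y h').φ u = (L y x h).p w := by
    obtain ⟨g, hg⟩ := (ρ_bijective h' h).2 k⁻¹
    refine ⟨g • (A.chg y x h).φ ((L y x h).p w), ⟨hinv x _ _ hz.2.2,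
      (A.chg x y h').dom_invariant _ _ (mem_dom_φ h h' hz.2.1), ?_⟩, ?_⟩ <;>
    rw [(A.chg x y h').φ_equivariant _ _ (mem_dom_φ h h' hz.2.1), hk _ hz.2.1, hg, inv_smul_smul]
    exact hz.1
  have h1 := (hL.change x y h').image_mem u hu
  rw [hpu] at h1
  have h2 := hm w hw (hl _ (hinv x _ _ hwx)).1 h1.1
  rw [h1.2, (hl _ (hinv x _ _ hwx)).2] at h2
  obtain ⟨g, hg⟩ := (ρ_bijective h h').2 (m * l⁻¹ * k'⁻¹)
  refine ⟨g • (L y x h).p w, ⟨hinv y _ _ hz.1, (A.chg y x h).dom_invariant _ _ hz.2.1, ?_⟩, ?_⟩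
  · rw [(A.chg y x h).φ_equivariant _ _ hz.2.1]
    exact hinv x _ _ hz.2.2
  · rw [(A.chg y x h).φ_equivariant _ _ hz.2.1, ← hpu, hk' _ hu.2.1, hg, h2, ← mul_smul,
      ← mul_smul, ← mul_smul]
    simp

/-- Coherence implies that the perturbation is lifted along a coordinate change which has an
opposite coordinate change. -/
theorem lift_eq_of_mutual {V : A.Fam} {Λ : WeightFamily A} {y x : A.S} (h : A.I y x)
    (h' : A.I x y)
    (hcoh : ∀ v : (A.chart y).Tot, v.proj ∈ A.domIn V y x h → Λ x ((A.chg y x h).hat v) = Λ y v)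
    {v : (A.chart x).Tot} (hv : v.proj ∈ (L y x h).W)
    (hpv : (L y x h).p v.proj ∈ A.domIn V y x h) :
    Λ x v = (L y x h).lift (Λ y) v := by
  obtain ⟨w, e⟩ := v
  obtain ⟨z, hz, rfl⟩ := hL.W_subset_image h h' hv
  obtain ⟨f, rfl⟩ := (Φ_bijective h h' hz.2.1).2 e
  have hin : (L y x h).InSub ⟨(A.chg y x h).φ z, (A.chg y x h).Φ z f⟩ := by
    refine ⟨hv, ?_⟩
    change _ ∈ (L y x h).sub ((A.chg y x h).φ z)
    rw [(hL.change y x h).sub_image z hz]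
    exact ⟨f, rfl⟩
  rw [LevelOneData.lift, if_pos hin]
  have h1 := (hL.change y x h).T_image ⟨z, f⟩ hz
  change _ = Λ y ((L y x h).hatT ((A.chg y x h).hat ⟨z, f⟩))
  rw [h1]
  refine hcoh ⟨z, f⟩ ?_
  rwa [show (L y x h).p _ = z from ((hL.change y x h).image_mem z hz).2] at hpv

end IsLevelOneSystem

end Groupoid

/-! ### Compactness and shrinkings -/

section PointSet

/-- Compact sets in a Hausdorff space have neighbourhoods whose pairwise intersections are as close
to those of the compact sets as desired. -/
theorem exists_isOpen_inter_subset {M ι : Type*} [TopologicalSpace M] [T2Space M] [Finite ι]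
    {K : ι → Set M} (hK : ∀ i, IsCompact (K i)) {Q : ι → ι → Set M} (hQ : ∀ i j, IsOpen (Q i j))
    (h : ∀ i j, K i ∩ K j ⊆ Q i j) :
    ∃ N : ι → Set M, (∀ i, IsOpen (N i)) ∧ (∀ i, K i ⊆ N i) ∧ ∀ i j, N i ∩ N j ⊆ Q i j := by
  have hsep : ∀ i j, ∃ a b : Set M, IsOpen a ∧ IsOpen b ∧ K i \ Q i j ⊆ a ∧ K j ⊆ b ∧
      Disjoint a b := fun i j =>
    SeparatedNhds.of_isCompact_isCompact ((hK i).diff (hQ i j)) (hK j)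
      (disjoint_left.2 fun z hz hz' => hz.2 (h i j ⟨hz.1, hz'⟩))
  choose a b ha hb hKa hKb hab using hsep
  refine ⟨fun i => (⋂ j, (Q i j ∪ a i j)) ∩ ⋂ j, b j i, fun i => ?_, fun i => ?_, fun i j => ?_⟩
  · exact (isOpen_iInter_of_finite fun j => (hQ i j).union (ha i j)).inter
      (isOpen_iInter_of_finite fun j => hb j i)
  · refine subset_inter (subset_iInter fun j z hz => ?_) (subset_iInter fun j => hKb j i)
    by_cases hq : z ∈ Q i j
    · exact Or.inl hq
    · exact Or.inr (hKa i j ⟨hz, hq⟩)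
  · rintro z ⟨hi, hj⟩
    rcases mem_iInter.1 hi.1 j with h' | h'
    · exact h'
    · exact absurd (mem_iInter.1 hj.2 i) (disjoint_left.1 (hab i j) h')

variable {X : Type u} [TopologicalSpace X]

namespace KuranishiChart

variable (C : KuranishiChart X)

theorem continuous_smul (g : C.Grp) : Continuous fun z : C.Base => g • z :=
  (C.smul_smooth g).continuous

theorem locallyCompactSpace : LocallyCompactSpace C.Base :=
  locallyCompactSpace_of_corners C.dim C.Base

variable {C}

theorem Invariant.smul_mem_iff {V : Set C.Base} (hV : C.Invariant V) (g : C.Grp) {z : C.Base} :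
    g • z ∈ V ↔ z ∈ V := by
  refine ⟨fun h => ?_, hV g z⟩
  have := hV g⁻¹ _ h
  rwa [inv_smul_smul] at this

theorem Invariant.closure {V : Set C.Base} (hV : C.Invariant V) : C.Invariant (_root_.closure V) :=
  fun g _ hz => map_mem_closure (C.continuous_smul g) hz (hV g)

theorem Invariant.interior {V : Set C.Base} (hV : C.Invariant V) :
    C.Invariant (_root_.interior V) := by
  intro g z hz
  refine mem_interior.2 ⟨(fun w => g⁻¹ • w) ⁻¹' _root_.interior V, fun w hw => ?_,
    isOpen_interior.preimage (C.continuous_smul g⁻¹), ?_⟩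
  · exact (hV.smul_mem_iff g⁻¹).1 (interior_subset hw)
  · change g⁻¹ • g • z ∈ _root_.interior V
    rwa [inv_smul_smul]

/-- The union of the translates of a set. -/
def saturation (C : KuranishiChart X) (B : Set C.Base) : Set C.Base :=
  ⋃ g : C.Grp, (fun z => g • z) ⁻¹' B

theorem invariant_saturation (B : Set C.Base) : C.Invariant (C.saturation B) := by
  intro g z hz
  obtain ⟨k, hk⟩ := mem_iUnion.1 hz
  refine mem_iUnion.2 ⟨k * g⁻¹, ?_⟩
  change (k * g⁻¹) • g • z ∈ B
  rwa [mul_smul, inv_smul_smul]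

theorem subset_saturation (B : Set C.Base) : B ⊆ C.saturation B := fun z hz =>
  mem_iUnion.2 ⟨1, by simpa using hz⟩

theorem saturation_subset {B V : Set C.Base} (hV : C.Invariant V) (h : B ⊆ V) :
    C.saturation B ⊆ V := by
  intro z hz
  obtain ⟨k, hk⟩ := mem_iUnion.1 hz
  exact (hV.smul_mem_iff k).1 (h hk)

theorem isOpen_saturation {B : Set C.Base} (hB : IsOpen B) : IsOpen (C.saturation B) :=
  isOpen_iUnion fun g => hB.preimage (C.continuous_smul g)

theorem isCompact_saturation {B : Set C.Base} (hB : IsCompact B) : IsCompact (C.saturation B) := by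
  refine isCompact_iUnion fun g => ?_
  have h : (fun z : C.Base => g • z) ⁻¹' B = (fun z => g⁻¹ • z) '' B := by
    ext z
    constructor
    · exact fun hz => ⟨g • z, hz, inv_smul_smul g z⟩
    · rintro ⟨w, hw, rfl⟩
      change g • g⁻¹ • w ∈ B
      rwa [smul_inv_smul]
  rw [h]
  exact hB.image (C.continuous_smul g⁻¹)

theorem isOpen_footprint {V : Set C.Base} (hV : IsOpen V) : IsOpen (C.footprint V) :=
  C.ψ_open _ (hV.preimage continuous_subtype_val)

theorem footprint_mono {V W : Set C.Base} (h : V ⊆ W) : C.footprint V ⊆ C.footprint W :=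
  image_mono fun _ hz => h hz

end KuranishiChart

namespace GoodCoordinateSystem

variable {A : GoodCoordinateSystem X}

open KuranishiChart

/-- A shrinking of a good coordinate system of a compact space can be shrunk further to a precompact
one: finitely many relatively compact open sets around zeros cover everything that is needed. -/
theorem exists_isPrecompactShrinking [CompactSpace X] {U' W : A.Fam} (hU' : A.IsShrinking U' W) :
    ∃ V : A.Fam, A.IsPrecompactShrinking V U' := by
  have hfin : Finite A.S := A.S_finite
  have hex : ∀ (x : A.S) (q : X), ∃ B : Set (A.chart x).Base, IsOpen B ∧ IsCompact (closure B) ∧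
      closure B ⊆ U' x ∧
        (q ∈ (A.chart x).footprint (U' x) → q ∈ (A.chart x).footprint B) := by
    intro x q
    by_cases hq : q ∈ (A.chart x).footprint (U' x)
    · obtain ⟨z, hz, rfl⟩ := hq
      have := (A.chart x).locallyCompactSpace
      obtain ⟨B, hB, hzB, hBU, hc⟩ := exists_open_between_and_isCompact_closure
        (isCompact_singleton (x := z.1)) (hU'.isOpen x) (singleton_subset_iff.2 hz)
      exact ⟨B, hB, hc, hBU, fun _ => ⟨z, hzB (mem_singleton _), rfl⟩⟩
    · exact ⟨∅, isOpen_empty, by simp, by simp, fun h => absurd h hq⟩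
  choose B hBo hBc hBU hBq using hex
  have hcov : ∃ T : Finset X, ∀ p : X, ∃ q ∈ T, ∃ x, p ∈ (A.chart x).footprint (B x q) := by
    obtain ⟨T, hT⟩ := isCompact_univ.elim_finite_subcover
      (fun q : X => ⋃ x, (A.chart x).footprint (B x q))
      (fun q => isOpen_iUnion fun x => isOpen_footprint (hBo x q)) (fun q _ => by
        obtain ⟨x, hx⟩ := hU'.cover q
        exact mem_iUnion.2 ⟨q, mem_iUnion.2 ⟨x, hBq x q hx⟩⟩)
    refine ⟨T, fun p => ?_⟩
    obtain ⟨q, hq, hp⟩ := mem_iUnion₂.1 (hT (mem_univ p))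
    exact ⟨q, hq, mem_iUnion.1 hp⟩
  obtain ⟨T, hT⟩ := hcov
  -- one point in each nonempty overlap
  have hov : ∀ y x : A.S, ∃ q : X,
      ((A.chart y).footprint (U' y) ∩ (A.chart x).footprint (U' x)).Nonempty →
        q ∈ (A.chart y).footprint (U' y) ∩ (A.chart x).footprint (U' x) := by
    intro y x
    by_cases h : ((A.chart y).footprint (U' y) ∩ (A.chart x).footprint (U' x)).Nonempty
    · exact ⟨h.some, fun _ => h.some_mem⟩
    · exact ⟨y, fun h' => absurd h' h⟩
  choose c hc using hov
  let F : Set X := ↑T ∪ A.S ∪ range fun p : A.S × A.S => c p.1 p.2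
  have hF : F.Finite := (T.finite_toSet.union A.S_finite).union (finite_range _)
  let V₀ : A.Fam := fun x => (A.chart x).saturation (⋃ q ∈ F, B x q)
  let Kc : A.Fam := fun x => (A.chart x).saturation (⋃ q ∈ F, closure (B x q))
  have hKc : ∀ x, IsCompact (Kc x) := fun x =>
    isCompact_saturation (hF.isCompact_biUnion fun q _ => hBc x q)
  have hcl : ∀ x, closure (V₀ x) ⊆ Kc x := fun x => by
    refine closure_minimal ?_ (hKc x).isClosed
    exact iUnion_mono fun g => preimage_mono (iUnion₂_mono fun q _ => subset_closure)
  have hKU : ∀ x, Kc x ⊆ U' x := fun x =>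
    saturation_subset (hU'.invariant x) (iUnion₂_subset fun q _ => hBU x q)
  have hV₀o : ∀ x, IsOpen (V₀ x) := fun x =>
    isOpen_saturation (isOpen_biUnion fun q _ => hBo x q)
  have hsub : ∀ x, V₀ x ⊆ interior (closure (V₀ x)) := fun x =>
    (hV₀o x).subset_interior_iff.2 subset_closure
  have hcl' : ∀ x, closure (interior (closure (V₀ x))) ⊆ Kc x := fun x =>
    (closure_minimal interior_subset isClosed_closure).trans (hcl x)
  have hq : ∀ x, ∀ q ∈ F, (A.chart x).footprint (B x q) ⊆
      (A.chart x).footprint (interior (closure (V₀ x))) := fun x q hq =>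
    footprint_mono (((subset_biUnion_of_mem (u := fun q => B x q) hq).trans
      (subset_saturation _)).trans (hsub x))
  refine ⟨fun x => interior (closure (V₀ x)),
    { subset := fun x => subset_closure.trans ((hcl' x).trans (hKU x))
      isOpen := fun x => isOpen_interior
      invariant := fun x => (invariant_saturation _).closure.interior
      base_point := fun x => hq x x (Or.inl (Or.inr x.2)) (hBq x x (hU'.base_point x))
      cover := fun p => ?_
      overlap := fun y x hyx => ?_
      compact := fun x => (hKc x).of_isClosed_subset isClosed_closure (hcl' x)
      closure_subset := fun x => (hcl' x).trans (hKU x)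
      regular := fun x => interior_closure_idem }⟩
  · obtain ⟨q, hqT, x, hp⟩ := hT p
    exact ⟨x, hq x q (Or.inl (Or.inl hqT)) hp⟩
  · have hm : c y x ∈ F := Or.inr ⟨(y, x), rfl⟩
    exact ⟨c y x, hq y _ hm (hBq y _ (hc y x hyx).1), hq x _ hm (hBq x _ (hc y x hyx).2)⟩

/-- In a Hausdorff family of charts the identification is a closed relation. -/
theorem IsHausdorff.isClosed_ident {U : A.Fam} (hU : A.IsHausdorff U) (y x : A.S) :
    IsClosed {p : U y × U x | A.Ident A.full ⟨y, p.1⟩ ⟨x, p.2⟩} := by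
  let _ : TopologicalSpace (A.IdSpace U) :=
    A.relTop (V := U) (W := A.full) (fun _ => subset_univ _)
  let _ : TopologicalSpace (A.IdSpace A.full) := A.quotTop A.full
  have hT2 : T2Space (A.IdSpace U) := hU
  let nat : A.IdSpace U → A.IdSpace A.full := A.natMap fun _ => subset_univ _
  have hind : IsInducing nat := ⟨rfl⟩
  have hto : ∀ x, Continuous fun z : U x => A.toId U ⟨⟨x, z⟩, z.2⟩ := by
    intro x
    rw [hind.continuous_iff]
    have h0 : Continuous fun z : U x => (⟨x, z.1⟩ : A.Pt) :=
      (continuous_sigmaMk (σ := fun x : A.S => (A.chart x).Base)).comp continuous_subtype_val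
    have h1 : Continuous fun z : U x => (⟨⟨x, z⟩, trivial⟩ : A.PtIn A.full) :=
      h0.subtype_mk _
    exact continuous_coinduced_rng.comp h1
  have hset : {p : U y × U x | A.Ident A.full ⟨y, p.1⟩ ⟨x, p.2⟩} =
      {p | A.toId U ⟨⟨y, p.1⟩, p.1.2⟩ = A.toId U ⟨⟨x, p.2⟩, p.2.2⟩} := by
    ext p
    constructor
    · intro h
      apply hind.injective
      exact Quotient.sound (s := A.identSetoid A.full) h
    · intro h
      exact Ident_mono A (fun _ => subset_univ _) (Quotient.exact h)
  rw [hset]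
  exact isClosed_eq ((hto y).comp continuous_fst) ((hto x).comp continuous_snd)

/-- The domain of a coordinate change between compact sets is compact. -/
theorem IsHausdorff.isCompact_domIn {U K : A.Fam} (hU : A.IsHausdorff U)
    (hK : ∀ x, IsCompact (K x)) (hKU : ∀ x, K x ⊆ U x) (hKi : ∀ x, (A.chart x).Invariant (K x))
    (y x : A.S) (h : A.I y x) : IsCompact (A.domIn K y x h) := by
  have hind : IsInducing fun p : U y × U x =>
      ((p.1 : (A.chart y).Base), (p.2 : (A.chart x).Base)) :=
    IsInducing.subtypeVal.prodMap IsInducing.subtypeVal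
  obtain ⟨Z, hZ, hZe⟩ := hind.isClosed_iff.1 (hU.isClosed_ident y x)
  have hZ' : ∀ a ∈ U y, ∀ b ∈ U x, (a, b) ∈ Z ↔ A.Ident A.full ⟨y, a⟩ ⟨x, b⟩ := fun a ha b hb =>
    Set.ext_iff.1 hZe (⟨a, ha⟩, ⟨b, hb⟩)
  have himg : A.domIn K y x h = Prod.fst '' ((K y ×ˢ K x) ∩ Z) := by
    ext z
    constructor
    · rintro ⟨hz, hd, hφ⟩
      refine ⟨(z, (A.chg y x h).φ z), ⟨⟨hz, hφ⟩, ?_⟩, rfl⟩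
      exact (hZ' _ (hKU y hz) _ (hKU x hφ)).2
        ((ident_full_iff h).2 ⟨hd, 1, (one_smul _ _).symm⟩)
    · rintro ⟨⟨z, w⟩, ⟨⟨hz, hw⟩, hzw⟩, rfl⟩
      obtain ⟨hd, g, hg⟩ := (ident_full_iff h).1 ((hZ' _ (hKU y hz) _ (hKU x hw)).1 hzw)
      rw [hg] at hw
      exact ⟨hz, hd, ((hKi x).smul_mem_iff g).1 hw⟩
  rw [himg]
  exact (((hK y).prod (hK x)).inter_right hZ).image continuous_fst

theorem IsHausdorff.isCompact_image {U K : A.Fam} (hU : A.IsHausdorff U)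
    (hK : ∀ x, IsCompact (K x)) (hKU : ∀ x, K x ⊆ U x) (hKi : ∀ x, (A.chart x).Invariant (K x))
    (y x : A.S) (h : A.I y x) : IsCompact ((A.chg y x h).φ '' A.domIn K y x h) :=
  (hU.isCompact_domIn hK hKU hKi y x h).image_of_continuousOn
    ((A.chg y x h).φ_smooth.continuousOn.mono fun _ hz => hz.2.1)

/-- The indices can be enumerated compatibly with the relation `≤`. -/
theorem exists_rank (A : GoodCoordinateSystem X) : ∃ r : A.S → ℕ, Function.Injective r ∧
    ∀ y x, r y < r x → A.le y x := by
  have hfin : Finite A.S := A.S_finite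
  obtain ⟨N, ⟨f⟩⟩ := Finite.exists_equiv_fin A.S
  let c : A.S → ℕ := fun x => {z | A.le z x}.ncard
  have hc : ∀ y x, A.le y x → c y ≤ c x := fun y x h =>
    ncard_le_ncard (fun z hz => A.le_trans z y x hz h) (toFinite _)
  have hc' : ∀ y x, ¬ A.le y x → c x < c y := fun y x h =>
    ncard_lt_ncard ⟨fun z hz => A.le_trans z x y hz ((A.le_total y x).resolve_left h),
      fun h' => h (h' (A.le_refl y))⟩ (toFinite _)
  refine ⟨fun x => c x * (N + 1) + f x, fun y x hyx => ?_, fun y x hyx => ?_⟩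
  · have h1 := (f y).2
    have h2 := (f x).2
    have h3 : c y = c x := by
      rcases lt_trichotomy (c y) (c x) with h | h | h
      · nlinarith
      · exact h
      · nlinarith
    simp only [h3] at hyx
    exact f.injective (Fin.ext (by omega))
  · by_contra h
    have h1 := hc' y x h
    have h2 := (f x).2
    simp only at hyx
    nlinarith

end GoodCoordinateSystem

end PointSet

/-! ### Group actions and linear families of multisections -/

section GroupAction

variable {X : Type u} [TopologicalSpace X]

namespace KuranishiChart

variable (C : KuranishiChart X)

/-- The action of a group element on a fibre. -/
def smulFib (g : C.Grp) (z : C.Base) : C.Fib z →ₗ[ℝ] C.Fib (g • z) :=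
  (C.smul_linear g z).choose

theorem smul_mk (g : C.Grp) (z : C.Base) (e : C.Fib z) :
    g • (⟨z, e⟩ : C.Tot) = ⟨g • z, C.smulFib g z e⟩ :=
  (C.smul_linear g z).choose_spec e

theorem smulFib_bijective (g : C.Grp) (z : C.Base) : Function.Bijective (C.smulFib g z) := by
  constructor
  · intro e e' h
    have h1 : g • (⟨z, e⟩ : C.Tot) = g • ⟨z, e'⟩ := by rw [smul_mk, smul_mk, h]
    exact eq_of_heq (TotalSpace.mk.inj (MulAction.injective g h1)).2
  · intro f
    have h1 : (g⁻¹ • (⟨g • z, f⟩ : C.Tot)).proj = z := by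
      rw [C.proj_smul, inv_smul_smul]
    obtain ⟨z', e, he⟩ : ∃ z' e, g⁻¹ • (⟨g • z, f⟩ : C.Tot) = ⟨z', e⟩ := ⟨_, _, rfl⟩
    obtain rfl : z' = z := by rwa [he] at h1
    refine ⟨e, ?_⟩
    have h2 : g • (⟨z', e⟩ : C.Tot) = ⟨g • z', f⟩ := by rw [← he, smul_inv_smul]
    rw [smul_mk] at h2
    exact eq_of_heq (TotalSpace.mk.inj h2).2

theorem isBundleMapOn_smul (g : C.Grp) :
    IsBundleMapOn C.bundle C.bundle (f := fun z => g • z) (C.smulFib g) univ := by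
  refine ContMDiffOn.congr (C.smul_smooth_tot g).contMDiffOn fun v _ => ?_
  exact (C.smul_mk g v.proj v.2).symm

theorem exists_translateFib (g : C.Grp) (w : C.Base) :
    ∃ T : C.Fib (g⁻¹ • w) →ₗ[ℝ] C.Fib w, ∀ e, g • (⟨g⁻¹ • w, e⟩ : C.Tot) = ⟨w, T e⟩ := by
  have h := C.smul_linear g (g⁻¹ • w)
  rwa [smul_inv_smul] at h

/-- The action of a group element on fibres, as a map into the fibre over `w`. -/
def translateFib (g : C.Grp) (w : C.Base) : C.Fib (g⁻¹ • w) →ₗ[ℝ] C.Fib w :=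
  (C.exists_translateFib g w).choose

/-- The translate of a section by a group element. -/
def translate (g : C.Grp) (t : ∀ z, C.Fib z) (w : C.Base) : C.Fib w :=
  C.translateFib g w (t (g⁻¹ • w))

theorem smul_mk_inv (g : C.Grp) (w : C.Base) (e : C.Fib (g⁻¹ • w)) :
    g • (⟨g⁻¹ • w, e⟩ : C.Tot) = ⟨w, C.translateFib g w e⟩ :=
  (C.exists_translateFib g w).choose_spec e

variable {C}

theorem mk_inj {z : C.Base} {e e' : C.Fib z} : (⟨z, e⟩ : C.Tot) = ⟨z, e'⟩ ↔ e = e' :=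
  ⟨fun h => eq_of_heq (TotalSpace.mk.inj h).2, fun h => h ▸ rfl⟩

theorem toTot_translate (g : C.Grp) (t : ∀ z, C.Fib z) (w : C.Base) :
    C.bundle.toTot (C.translate g t) w = g • C.bundle.toTot t (g⁻¹ • w) :=
  (C.smul_mk_inv g w _).symm

theorem smulFib_apply (g : C.Grp) (t : ∀ z, C.Fib z) (z : C.Base) :
    C.smulFib g z (t z) = C.translate g t (g • z) := by
  rw [← mk_inj]
  refine (C.smul_mk g z (t z)).symm.trans ((toTot_translate g t (g • z)).trans ?_).symm
  rw [inv_smul_smul]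
  rfl

theorem translate_s (g : C.Grp) (w : C.Base) : C.translate g C.s w = C.s w := by
  rw [← mk_inj]
  refine (toTot_translate g C.s w).trans ?_
  rw [C.s_equivariant, smul_inv_smul]
  rfl

theorem translate_one (t : ∀ z, C.Fib z) (w : C.Base) : C.translate 1 t w = t w := by
  rw [← mk_inj]
  refine (toTot_translate 1 t w).trans ?_
  rw [inv_one, one_smul, one_smul]
  rfl

theorem translate_mul (g h : C.Grp) (t : ∀ z, C.Fib z) (w : C.Base) :
    C.translate (g * h) t w = C.translate g (C.translate h t) w := by
  rw [← mk_inj]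
  refine (toTot_translate (g * h) t w).trans ((toTot_translate g _ w).trans ?_).symm
  rw [toTot_translate, mul_inv_rev, mul_smul, mul_smul]

theorem smoothAt_translate (g : C.Grp) {t : ∀ z, C.Fib z} {w : C.Base}
    (ht : C.bundle.SmoothAt t (g⁻¹ • w)) : C.bundle.SmoothAt (C.translate g t) w := by
  have h : C.bundle.toTot (C.translate g t) = fun w => g • C.bundle.toTot t (g⁻¹ • w) :=
    funext fun w => toTot_translate g t w
  rw [SmoothVectorBundle.SmoothAt, h]
  exact ((C.smul_smooth_tot g).contMDiffAt).comp w
    (ContMDiffAt.comp w ht (C.smul_smooth g⁻¹).contMDiffAt)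

/-- Transversality at a zero is preserved by the group action. -/
theorem linearization_translate_surjective (g : C.Grp) {t : ∀ z, C.Fib z} {w : C.Base}
    (ht : C.bundle.SmoothAt t (g⁻¹ • w)) (h0 : t (g⁻¹ • w) = 0)
    (hs : Function.Surjective (C.bundle.linearization t (g⁻¹ • w))) :
    Function.Surjective (C.bundle.linearization (C.translate g t) w) := by
  have ht' := smoothAt_translate g ht
  obtain ⟨z, rfl⟩ : ∃ z, w = g • z := ⟨g⁻¹ • w, (smul_inv_smul g w).symm⟩
  rw [inv_smul_smul] at ht h0 hs
  intro e
  obtain ⟨f, rfl⟩ := (C.smulFib_bijective g z).2 e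
  obtain ⟨v, rfl⟩ := hs f
  exact ⟨_, (C.isBundleMapOn_smul g).linearization_apply isOpen_univ (mem_univ z) ht ht' h0
    (Eventually.of_forall fun z' => (smulFib_apply g t z').symm) v⟩

end KuranishiChart

end GroupAction

section Families

open MeasureTheory

variable {n : ℕ} {M : Type u} [TopologicalSpace M] [ChartedSpace (EuclideanQuadrant n) M]
  {ι : Type*} [Fintype ι]

open Classical in
/-- Over `O`, the family `Λ a` of weight functions with parameters `a ∈ ℝ^ι` is given by smooth
branches `t i` which depend linearly on `a` and only on the coordinates `a j` with `j ∈ J`. For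
almost every parameter the branches of `s + Λ a` are transverse. -/
structure IsLinearBranching (B : SmoothVectorBundle n M) (s : ∀ z, B.Fib z) (J : Set ι)
    (Λ : (ι → ℝ) → B.Tot → ℚ) (O : Set M) {κ : Type u} [Fintype κ]
    (t : κ → ∀ z, (ι → ℝ) →ₗ[ℝ] B.Fib z) (q : κ → ℚ) : Prop where
  pos : ∀ i, 0 < q i
  sum_eq_one : ∑ i, q i = 1
  smooth : ∀ i a, ∀ w ∈ O, B.SmoothAt (fun z => t i z a) w
  eq_zero : ∀ i a, (∀ j ∈ J, a j = 0) → ∀ w, t i w a = 0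
  weight : ∀ a, ∀ w ∈ O, ∀ e, Λ a ⟨w, e⟩ = ∑ i, if t i w a = e then q i else 0
  transverse : ∀ i, ∀ᵐ a : ι → ℝ, ∀ w ∈ O, s w + t i w a = 0 →
    Function.Surjective (B.linearization (fun z => s z + t i z a) w)

/-- A family of multisections over `D` that is locally given by branches depending linearly on the
parameter, as in `IsLinearBranching`. -/
def IsLinearFamilyOn (B : SmoothVectorBundle n M) (s : ∀ z, B.Fib z) (J : Set ι)
    (Λ : (ι → ℝ) → B.Tot → ℚ) (D : Set M) : Prop :=
  ∀ z ∈ D, ∃ (O : Set M) (κ : Type u) (_ : Fintype κ) (t : κ → ∀ z, (ι → ℝ) →ₗ[ℝ] B.Fib z)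
    (q : κ → ℚ), IsOpen O ∧ z ∈ O ∧ O ⊆ D ∧ IsLinearBranching B s J Λ O t q

variable {B : SmoothVectorBundle n M} {s : ∀ z, B.Fib z} {J : Set ι}
    {Λ : (ι → ℝ) → B.Tot → ℚ} {D : Set M}

theorem IsLinearBranching.mono {J' : Set ι} {O O' : Set M} {κ : Type u} [Fintype κ]
    {t : κ → ∀ z, (ι → ℝ) →ₗ[ℝ] B.Fib z} {q : κ → ℚ} {Λ' : (ι → ℝ) → B.Tot → ℚ}
    (h : IsLinearBranching B s J Λ O t q) (hJ : J ⊆ J') (hO : O' ⊆ O)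
    (hΛ : ∀ a, ∀ v : B.Tot, v.proj ∈ O' → Λ' a v = Λ a v) :
    IsLinearBranching B s J' Λ' O' t q where
  pos := h.pos
  sum_eq_one := h.sum_eq_one
  smooth i a w hw := h.smooth i a w (hO hw)
  eq_zero i a ha := h.eq_zero i a fun j hj => ha j (hJ hj)
  weight a w hw e := (hΛ a _ hw).trans (h.weight a w (hO hw) e)
  transverse i := (h.transverse i).mono fun _ ha w hw => ha w (hO hw)

theorem IsLinearFamilyOn.mono {J' : Set ι} {D' : Set M} {Λ' : (ι → ℝ) → B.Tot → ℚ}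
    (h : IsLinearFamilyOn B s J Λ D) (hJ : J ⊆ J') (hD' : IsOpen D') (hD : D' ⊆ D)
    (hΛ : ∀ a, ∀ v : B.Tot, v.proj ∈ D' → Λ' a v = Λ a v) : IsLinearFamilyOn B s J' Λ' D' := by
  intro z hz
  obtain ⟨O, κ, hκ, t, q, hO, hzO, -, hb⟩ := h z (hD hz)
  exact ⟨O ∩ D', κ, hκ, t, q, hO.inter hD', ⟨hzO, hz⟩, inter_subset_right,
    hb.mono hJ inter_subset_left fun a v hv => hΛ a v hv.2⟩

/-- Being a linear family is a local property. -/
theorem IsLinearFamilyOn.of_local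
    (h : ∀ z ∈ D, ∃ D', z ∈ D' ∧ D' ⊆ D ∧ IsLinearFamilyOn B s J Λ D') :
    IsLinearFamilyOn B s J Λ D := by
  intro z hz
  obtain ⟨D', hzD, hD, h'⟩ := h z hz
  obtain ⟨O, κ, hκ, t, q, hO, hzO, hOD, hb⟩ := h' z hzD
  exact ⟨O, κ, hκ, t, q, hO, hzO, hOD.trans hD, hb⟩

theorem IsLinearBranching.continuousAt {O : Set M} {κ : Type u} [Fintype κ]
    {t : κ → ∀ z, (ι → ℝ) →ₗ[ℝ] B.Fib z} {q : κ → ℚ} (hb : IsLinearBranching B s J Λ O t q) (i : κ)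
    (a : ι → ℝ) {z : M} (hz : z ∈ O) :
    ContinuousAt (fun p : (ι → ℝ) × M => (⟨p.2, t i p.2 p.1⟩ : B.Tot)) (a, z) := by
  classical
  rw [FiberBundle.continuousAt_totalSpace]
  refine ⟨continuousAt_snd, ?_⟩
  have h1 : ContinuousAt (fun p : (ι → ℝ) × M => ∑ j, p.1 j •
      B.coord (B.triv z) (fun w => t i w (Pi.single j 1)) p.2) (a, z) := by
    refine tendsto_finsetSum _ fun j _ => ?_
    have h2 : ContinuousAt (fun p : (ι → ℝ) × M => p.1 j) (a, z) :=
      ((continuous_apply j).comp continuous_fst).continuousAt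
    have h3 : ContinuousAt (B.coord (B.triv z) (fun w => t i w (Pi.single j 1))) z :=
      ((hb.smooth i _ z hz).coord _ (SmoothVectorBundle.mem_triv z)).continuousAt
    exact h2.smul (ContinuousAt.comp (f := fun p : (ι → ℝ) × M => p.2)
      (x := ((a, z) : (ι → ℝ) × M)) h3 continuousAt_snd)
  refine h1.congr ?_
  have hnear : ∀ᶠ p : (ι → ℝ) × M in 𝓝 (a, z), p.2 ∈ (B.triv z).baseSet :=
    continuousAt_snd.eventually
      ((B.triv z).open_baseSet.mem_nhds (SmoothVectorBundle.mem_triv z))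
  filter_upwards [hnear] with p hp
  have h4 : p.1 = ∑ j, p.1 j • (Pi.single j 1 : ι → ℝ) := by
    ext k
    simp [Finset.sum_apply, Pi.single_apply]
  have h5 : t i p.2 p.1 = ∑ j, p.1 j • t i p.2 (Pi.single j 1) := by
    conv_lhs => rw [h4]
    simp only [map_sum, map_smul]
  have h6 : ∀ (e : B.Fib p.2), ((B.triv z) (⟨p.2, e⟩ : B.Tot)).2 =
      (B.triv z).continuousLinearEquivAt ℝ p.2 hp e := fun e => rfl
  change _ = ((B.triv z) (⟨p.2, t i p.2 p.1⟩ : B.Tot)).2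
  rw [h6, h5, map_sum]
  refine Finset.sum_congr rfl fun j _ => ?_
  rw [map_smul]
  rfl

theorem IsLinearBranching.weight_ne_zero_iff {O : Set M} {κ : Type u} [Fintype κ]
    {t : κ → ∀ z, (ι → ℝ) →ₗ[ℝ] B.Fib z} {q : κ → ℚ} (hb : IsLinearBranching B s J Λ O t q)
    (a : ι → ℝ) {z : M} (hz : z ∈ O) (e : B.Fib z) : Λ a ⟨z, e⟩ ≠ 0 ↔ ∃ i, t i z a = e := by
  classical
  rw [hb.weight a z hz]
  constructor
  · intro he
    obtain ⟨i, -, hi⟩ := Finset.exists_ne_zero_of_sum_ne_zero he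
    refine ⟨i, ?_⟩
    by_contra hne
    exact hi (if_neg hne)
  · rintro ⟨i, hi⟩
    refine (Finset.sum_pos' (fun k _ => ?_) ⟨i, Finset.mem_univ i, ?_⟩).ne'
    · split_ifs
      exacts [(hb.pos k).le, le_rfl]
    · rw [if_pos hi]
      exact hb.pos i

/-- The set of the values of the branches is upper semicontinuous in the parameter and the point. -/
theorem IsLinearFamilyOn.eventually_mem (h : IsLinearFamilyOn B s J Λ D) {a : ι → ℝ} {z : M}
    (hz : z ∈ D) {O : Set B.Tot} (hO : IsOpen O)
    (hzO : ∀ e, Λ a ⟨z, e⟩ ≠ 0 → (⟨z, e⟩ : B.Tot) ∈ O) :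
    ∀ᶠ p : (ι → ℝ) × M in 𝓝 (a, z), ∀ e, Λ p.1 ⟨p.2, e⟩ ≠ 0 → (⟨p.2, e⟩ : B.Tot) ∈ O := by
  obtain ⟨N, κ, hκ, t, q, hN, hzN, -, hb⟩ := h z hz
  have hev : ∀ i, ∀ᶠ p : (ι → ℝ) × M in 𝓝 (a, z), (⟨p.2, t i p.2 p.1⟩ : B.Tot) ∈ O := fun i =>
    (hb.continuousAt i a hzN).eventually
      (hO.mem_nhds (hzO _ ((hb.weight_ne_zero_iff a hzN _).2 ⟨i, rfl⟩)))
  have hN' : ∀ᶠ p : (ι → ℝ) × M in 𝓝 (a, z), p.2 ∈ N :=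
    continuousAt_snd.eventually (hN.mem_nhds hzN)
  filter_upwards [eventually_all.2 hev, hN'] with p hp hpN e he
  obtain ⟨i, rfl⟩ := (hb.weight_ne_zero_iff p.1 hpN e).1 he
  exact hp i

theorem IsLinearFamilyOn.eq_zero_of_weight_zero_ne_zero (h : IsLinearFamilyOn B s J Λ D) {z : M}
    (hz : z ∈ D) {e : B.Fib z} (he : Λ 0 ⟨z, e⟩ ≠ 0) : e = 0 := by
  obtain ⟨N, κ, hκ, t, q, hN, hzN, -, hb⟩ := h z hz
  obtain ⟨i, rfl⟩ := (hb.weight_ne_zero_iff 0 hzN e).1 he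
  exact map_zero _

/-- The complement of the graph of `-s` is open. -/
theorem SmoothVectorBundle.isOpen_ne_neg (hs : ∀ z, B.SmoothAt s z) :
    IsOpen {v : B.Tot | v.2 ≠ -s v.proj} := by
  refine isOpen_iff_mem_nhds.2 fun v hv => ?_
  have hproj : ContinuousAt (fun v : B.Tot => v.proj) v :=
    (FiberBundle.continuous_proj B.Model B.Fib).continuousAt
  have hc1 : ContinuousAt (fun u : B.Tot => ((B.triv v.proj) u).2) v :=
    ((FiberBundle.continuousAt_totalSpace B.Model (f := fun u : B.Tot => u)).1 continuousAt_id).2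
  have hc2 : ContinuousAt (fun u : B.Tot => B.coord (B.triv v.proj) s u.proj) v :=
    ContinuousAt.comp (f := fun u : B.Tot => u.proj) (x := v)
      ((hs v.proj).coord _ (SmoothVectorBundle.mem_triv v.proj)).continuousAt hproj
  have key : ∀ u : B.Tot, u.proj ∈ (B.triv v.proj).baseSet →
      (u.2 = -s u.proj ↔ ((B.triv v.proj) u).2 + B.coord (B.triv v.proj) s u.proj = 0) := by
    rintro ⟨w, e⟩ hw
    have h1 : ∀ e : B.Fib w, ((B.triv v.proj) (⟨w, e⟩ : B.Tot)).2 =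
      (B.triv v.proj).continuousLinearEquivAt ℝ w hw e := fun e => rfl
    change e = -s w ↔ ((B.triv v.proj) (⟨w, e⟩ : B.Tot)).2 +
      ((B.triv v.proj) (⟨w, s w⟩ : B.Tot)).2 = 0
    rw [h1, h1, ← map_add, map_eq_zero_iff _ (ContinuousLinearEquiv.injective _),
      eq_neg_iff_add_eq_zero]
  have h2 := (hc1.add hc2).eventually_ne
    (fun h => hv ((key v (SmoothVectorBundle.mem_triv v.proj)).2 h))
  filter_upwards [h2, hproj.eventually ((B.triv v.proj).open_baseSet.mem_nhds
    (SmoothVectorBundle.mem_triv v.proj))] with u hu hu' h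
  exact hu ((key u hu').1 h)

/-- A parameter and a point that is not a solution have neighbourhoods without solutions. -/
theorem IsLinearFamilyOn.eventually_weight_eq_zero (h : IsLinearFamilyOn B s J Λ D)
    (hs : ∀ z, B.SmoothAt s z) {a : ι → ℝ} {z : M} (hz : z ∈ D) (h0 : Λ a ⟨z, -s z⟩ = 0) :
    ∀ᶠ p : (ι → ℝ) × M in 𝓝 (a, z), Λ p.1 ⟨p.2, -s p.2⟩ = 0 := by
  refine (h.eventually_mem (a := a) hz (SmoothVectorBundle.isOpen_ne_neg hs) ?_).mono
    fun p hp => ?_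
  · intro e he heq
    have heq' : e = -s z := heq
    rw [heq'] at he
    exact he h0
  · by_contra hne
    exact hp _ hne rfl

theorem IsLinearBranching.isBranching {O : Set M} (hO : IsOpen O) {κ : Type u} [Fintype κ]
    {t : κ → ∀ z, (ι → ℝ) →ₗ[ℝ] B.Fib z} {q : κ → ℚ}
    (h : IsLinearBranching B s J Λ O t q) (a : ι → ℝ) :
    IsBranching B (Λ a) O (fun i w => t ((Fintype.equivFin κ).symm i) w a)
      (fun i => q ((Fintype.equivFin κ).symm i)) := by
  classical
  refine ⟨fun i => h.pos _, ?_, fun i => (B.smoothOn_iff hO).2 (h.smooth _ a), fun z hz e => ?_⟩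
  · rw [← h.sum_eq_one]
    exact (Fintype.equivFin κ).symm.sum_comp q
  · rw [h.weight a z hz]
    refine ((Fintype.equivFin κ).symm.sum_comp
      fun i => if t i z a = e then q i else 0).symm.trans ?_
    exact Finset.sum_congr rfl fun i _ => by congr

theorem IsTransverseOn.isMultisectionOn {Λ : B.Tot → ℚ} (h : IsTransverseOn B s Λ D) :
    IsMultisectionOn B Λ D := fun z hz => by
  obtain ⟨O, k, t, q, h1, h2, h3, h4, -⟩ := h z hz
  exact ⟨O, k, t, q, h1, h2, h3, h4⟩

theorem IsTransverseOn.mono {Λ : B.Tot → ℚ} {D' : Set M} (h : IsTransverseOn B s Λ D)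
    (hD' : IsOpen D') (hD : D' ⊆ D) : IsTransverseOn B s Λ D' := fun z hz => by
  obtain ⟨O, k, t, q, h1, h2, h3, ⟨h4, h5, h6, h7⟩, h8⟩ := h z (hD hz)
  exact ⟨O ∩ D', k, t, q, h1.inter hD', ⟨h2, hz⟩, inter_subset_right,
    ⟨h4, h5, fun i => (h6 i).mono inter_subset_left, fun w hw => h7 w hw.1⟩,
    fun w hw => h8 w hw.1⟩

/-- Almost every member of a linear family is transverse over a compact set. -/
theorem IsLinearFamilyOn.ae_isTransverseOn (h : IsLinearFamilyOn B s J Λ D) {K : Set M}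
    (hK : IsCompact K) (hKD : K ⊆ D) {V : Set M} (hV : IsOpen V) (hVK : V ⊆ K) :
    ∀ᵐ a : ι → ℝ, IsTransverseOn B s (Λ a) V := by
  have hloc : ∀ z ∈ K, ∃ O, IsOpen O ∧ z ∈ O ∧ ∀ᵐ a : ι → ℝ, IsTransverseOn B s (Λ a) O := by
    intro z hz
    obtain ⟨O, κ, hκ, t, q, hO, hzO, -, hb⟩ := h z (hKD hz)
    refine ⟨O, hO, hzO, (ae_all_iff.2 hb.transverse).mono fun a ha w hw => ?_⟩
    exact ⟨O, _, _, _, hO, hw, subset_rfl, hb.isBranching hO a, fun w hw i => ha _ w hw⟩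
  choose! O hO hzO hOa using hloc
  obtain ⟨T, hTK⟩ := hK.elim_nhds_subcover' (fun z hz => O z)
    (fun z hz => (hO z hz).mem_nhds (hzO z hz))
  have hall : ∀ᵐ a : ι → ℝ, ∀ z ∈ T, IsTransverseOn B s (Λ a) (O z) :=
    (Finset.eventually_all T).2 fun z _ => hOa z z.2
  refine hall.mono fun a ha z hz => ?_
  obtain ⟨y, hy, hzy⟩ := mem_iUnion₂.1 (hTK (hVK hz))
  exact (ha y hy).mono ((hO y y.2).inter hV) inter_subset_left z ⟨hzy, hz⟩ |>.imp
    fun O' ⟨k, t, q, h1, h2, h3, h4⟩ => ⟨k, t, q, h1, h2, h3.trans inter_subset_right, h4⟩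

end Families

section FamilyTransport

variable {X : Type u} [TopologicalSpace X] {ι : Type*} [Fintype ι] {J : Set ι}

/-- The translate of a linear family by a group element. -/
theorem IsLinearFamilyOn.translate {C : KuranishiChart X} {Λ : (ι → ℝ) → C.Tot → ℚ}
    {D : Set C.Base} (h : IsLinearFamilyOn C.bundle C.s J Λ D) (g : C.Grp) :
    IsLinearFamilyOn C.bundle C.s J (fun a v => Λ a (g⁻¹ • v)) ((fun z => g⁻¹ • z) ⁻¹' D) := by
  classical
  intro z hz
  obtain ⟨O, κ, hκ, t, q, hO, hzO, hOD, hb⟩ := h _ hz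
  refine ⟨(fun z => g⁻¹ • z) ⁻¹' O, κ, hκ, fun i w => (C.translateFib g w).comp (t i (g⁻¹ • w)), q,
    hO.preimage (C.continuous_smul g⁻¹), hzO, preimage_mono hOD, ?_⟩
  refine ⟨hb.pos, hb.sum_eq_one, fun i a w hw => ?_, fun i a ha w => ?_, fun a w hw e => ?_,
    fun i => (hb.transverse i).mono fun a ha w hw h0 => ?_⟩
  · exact C.smoothAt_translate g (hb.smooth i a _ hw)
  · simp [hb.eq_zero i a ha]
  · have h1 : g⁻¹ • (⟨w, e⟩ : C.Tot) = ⟨g⁻¹ • w, C.smulFib g⁻¹ w e⟩ := C.smul_mk _ _ _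
    rw [h1, hb.weight a _ hw]
    refine Finset.sum_congr rfl fun i _ => if_congr ?_ rfl rfl
    rw [← KuranishiChart.mk_inj, ← h1, eq_inv_smul_iff, C.smul_mk_inv, KuranishiChart.mk_inj]
    rfl
  · have hsm := (C.s_smoothAt (g⁻¹ • w)).add (hb.smooth i a _ hw)
    have heq : (fun w => C.s w + (C.translateFib g w).comp (t i (g⁻¹ • w)) a) =
        C.translate g fun w => C.s w + t i w a := by
      funext w
      change _ = C.translateFib g w (C.s (g⁻¹ • w) + t i (g⁻¹ • w) a)
      rw [map_add]
      exact congrArg (· + _) (C.translate_s g w).symm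
    have h1 : C.s (g⁻¹ • w) + t i (g⁻¹ • w) a = 0 := by
      have h2 := (congrFun heq w).symm.trans h0
      have h3 := C.smul_mk_inv g w (C.s (g⁻¹ • w) + t i (g⁻¹ • w) a)
      rw [show C.translateFib g w (C.s (g⁻¹ • w) + t i (g⁻¹ • w) a) = 0 from h2] at h3
      have h4 := C.smul_mk_inv g w 0
      rw [map_zero, ← h3] at h4
      exact (KuranishiChart.mk_inj.1 (MulAction.injective g h4)).symm
    rw [heq]
    exact C.linearization_translate_surjective g hsm h1 (ha _ hw h1)

/-- The lift of a linear family. -/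
theorem IsLevelOneChange.isLinearFamilyOn_lift {Cy Cx : KuranishiChart X} {c : CoordChange Cy Cx}
    {L : LevelOneData c} {Uy Uy' : Set Cy.Base} {Ux Ux' : Set Cx.Base}
    (hL : IsLevelOneChange L Uy Uy' Ux Ux') {Λ : (ι → ℝ) → Cy.Tot → ℚ}
    (h : IsLinearFamilyOn Cy.bundle Cy.s J Λ (c.domIn Uy' Ux')) :
    IsLinearFamilyOn Cx.bundle Cx.s J (fun a => L.lift (Λ a)) L.W := by
  classical
  intro w hw
  obtain ⟨O, κ, hκ, t, q, hO, hzO, hOD, hb⟩ := h _ (hL.p_mem w hw)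
  refine ⟨L.W ∩ L.p ⁻¹' O, κ, hκ, fun i w => (L.liftVec w).comp (t i (L.p w)), q,
    hL.continuousOn_p.isOpen_inter_preimage hL.W_open hO, ⟨hw, hzO⟩, inter_subset_left, ?_⟩
  refine ⟨hb.pos, hb.sum_eq_one, fun i a w hw => ?_, fun i a ha w => ?_, fun a w hw e => ?_,
    fun i => (hb.transverse i).mono fun a ha w hw h0 => ?_⟩
  · exact hL.smoothAt_liftSec (t := fun z => t i z a) hw.1 (hb.smooth i a _ hw.2)
  · simp [hb.eq_zero i a ha]
  · exact hL.lift_apply hw.1 (hb.weight a _ hw.2) e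
  · have hsec : (fun w => (L.liftVec w).comp (t i (L.p w)) a) = L.liftSec fun z => t i z a := rfl
    have h1 := hL.linearization_liftSec_surjective (t := fun z => t i z a) hw.1
      (hb.smooth i a _ hw.2) (ha _ hw.2) h0
    rw [← hsec] at h1
    exact h1

end FamilyTransport

/-! ### Extension of a family over one chart -/

section Extension

open MeasureTheory

variable {X : Type u} [TopologicalSpace X] (C : KuranishiChart X)

namespace KuranishiChart

/-- A smooth nonnegative function which is invariant and vanishes exactly on a given closed
invariant set. -/
theorem exists_invariant_zero_iff {Z : Set C.Base} (hZ : IsClosed Z) (hZi : C.Invariant Z) :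
    ∃ f : C.Base → ℝ, ContMDiff (cornerModel C.dim) 𝓘(ℝ, ℝ) ∞ f ∧ (∀ z, f z = 0 ↔ z ∈ Z) ∧
      ∀ (g : C.Grp) z, f (g • z) = f z := by
  have := Fintype.ofFinite C.Grp
  have := C.locallyCompactSpace
  obtain ⟨f, hf, hf01, hf0, -⟩ := exists_contMDiff_zero_iff_one_iff_of_isClosed
    (cornerModel C.dim) (n := ⊤) hZ isClosed_empty (disjoint_empty Z)
  have hpos : ∀ z, 0 ≤ f z := fun z => (hf01 (mem_range_self z)).1
  refine ⟨fun z => ∑ g : C.Grp, f (g • z), ?_, fun z => ?_, fun g z => ?_⟩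
  · exact contMDiff_finsetSum fun g _ => hf.comp (C.smul_smooth g)
  · rw [Finset.sum_eq_zero_iff_of_nonneg fun g _ => hpos _]
    constructor
    · intro h
      have h1 := h 1 (Finset.mem_univ _)
      rw [one_smul] at h1
      exact (hf0 z).2 h1
    · intro h g _
      exact (hf0 _).1 (hZi g z h)
  · simp only [← mul_smul]
    exact Equiv.sum_comp (Equiv.mulRight g) fun k => f (k • z)

/-- An invariant smooth cutoff function. -/
theorem exists_invariant_cutoff {Z R : Set C.Base} (hZ : IsClosed Z) (hZi : C.Invariant Z)
    (hR : IsOpen R) (hRi : C.Invariant R) (hZR : Z ⊆ R) :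
    ∃ f : C.Base → ℝ, ContMDiff (cornerModel C.dim) 𝓘(ℝ, ℝ) ∞ f ∧
      (∀ z ∈ Z, ∀ᶠ w in 𝓝 z, f w = 1) ∧ (∀ z ∉ R, ∀ᶠ w in 𝓝 z, f w = 0) ∧
      ∀ (g : C.Grp) z, f (g • z) = f z := by
  have := Fintype.ofFinite C.Grp
  obtain ⟨f, hf, hf1, hf0, -⟩ := exists_smooth_cutoff C.dim hZ hR hZR
  have hcard : (Fintype.card C.Grp : ℝ) ≠ 0 := Nat.cast_ne_zero.2 Fintype.card_ne_zero
  have hev : ∀ {z : C.Base} {c : ℝ}, (∀ g : C.Grp, ∀ᶠ w in 𝓝 (g • z), f w = c) →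
      ∀ᶠ w in 𝓝 z, ∀ g : C.Grp, f (g • w) = c := fun h =>
    eventually_all.2 fun g => (C.continuous_smul g).continuousAt.eventually (h g)
  refine ⟨fun z => (Fintype.card C.Grp : ℝ)⁻¹ * ∑ g : C.Grp, f (g • z), ?_, fun z hz => ?_,
    fun z hz => ?_, fun g z => ?_⟩
  · exact contMDiff_const.mul (contMDiff_finsetSum fun g _ => hf.comp (C.smul_smooth g))
  · filter_upwards [hev fun g => hf1 _ (hZi g z hz)] with w hw
    simp [hw, hcard]
  · filter_upwards [hev fun g => hf0 _ fun h => hz ((hRi.smul_mem_iff g).1 h)] with w hw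
    simp [hw]
  · simp only [← mul_smul]
    congr 1
    exact Equiv.sum_comp (Equiv.mulRight g) fun k => f (k • z)

section Noise

variable {C} {ι : Type*}

/-- The translate by `g` of the linear family of sections `∑ a_{h,t} η² ht`, where `ht` is the
translate of `t` by `h` and the index of the parameter `a_{h,t}` is `j h t`. -/
def noise (η : C.Base → ℝ) {𝒯 : Set (∀ z, C.Fib z)} [Fintype C.Grp] [Fintype 𝒯]
    (j : C.Grp → 𝒯 → ι) (g : C.Grp) (w : C.Base) : (ι → ℝ) →ₗ[ℝ] C.Fib w :=
  ∑ h : C.Grp, ∑ t : 𝒯,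
    (LinearMap.proj (j h t) : (ι → ℝ) →ₗ[ℝ] ℝ).smulRight (η w • η w • C.translate (g * h) t w)

variable {η : C.Base → ℝ} {𝒯 : Set (∀ z, C.Fib z)} {j : C.Grp → 𝒯 → ι}

theorem smoothAt_translate_smul (hη : ContMDiff (cornerModel C.dim) 𝓘(ℝ, ℝ) ∞ η)
    (h𝒯 : ∀ t ∈ 𝒯, ∀ z, C.bundle.SmoothAt t z) (a : ι → ℝ) (g h : C.Grp) (t : 𝒯) (w : C.Base) :
    C.bundle.SmoothAt (fun w => a (j h t) • η w • C.translate (g * h) t w) w :=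
  ((smoothAt_translate (g * h) (h𝒯 t t.2 _)).smul hη.contMDiffAt).const_smul _

variable [Fintype C.Grp] [Fintype 𝒯]

theorem noise_apply (g : C.Grp) (w : C.Base) (a : ι → ℝ) :
    noise η j g w a = ∑ h : C.Grp, ∑ t : 𝒯, a (j h t) • η w • η w • C.translate (g * h) t w := by
  simp [noise]

theorem smulFib_noise (hη : ∀ (g : C.Grp) z, η (g • z) = η z) (k g : C.Grp) (w : C.Base)
    (a : ι → ℝ) : C.smulFib k w (noise η j g w a) = noise η j (k * g) (k • w) a := by
  simp only [noise_apply, map_sum, map_smul, hη]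
  refine Finset.sum_congr rfl fun h _ => Finset.sum_congr rfl fun t _ => ?_
  rw [smulFib_apply, ← translate_mul, mul_assoc]

theorem noise_eq (a : ι → ℝ) (g : C.Grp) (w : C.Base) : noise η j g w a =
    η w • ∑ h : C.Grp, ∑ t : 𝒯, a (j h t) • η w • C.translate (g * h) t w := by
  simp only [noise_apply, Finset.smul_sum]
  exact Finset.sum_congr rfl fun h _ => Finset.sum_congr rfl fun t _ => smul_comm _ _ _

theorem smoothAt_noise (hη : ContMDiff (cornerModel C.dim) 𝓘(ℝ, ℝ) ∞ η)
    (h𝒯 : ∀ t ∈ 𝒯, ∀ z, C.bundle.SmoothAt t z) (a : ι → ℝ) (g : C.Grp) (w : C.Base) :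
    C.bundle.SmoothAt (fun w => noise η j g w a) w := by
  simp only [noise_eq]
  refine SmoothVectorBundle.SmoothAt.smul hη.contMDiffAt ?_
  exact SmoothVectorBundle.SmoothAt.sum fun h _ => SmoothVectorBundle.SmoothAt.sum fun t _ =>
    smoothAt_translate_smul hη h𝒯 a g h t w

/-- The family vanishes to first order where `η` vanishes, because of the square. -/
theorem linearization_noise (hη : ContMDiff (cornerModel C.dim) 𝓘(ℝ, ℝ) ∞ η)
    (h𝒯 : ∀ t ∈ 𝒯, ∀ z, C.bundle.SmoothAt t z) (a : ι → ℝ) (g : C.Grp) {w : C.Base}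
    (hw : η w = 0) (v : EuclideanSpace ℝ (Fin C.dim)) :
    C.bundle.linearization (fun w => noise η j g w a) w v = 0 := by
  simp only [noise_eq]
  rw [SmoothVectorBundle.linearization_smul hη.contMDiffAt
    (SmoothVectorBundle.SmoothAt.sum fun h _ => SmoothVectorBundle.SmoothAt.sum fun t _ =>
    smoothAt_translate_smul hη h𝒯 a g h t w) (by simp [hw]), hw, zero_smul]

theorem noise_single [DecidableEq ι] (hj : Function.Injective fun p : C.Grp × 𝒯 => j p.1 p.2)
    (g : C.Grp) (t : 𝒯) (w : C.Base) :
    noise η j g w (Pi.single (j g⁻¹ t) 1) = η w • η w • t.1 w := by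
  rw [noise_apply, Finset.sum_eq_single g⁻¹, Finset.sum_eq_single t]
  · rw [Pi.single_eq_same, one_smul, mul_inv_cancel, translate_one]
  · intro t' _ ht'
    rw [Pi.single_eq_of_ne, zero_smul]
    exact fun h => ht' (Prod.ext_iff.1 (hj (a₁ := (g⁻¹, t')) (a₂ := (g⁻¹, t)) h)).2
  · simp
  · intro h _ hh
    refine Finset.sum_eq_zero fun t' _ => ?_
    rw [Pi.single_eq_of_ne, zero_smul]
    exact fun h' => hh (Prod.ext_iff.1 (hj (a₁ := (h, t')) (a₂ := (g⁻¹, t)) h')).1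
  · simp

end Noise

open Classical in
/-- The weight function `Λ` scaled by `χ`; where `χ` vanishes it is the zero section. -/
def scaledWeight (χ : C.Base → ℝ) (Λ : C.Tot → ℚ) (v : C.Tot) : ℚ :=
  if χ v.proj = 0 then (if v.2 = 0 then 1 else 0) else Λ ⟨v.proj, (χ v.proj)⁻¹ • v.2⟩

variable {C}

open Classical in
theorem scaledWeight_apply {χ : C.Base → ℝ} {Λ : C.Tot → ℚ} {w : C.Base} {κ : Type*} [Fintype κ]
    {f : κ → C.Fib w} {q : κ → ℚ} (hq : ∑ i, q i = 1)
    (h : ∀ e, Λ ⟨w, e⟩ = ∑ i, if f i = e then q i else 0) (e : C.Fib w) :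
    C.scaledWeight χ Λ ⟨w, e⟩ = ∑ i, if χ w • f i = e then q i else 0 := by
  by_cases hw : χ w = 0
  · simp only [scaledWeight, hw, if_true, zero_smul]
    by_cases he : e = 0
    · simp [he, hq]
    · rw [if_neg he]
      exact (Finset.sum_eq_zero fun i _ => if_neg fun h => he h.symm).symm
  · simp only [scaledWeight, hw, if_false]
    rw [h]
    refine Finset.sum_congr rfl fun i _ => if_congr ?_ rfl rfl
    constructor
    · intro h'
      rw [h', smul_inv_smul₀ hw]
    · rintro rfl
      rw [inv_smul_smul₀ hw]

theorem scaledWeight_smul {χ : C.Base → ℝ} {Λ : C.Tot → ℚ} (hχ : ∀ (g : C.Grp) z, χ (g • z) = χ z)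
    (hΛ : ∀ (g : C.Grp) (v : C.Tot), χ v.proj ≠ 0 → Λ (g • v) = Λ v) (g : C.Grp) (v : C.Tot) :
    C.scaledWeight χ Λ (g • v) = C.scaledWeight χ Λ v := by
  obtain ⟨w, e⟩ := v
  rw [smul_mk]
  simp only [scaledWeight, hχ]
  by_cases hw : χ w = 0
  · rw [if_pos hw, if_pos hw]
    have h : C.smulFib g w e = 0 ↔ e = 0 :=
      ⟨fun h => (C.smulFib_bijective g w).1 (h.trans (map_zero _).symm), fun h => h ▸ map_zero _⟩
    by_cases he : e = 0
    · exact (if_pos (h.2 he)).trans (if_pos he).symm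
    · exact (if_neg (mt h.1 he)).trans (if_neg he).symm
  · rw [if_neg hw, if_neg hw, ← map_smul, ← smul_mk]
    exact hΛ g _ hw

variable {ι : Type*}

open Classical in
/-- The average over `g` in the group of the scaled family, translated by the sections `σ g`. -/
def extendedWeight [Fintype C.Grp] (χ : C.Base → ℝ) (σ : C.Grp → ∀ w, (ι → ℝ) →ₗ[ℝ] C.Fib w)
    (Λ : (ι → ℝ) → C.Tot → ℚ) (a : ι → ℝ) (v : C.Tot) : ℚ :=
  ∑ g : C.Grp, (Fintype.card C.Grp : ℚ)⁻¹ *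
    C.scaledWeight χ (Λ a) ⟨v.proj, v.2 - σ g v.proj a⟩

open Classical in
theorem extendedWeight_apply [Fintype C.Grp] {χ : C.Base → ℝ}
    {σ : C.Grp → ∀ w, (ι → ℝ) →ₗ[ℝ] C.Fib w} {Λ : (ι → ℝ) → C.Tot → ℚ} {a : ι → ℝ} {w : C.Base}
    {κ : Type*} [Fintype κ] {f : κ → C.Fib w} {q : κ → ℚ}
    (h : ∀ e, C.scaledWeight χ (Λ a) ⟨w, e⟩ = ∑ i, if f i = e then q i else 0) (e : C.Fib w) :
    extendedWeight χ σ Λ a ⟨w, e⟩ = ∑ p : κ × C.Grp,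
      if f p.1 + σ p.2 w a = e then (Fintype.card C.Grp : ℚ)⁻¹ * q p.1 else 0 := by
  rw [Fintype.sum_prod_type_right]
  refine Finset.sum_congr rfl fun g _ => ?_
  rw [h, Finset.mul_sum]
  refine Finset.sum_congr rfl fun i _ => ?_
  rw [mul_ite, mul_zero]
  exact if_congr eq_sub_iff_add_eq rfl rfl

theorem extendedWeight_smul [Fintype C.Grp] {χ : C.Base → ℝ}
    {σ : C.Grp → ∀ w, (ι → ℝ) →ₗ[ℝ] C.Fib w} {Λ : (ι → ℝ) → C.Tot → ℚ} {a : ι → ℝ}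
    (hχ : ∀ (g : C.Grp) z, χ (g • z) = χ z)
    (hσ : ∀ k g w, C.smulFib k w (σ g w a) = σ (k * g) (k • w) a)
    (hΛ : ∀ (g : C.Grp) (v : C.Tot), χ v.proj ≠ 0 → Λ a (g • v) = Λ a v) (k : C.Grp) (v : C.Tot) :
    extendedWeight χ σ Λ a (k • v) = extendedWeight χ σ Λ a v := by
  obtain ⟨w, e⟩ := v
  rw [smul_mk]
  refine (Equiv.sum_comp (Equiv.mulLeft k) _).symm.trans (Finset.sum_congr rfl fun g _ => ?_)
  congr 1
  rw [← scaledWeight_smul hχ hΛ k ⟨w, e - σ g w a⟩, smul_mk, map_sub, hσ]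
  rfl

/-- A family of multisections near a compact set `K` extends to the whole chart after it has been
changed away from a neighbourhood of `K`: it is cut off, made transverse away from `K` by adding a
linear combination of sections whose `1`-jets span and whose coefficients are new parameters, and
averaged over the group. -/
theorem exists_linearFamily_extension [Fintype ι] {D R K : Set C.Base} (hD : IsOpen D)
    (hR : IsOpen R) (hRi : C.Invariant R) (hK : IsCompact K) (hKR : K ⊆ R) {J J' : Set ι}
    {Λ : (ι → ℝ) → C.Tot → ℚ} (hΛ : IsLinearFamilyOn C.bundle C.s J Λ R)
    (hΛi : ∀ a (g : C.Grp) (v : C.Tot), v.proj ∈ R → Λ a (g • v) = Λ a v)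
    {𝒯 : Set (∀ z, C.Fib z)} (h𝒯f : 𝒯.Finite) (h𝒯 : ∀ t ∈ 𝒯, ∀ z, C.bundle.SmoothAt t z)
    (hspan : ∀ w ∈ D, C.bundle.SpansJets 𝒯 w) {j : C.Grp → 𝒯 → ι}
    (hj : Function.Injective fun p : C.Grp × 𝒯 => j p.1 p.2) (hjJ : ∀ h t, j h t ∉ J)
    (hJJ' : J ⊆ J') (hjJ' : ∀ h t, j h t ∈ J') :
    ∃ (Λ' : (ι → ℝ) → C.Tot → ℚ) (N : Set C.Base), IsOpen N ∧ K ⊆ N ∧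
      IsLinearFamilyOn C.bundle C.s J' Λ' D ∧ (∀ a (g : C.Grp) v, Λ' a (g • v) = Λ' a v) ∧
      ∀ a (v : C.Tot), v.proj ∈ N → Λ' a v = Λ a v := by
  classical
  have := Fintype.ofFinite C.Grp
  have : Fintype 𝒯 := h𝒯f.fintype
  have := C.locallyCompactSpace
  obtain ⟨Z₀, hZ₀, hKZ₀, hZ₀R⟩ := exists_compact_between hK hR hKR
  let Z := C.saturation Z₀
  have hZ : IsClosed Z := (isCompact_saturation hZ₀).isClosed
  have hZi : C.Invariant Z := invariant_saturation Z₀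
  have hZR : Z ⊆ R := saturation_subset hRi hZ₀R
  obtain ⟨χ, hχ, hχ1, hχ0, hχi⟩ := C.exists_invariant_cutoff hZ hZi hR hRi hZR
  obtain ⟨η, hη, hη0, hηi⟩ := C.exists_invariant_zero_iff hZ hZi
  have hcard : (0 : ℚ) < (Fintype.card C.Grp : ℚ)⁻¹ := by
    have := Fintype.card_pos (α := C.Grp)
    positivity
  have hcard1 : ∑ _g : C.Grp, (Fintype.card C.Grp : ℚ)⁻¹ = 1 := by
    rw [Finset.sum_const, Finset.card_univ, nsmul_eq_mul, mul_inv_cancel₀]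
    exact Nat.cast_ne_zero.2 Fintype.card_ne_zero
  have hχR : ∀ z, χ z ≠ 0 → z ∈ R := fun z hz => by
    by_contra h
    exact hz (hχ0 z h).self_of_nhds
  have hnoise0 : ∀ (g : C.Grp) a, (∀ i ∈ J', a i = 0) → ∀ w, noise η j g w a = 0 := by
    intro g a ha w
    rw [noise_apply]
    exact Finset.sum_eq_zero fun h _ => Finset.sum_eq_zero fun t _ => by
      rw [ha _ (hjJ' h t), zero_smul]
  -- away from `Z`, every linear family of the form `τ + noise` is generically transverse
  have hgen : ∀ (O : Set C.Base) (g : C.Grp) (τ : ∀ w, (ι → ℝ) →ₗ[ℝ] C.Fib w), IsOpen O →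
      O ⊆ D → (∀ a, ∀ w ∈ O, C.bundle.SmoothAt (fun z => τ z a) w) →
      (∀ a, (∀ i ∈ J, a i = 0) → ∀ w, τ w a = 0) →
      ∀ᵐ a : ι → ℝ, ∀ w ∈ O \ Z, C.s w + (τ w a + noise η j g w a) = 0 →
        Function.Surjective (C.bundle.linearization
          (fun z => C.s z + (τ z a + noise η j g z a)) w) := by
    intro O g τ hO hOD hτ hτ0
    -- the parameters `a_{g⁻¹,t}` are the coefficients of `η² t`, and `τ` does not involve them
    have h1 := C.bundle.volume_not_transverse_eq_zero (hO.sdiff hZ) (u := C.s)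
      (fun z _ => C.s_smoothAt z) (τ := fun w => τ w + noise η j g w)
      (fun a z hz => (hτ a z hz.1).add (smoothAt_noise hη h𝒯 a g z)) (fun z hz => by
        have hηz : η z ≠ 0 := fun h => hz.2 ((hη0 z).1 h)
        have hη2 : ContMDiffAt (cornerModel C.dim) 𝓘(ℝ, ℝ) ∞ (fun z => η z * η z) z :=
          (hη.mul hη).contMDiffAt
        refine ((hspan z (hOD hz.1)).smul (fun t ht => h𝒯 t ht z) hη2
          (mul_ne_zero hηz hηz)).mono ?_
        rintro _ ⟨t, ht, rfl⟩
        refine ⟨Pi.single (j g⁻¹ ⟨t, ht⟩) 1, ?_⟩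
        funext w
        have h2 : τ w (Pi.single (j g⁻¹ ⟨t, ht⟩) 1) = 0 := hτ0 _ (fun i hi => by
          rw [Pi.single_eq_of_ne]
          rintro rfl
          exact hjJ _ _ hi) w
        simp only [LinearMap.add_apply, h2, noise_single hj, zero_add, mul_smul])
    rw [ae_iff]
    convert h1 using 2
    ext a
    simp only [not_forall, mem_ofPred_eq, LinearMap.add_apply, exists_prop]
  refine ⟨extendedWeight χ (noise η j) Λ, interior Z, isOpen_interior,
    hKZ₀.trans (interior_mono (subset_saturation Z₀)), fun z hz => ?_, fun a g v => ?_,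
    fun a v hv => ?_⟩
  · by_cases hzR : z ∈ R
    · obtain ⟨O, κ, hκ, t, q, hO, hzO, hOR, hb⟩ := hΛ z hzR
      refine ⟨O ∩ D, κ × C.Grp, inferInstance, fun p w => χ w • t p.1 w + noise η j p.2 w,
        fun p => (Fintype.card C.Grp : ℚ)⁻¹ * q p.1, hO.inter hD, ⟨hzO, hz⟩, inter_subset_right, ?_⟩
      have hsm : ∀ i a, ∀ w ∈ O, C.bundle.SmoothAt (fun z => χ z • t i z a) w := fun i a w hw =>
        (hb.smooth i a w hw).smul hχ.contMDiffAt
      refine ⟨fun p => mul_pos hcard (hb.pos _), ?_, fun p a w hw => ?_, fun p a ha w => ?_,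
        fun a w hw e => ?_, fun p => ?_⟩
      · rw [Fintype.sum_prod_type_right]
        simp only [← Finset.mul_sum, hb.sum_eq_one, mul_one]
        exact hcard1
      · exact (hsm p.1 a w hw.1).add (smoothAt_noise hη h𝒯 a p.2 w)
      · simp only [LinearMap.add_apply, LinearMap.smul_apply]
        rw [hb.eq_zero p.1 a fun i hi => ha i (hJJ' hi), hnoise0 p.2 a ha, smul_zero, add_zero]
      · rw [extendedWeight_apply (scaledWeight_apply hb.sum_eq_one (hb.weight a w hw.1))]
        rfl
      · filter_upwards [hb.transverse p.1, hgen (O ∩ D) p.2 (fun w => χ w • t p.1 w)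
          (hO.inter hD) inter_subset_right (fun a w hw => hsm p.1 a w hw.1) (fun a ha w => by
            rw [LinearMap.smul_apply, hb.eq_zero p.1 a ha, smul_zero])] with a ha ha' w hw h0
        by_cases hwZ : w ∈ Z
        · -- on `Z` the linearization is that of the given family
          have hη' := (hη0 w).2 hwZ
          have hn0 : noise η j p.2 w a = 0 := by rw [noise_eq, hη', zero_smul]
          have h1 := (hχ1 w hwZ).self_of_nhds
          have h2 : C.s w + t p.1 w a = 0 := by
            simpa [hn0, h1] using h0
          have h3 := ha w hw.1 h2
          have hlin : C.bundle.linearization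
              (fun z => C.s z + (χ z • t p.1 z + noise η j p.2 z) a) w =
              C.bundle.linearization (fun z => C.s z + t p.1 z a) w := by
            have h4 : C.bundle.linearization
              (fun z => C.s z + (χ z • t p.1 z + noise η j p.2 z) a) w =
              C.bundle.linearization (fun z => (C.s z + t p.1 z a) + noise η j p.2 z a) w := by
              refine SmoothVectorBundle.linearization_congr ?_
              filter_upwards [hχ1 w hwZ] with z hz
              rw [hz, one_smul, LinearMap.add_apply, add_assoc]
            rw [h4]
            funext v
            refine (SmoothVectorBundle.linearization_add
              ((C.s_smoothAt w).add (hb.smooth p.1 a w hw.1)) (smoothAt_noise hη h𝒯 a p.2 w) h2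
              hn0 v).trans ?_
            exact (congrArg _ (linearization_noise hη h𝒯 a p.2 hη' v)).trans (add_zero _)
          rw [hlin]
          exact h3
        · exact ha' w ⟨hw, hwZ⟩ h0
    · obtain ⟨O, hO, hOopen, hzO⟩ := eventually_nhds_iff.1 (hχ0 z hzR)
      have hzZ : z ∉ Z := fun h => hzR (hZR h)
      refine ⟨(O ∩ D) \ Z, C.Grp, inferInstance, fun g w => noise η j g w,
        fun g => (Fintype.card C.Grp : ℚ)⁻¹, (hOopen.inter hD).sdiff hZ, ⟨⟨hzO, hz⟩, hzZ⟩,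
        sdiff_subset.trans inter_subset_right, ?_⟩
      refine ⟨fun g => hcard, hcard1, fun g a w hw => smoothAt_noise hη h𝒯 a g w,
        fun g a ha w => hnoise0 g a ha w, fun a w hw e => ?_, fun g => ?_⟩
      · refine Finset.sum_congr rfl fun g _ => ?_
        simp only [scaledWeight, hO w hw.1.1, if_true, mul_ite, mul_one, mul_zero]
        refine if_congr ?_ rfl rfl
        rw [sub_eq_zero, eq_comm]
      · have h1 := hgen (O ∩ D) g (fun _ => 0) (hOopen.inter hD) inter_subset_right
          (fun a w _ => SmoothVectorBundle.smoothAt_zero w) (fun _ _ _ => rfl)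
        simpa only [LinearMap.zero_apply, zero_add] using h1
  · exact extendedWeight_smul hχi (fun k g w => smulFib_noise hηi k g w a)
      (fun g v hv => hΛi a g v (hχR _ hv)) g v
  · obtain ⟨w, e⟩ := v
    have hwZ : w ∈ Z := interior_subset hv
    have h1 := (hχ1 w hwZ).self_of_nhds
    have h2 : ∀ g, noise η j g w a = 0 := fun g => by rw [noise_eq, (hη0 w).2 hwZ, zero_smul]
    simp only [extendedWeight, h2, sub_zero, scaledWeight, h1, one_ne_zero, if_false, inv_one,
      one_smul, ← Finset.sum_mul, hcard1, one_mul]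

end KuranishiChart

end Extension

/-! ### Consistency of the lifts -/

section LiftConsistency

variable {X : Type u} [TopologicalSpace X]

theorem KuranishiChart.eventually_smul_mem {C : KuranishiChart X} {g : C.Grp} {w : C.Base}
    {D : Set C.Base} (hD : IsOpen D) (h : g • w ∈ D) : ∀ᶠ w' in 𝓝 w, g • w' ∈ D :=
  (C.continuous_smul g).continuousAt.eventually (hD.mem_nhds h)

/-- The lift of an invariant multisection does not depend on the sheet: a group element which moves
a point of `W` into `W` comes from the group of the smaller chart. -/
theorem IsLevelOneChange.lift_smul {Cy Cx : KuranishiChart X} {c : CoordChange Cy Cx}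
    {L : LevelOneData c} {Uy Uy' : Set Cy.Base} {Ux Ux' : Set Cx.Base}
    (hL : IsLevelOneChange L Uy Uy' Ux Ux') {Λ : Cy.Tot → ℚ}
    (hΛ : ∀ (g : Cy.Grp) v, Λ (g • v) = Λ v) {g : Cx.Grp}
    {v : Cx.Tot} (hv : v.proj ∈ L.W) (hgv : g • v.proj ∈ L.W) : L.lift Λ (g • v) = L.lift Λ v := by
  have hg : g ∈ c.ρ.range := by
    by_contra hg
    exact disjoint_left.1 (hL.sheets g hg) ⟨subset_closure hgv, hL.W_subset hgv⟩
      ⟨subset_closure ⟨_, hv, rfl⟩, hL.W_subset hgv⟩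
  obtain ⟨m, rfl⟩ := hg
  by_cases hin : L.InSub v
  · rw [LevelOneData.lift, LevelOneData.lift, if_pos hin, if_pos (hL.sub_invariant m v hin),
      hL.T_equivariant m v hin, hΛ]
  · have hin' : ¬ L.InSub (c.ρ m • v) := fun h => hin (by
      have h1 := hL.sub_invariant m⁻¹ _ h
      rwa [map_inv, inv_smul_smul] at h1)
    rw [LevelOneData.lift, LevelOneData.lift, if_neg hin, if_neg hin']

/-- The lift of a lift is a lift. -/
theorem LevelOneData.lift_eq_lift {Cz Cy Cx : KuranishiChart X} {czy : CoordChange Cz Cy}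
    {cyx : CoordChange Cy Cx} {czx : CoordChange Cz Cx} {Lzy : LevelOneData czy}
    {Lyx : LevelOneData cyx} {Lzx : LevelOneData czx} {Λz : Cz.Tot → ℚ} {Λy : Cy.Tot → ℚ}
    {v v' : Cx.Tot} (hsub : (Lyx.InSub v ∧ Lzy.InSub (Lyx.hatT v)) ↔ Lzx.InSub v')
    (hT : Lzx.InSub v' → Lzy.hatT (Lyx.hatT v) = Lzx.hatT v')
    (hΛ : Λy (Lyx.hatT v) = Lzy.lift Λz (Lyx.hatT v)) : Lyx.lift Λy v = Lzx.lift Λz v' := by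
  by_cases h : Lzx.InSub v'
  · have h' := hsub.2 h
    rw [lift, if_pos h'.1, hΛ, lift, if_pos h'.2, hT h, lift, if_pos h]
  · rw [lift, lift, if_neg h]
    by_cases h1 : Lyx.InSub v
    · rw [if_pos h1, hΛ, lift, if_neg fun h2 => h (hsub.1 ⟨h1, h2⟩)]
    · rw [if_neg h1]

namespace GoodCoordinateSystem

variable {A : GoodCoordinateSystem X} {U U' K : A.Fam}
  {L : ∀ (y x : A.S) (h : A.I y x), LevelOneData (A.chg y x h)} {ι : Type*} [Fintype ι]

/-- The family `Λ x` on the chart `x` is invariant, and near the images of the coordinate changes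
from the charts of smaller rank, restricted to `K`, it is the lift of their families. The parameters
have levels; the family on a chart involves only the parameters up to its own rank. -/
structure IsLiftedFamily (L : ∀ (y x : A.S) (h : A.I y x), LevelOneData (A.chg y x h))
    (U' K : A.Fam) (r : A.S → ℕ) (lvl : ι → ℕ)
    (Λ : ∀ x : A.S, (ι → ℝ) → (A.chart x).Tot → ℚ) (x : A.S) : Prop where
  linear : IsLinearFamilyOn (A.chart x).bundle (A.chart x).s {i | lvl i ≤ r x} (Λ x) (U' x)
  invariant : ∀ a (g : (A.chart x).Grp) v, Λ x a (g • v) = Λ x a v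
  lifted : ∀ (y : A.S) (h : A.I y x), r y < r x → ∃ N, IsOpen N ∧
    (A.chg y x h).φ '' A.domIn K y x h ⊆ N ∧ N ⊆ (L y x h).W ∧
    ∀ a v, v.proj ∈ N → Λ x a v = (L y x h).lift (Λ y a) v

variable {r : A.S → ℕ} {lvl : ι → ℕ} {Λ : ∀ x : A.S, (ι → ℝ) → (A.chart x).Tot → ℚ}

/-- The lifts of `Λ y` and `Λ y'`, translated by `g` and `g'`, are defined over `w` and agree. -/
def LiftsAgree (L : ∀ (y x : A.S) (h : A.I y x), LevelOneData (A.chg y x h))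
    (Λ : ∀ x : A.S, (ι → ℝ) → (A.chart x).Tot → ℚ) {x y y' : A.S} (h : A.I y x) (h' : A.I y' x)
    (g g' : (A.chart x).Grp) (w : (A.chart x).Base) : Prop :=
  g⁻¹ • w ∈ (L y x h).W ∧ g'⁻¹ • w ∈ (L y' x h').W ∧ ∀ a (v : (A.chart x).Tot), v.proj = w →
    (L y x h).lift (Λ y a) (g⁻¹ • v) = (L y' x h').lift (Λ y' a) (g'⁻¹ • v)

omit [Fintype ι] in
theorem LiftsAgree.symm {x y y' : A.S} {h : A.I y x} {h' : A.I y' x}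
    {g g' : (A.chart x).Grp} {w : (A.chart x).Base} (hw : LiftsAgree L Λ h h' g g' w) :
    LiftsAgree L Λ h' h g' g w :=
  ⟨hw.2.1, hw.1, fun a v hv => (hw.2.2 a v hv).symm⟩

/-- The lifts of the families of two charts `y'`, `y` agree near the points that come from both. The
point of `y` comes from the one of `y'`, hence the family of `y` is near it the lift of the family
of `y'`, and the level-1 structure is compatible. -/
theorem eventually_liftsAgree_of_lt (hL : IsLevelOneSystem A U U' L)
    (hU : A.StronglyIntersecting U) (hr : ∀ y x, r y < r x → A.le y x)
    (hK : ∀ x, K x ⊆ U' x) (hKi : ∀ x, (A.chart x).Invariant (K x)) {x y y' : A.S}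
    (h : A.I y x) (h' : A.I y' x) (hΛ : A.IsLiftedFamily L U' K r lvl Λ y)
    (hΛ' : A.IsLiftedFamily L U' K r lvl Λ y') (hyy' : r y' < r y) {g g' : (A.chart x).Grp}
    {z : (A.chart y).Base} (hz : z ∈ A.domIn K y x h) {z' : (A.chart y').Base}
    (hz' : z' ∈ A.domIn K y' x h') (hzz' : g • (A.chg y x h).φ z = g' • (A.chg y' x h').φ z') :
    ∀ᶠ w in 𝓝 (g • (A.chg y x h).φ z), LiftsAgree L Λ h h' g g' w := by
  have hsub := hL.shrinking.subset
  have hinv := hL.shrinking.invariant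
  -- the coordinate change from `y'` to `y` at `z'`
  have hid : A.Ident A.full ⟨y', z'⟩ ⟨y, z⟩ := by
    refine Relation.EqvGen.trans _ _ _ ((ident_full_iff h').2 ⟨hz'.2.1, g', rfl⟩) ?_
    rw [← hzz']
    exact Relation.EqvGen.symm _ _ ((ident_full_iff h).2 ⟨hz.2.1, g, rfl⟩)
  have hI : A.I y' y := by
    obtain ⟨q, hq⟩ := hU y' y z' (hsub _ (hK _ hz'.1)) z (hsub _ (hK _ hz.1)) hid
    exact ⟨hr _ _ hyy', q, KuranishiChart.footprint_mono (subset_univ _) hq.1,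
      KuranishiChart.footprint_mono (subset_univ _) hq.2⟩
  obtain ⟨hd, m, hm⟩ := (ident_full_iff hI).1 hid
  have hm' : (A.chg y' y hI).φ z' = m⁻¹ • z := by rw [hm, inv_smul_smul]
  have hzK : (A.chg y' y hI).φ z' ∈ K y := hm' ▸ hKi y _ _ hz.1
  have hdom : (A.chg y' y hI).φ z' ∈ A.domIn U' y x h := by
    rw [hm']
    refine ⟨hinv y _ _ (hK y hz.1), (A.chg y x h).dom_invariant _ _ hz.2.1, ?_⟩
    rw [(A.chg y x h).φ_equivariant _ _ hz.2.1]
    exact hinv x _ _ (hK x hz.2.2)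
  obtain ⟨N, hN, hzN, hNW, hlift⟩ := hΛ.lifted y' hI hyy'
  replace hzN := hzN ⟨z', ⟨hz'.1, hd, hzK⟩, rfl⟩
  obtain ⟨k, hk1, -, hk3, -⟩ := hL.compatible y' y x hI h h'
  have hz'U : z' ∈ A.domIn U' y' x h' := ⟨hK _ hz'.1, hz'.2.1, hK _ hz'.2.2⟩
  have hzU : z ∈ A.domIn U' y x h := ⟨hK _ hz.1, hz.2.1, hK _ hz.2.2⟩
  have hφ : (A.chg y x h).φ ((A.chg y' y hI).φ z') = k • (A.chg y' x h').φ z' := by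
    have h1 := congrArg TotalSpace.proj (hk1 ⟨z', 0⟩ hz'U ⟨hK _ hz'.1, hd, hK _ hzK⟩ hdom)
    rw [(A.chart x).proj_smul] at h1
    exact h1
  -- the translate `l w` of the point at which the compatibility is applied
  set w₀ := g • (A.chg y x h).φ z with hw₀
  let l : (A.chart x).Grp := ((A.chg y x h).ρ m)⁻¹ * g⁻¹
  have hl : l • w₀ = (A.chg y x h).φ ((A.chg y' y hI).φ z') := by
    rw [hm', (A.chg y x h).φ_equivariant _ _ hz.2.1, hw₀, mul_smul, inv_smul_smul, map_inv]
  have himg := (hL.change y x h).image_mem _ hdom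
  have himg' := (hL.change y' x h').image_mem _ hz'U
  have himg0 := (hL.change y x h).image_mem _ hzU
  have h1 : ∀ᶠ w in 𝓝 w₀, l • w ∈ (L y x h).W ∩ (L y x h).p ⁻¹' N := by
    refine KuranishiChart.eventually_smul_mem
      ((hL.change y x h).continuousOn_p.isOpen_inter_preimage (hL.change y x h).W_open hN) ?_
    rw [hl]
    exact ⟨himg.1, by rw [mem_preimage, himg.2]; exact hzN⟩
  have h2 : ∀ᶠ w in 𝓝 w₀, (k⁻¹ * l) • w ∈ (L y' x h').W := by
    refine KuranishiChart.eventually_smul_mem (hL.change y' x h').W_open ?_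
    rw [mul_smul, hl, hφ, inv_smul_smul]
    exact himg'.1
  have h3 : ∀ᶠ w in 𝓝 w₀, g⁻¹ • w ∈ (L y x h).W := by
    refine KuranishiChart.eventually_smul_mem (hL.change y x h).W_open ?_
    rw [hw₀, inv_smul_smul]
    exact himg0.1
  have h4 : ∀ᶠ w in 𝓝 w₀, g'⁻¹ • w ∈ (L y' x h').W := by
    refine KuranishiChart.eventually_smul_mem (hL.change y' x h').W_open ?_
    rw [hzz', inv_smul_smul]
    exact himg'.1
  filter_upwards [h1, h2, h3, h4] with w h1 h2 h3 h4
  refine ⟨h3, h4, fun a v hv => ?_⟩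
  have hp : ∀ k : (A.chart x).Grp, (k • v).proj = k • w := fun k => by
    rw [(A.chart x).proj_smul, hv]
  have e1 : (L y x h).lift (Λ y a) (l • v) = (L y x h).lift (Λ y a) (g⁻¹ • v) := by
    have h5 := (hL.change y x h).lift_smul (hΛ.invariant a) (g := l * g) (v := g⁻¹ • v)
      (by rw [hp]; exact h3) (by rw [hp, ← mul_smul, mul_inv_cancel_right]; exact h1.1)
    rwa [← mul_smul, mul_inv_cancel_right] at h5
  have e2 : (L y' x h').lift (Λ y' a) ((k⁻¹ * l) • v) =
      (L y' x h').lift (Λ y' a) (g'⁻¹ • v) := by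
    have h5 := (hL.change y' x h').lift_smul (hΛ'.invariant a) (g := k⁻¹ * l * g')
      (v := g'⁻¹ • v) (by rw [hp]; exact h4)
      (by rw [hp, ← mul_smul, mul_inv_cancel_right]; exact h2)
    rwa [← mul_smul, mul_inv_cancel_right] at h5
  have h6 := hk3 (l • v) (by rw [hp]; exact h1.1)
    (by rw [hp, ← mul_smul]; exact h2) (by rw [hp]; exact hNW h1.2)
  rw [← mul_smul] at h6
  rw [← e1, ← e2]
  refine LevelOneData.lift_eq_lift h6.1 h6.2.1 (hlift a _ ?_)
  change (L y x h).p (l • v).proj ∈ N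
  rw [hp]
  exact h1.2

theorem eventually_liftsAgree (hL : IsLevelOneSystem A U U' L)
    (hU : A.StronglyIntersecting U) (hr : ∀ y x, r y < r x → A.le y x)
    (hri : Function.Injective r)
    (hK : ∀ x, K x ⊆ U' x) (hKi : ∀ x, (A.chart x).Invariant (K x)) {x y y' : A.S}
    (h : A.I y x) (h' : A.I y' x) (hΛ : A.IsLiftedFamily L U' K r lvl Λ y)
    (hΛ' : A.IsLiftedFamily L U' K r lvl Λ y') {g g' : (A.chart x).Grp}
    {z : (A.chart y).Base} (hz : z ∈ A.domIn K y x h) {z' : (A.chart y').Base}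
    (hz' : z' ∈ A.domIn K y' x h') (hzz' : g • (A.chg y x h).φ z = g' • (A.chg y' x h').φ z') :
    ∀ᶠ w in 𝓝 (g • (A.chg y x h).φ z), LiftsAgree L Λ h h' g g' w := by
  rcases lt_trichotomy (r y') (r y) with hlt | heq | hlt
  · exact eventually_liftsAgree_of_lt hL hU hr hK hKi h h' hΛ hΛ' hlt hz hz' hzz'
  · obtain rfl := hri heq
    have h1 := (hL.change y' x h).image_mem z ⟨hK _ hz.1, hz.2.1, hK _ hz.2.2⟩
    have h2 := (hL.change y' x h).image_mem z' ⟨hK _ hz'.1, hz'.2.1, hK _ hz'.2.2⟩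
    have h3 : ∀ᶠ w in 𝓝 (g • (A.chg y' x h).φ z), g⁻¹ • w ∈ (L y' x h).W := by
      refine KuranishiChart.eventually_smul_mem (hL.change y' x h).W_open ?_
      rw [inv_smul_smul]
      exact h1.1
    have h4 : ∀ᶠ w in 𝓝 (g • (A.chg y' x h).φ z), g'⁻¹ • w ∈ (L y' x h).W := by
      refine KuranishiChart.eventually_smul_mem (hL.change y' x h).W_open ?_
      rw [hzz', inv_smul_smul]
      exact h2.1
    filter_upwards [h3, h4] with w h3 h4
    refine ⟨h3, h4, fun a v hv => ?_⟩
    have h5 := (hL.change y' x h).lift_smul (hΛ.invariant a) (g := g⁻¹ * g') (v := g'⁻¹ • v)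
      (by rw [(A.chart x).proj_smul, hv]; exact h4)
      (by rw [(A.chart x).proj_smul, hv, ← mul_smul, mul_inv_cancel_right]; exact h3)
    rwa [← mul_smul, mul_inv_cancel_right] at h5
  · rw [hzz']
    exact (eventually_liftsAgree_of_lt hL hU hr hK hKi h' h hΛ' hΛ hlt hz' hz hzz'.symm).mono
      fun w hw => hw.symm

end GoodCoordinateSystem

end LiftConsistency

/-! ### Recursion over the charts -/

section Recursion

open GoodCoordinateSystem

variable {X : Type u} [TopologicalSpace X] {A : GoodCoordinateSystem X} {U U' K : A.Fam}
  {L : ∀ (y x : A.S) (h : A.I y x), LevelOneData (A.chg y x h)} {ι : Type*} [Fintype ι]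
  {r : A.S → ℕ} {lvl : ι → ℕ} {Λ : ∀ x : A.S, (ι → ℝ) → (A.chart x).Tot → ℚ}

/-- The translated neighbourhoods of the images of the charts of smaller rank can be chosen so small
that the lifts agree on their intersections. -/
theorem IsLevelOneSystem.exists_nhds_liftsAgree (hL : IsLevelOneSystem A U U' L)
    (hU : A.StronglyIntersecting U) (hUH : A.IsHausdorff U) (hr : ∀ y x, r y < r x → A.le y x)
    (hri : Function.Injective r) (hKc : ∀ x, IsCompact (K x)) (hK : ∀ x, K x ⊆ U' x)
    (hKi : ∀ x, (A.chart x).Invariant (K x)) {x : A.S}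
    (hΛ : ∀ y, r y < r x → A.IsLiftedFamily L U' K r lvl Λ y) :
    ∃ N : {y : A.S // A.I y x ∧ r y < r x} → Set (A.chart x).Base, (∀ y, IsOpen (N y)) ∧
      (∀ y : {y : A.S // A.I y x ∧ r y < r x}, (A.chg y x y.2.1).φ '' A.domIn K y x y.2.1 ⊆ N y) ∧
      ∀ (y y' : {y : A.S // A.I y x ∧ r y < r x}) (g g' : (A.chart x).Grp) w,
        g⁻¹ • w ∈ N y → g'⁻¹ • w ∈ N y' → LiftsAgree L Λ y.2.1 y'.2.1 g g' w := by
  have hfin : Finite A.S := A.S_finite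
  let P := {y : A.S // A.I y x ∧ r y < r x} × (A.chart x).Grp
  let C : P → Set (A.chart x).Base := fun p =>
    (fun w => p.2 • w) '' ((A.chg p.1 x p.1.2.1).φ '' A.domIn K p.1 x p.1.2.1)
  have hC : ∀ p, IsCompact (C p) := fun p =>
    (hUH.isCompact_image hKc (fun x => (hK x).trans (hL.shrinking.subset x)) hKi _ x
      p.1.2.1).image ((A.chart x).continuous_smul p.2)
  obtain ⟨N, hN, hCN, hNN⟩ := exists_isOpen_inter_subset hC
    (Q := fun p p' => interior {w | LiftsAgree L Λ p.1.2.1 p'.1.2.1 p.2 p'.2 w})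
    (fun _ _ => isOpen_interior) (by
      rintro ⟨y, g⟩ ⟨y', g'⟩ w ⟨⟨_, ⟨z, hz, rfl⟩, rfl⟩, ⟨_, ⟨z', hz', rfl⟩, h⟩⟩
      exact mem_interior_iff_mem_nhds.2 (eventually_liftsAgree hL hU hr hri hK hKi y.2.1 y'.2.1
        (hΛ _ y.2.2) (hΛ _ y'.2.2) hz hz' h.symm))
  refine ⟨fun y => ⋂ g, (fun w => g • w) ⁻¹' N (y, g), fun y => ?_, fun y => ?_,
    fun y y' g g' w h h' => ?_⟩
  · exact isOpen_iInter_of_finite fun g => (hN _).preimage ((A.chart x).continuous_smul g)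
  · exact fun w hw => mem_iInter.2 fun g => hCN (y, g) ⟨w, hw, rfl⟩
  · have h1 := mem_iInter.1 h g
    have h2 := mem_iInter.1 h' g'
    simp only [mem_preimage, smul_inv_smul] at h1 h2
    have h3 := interior_subset (s := {w | LiftsAgree L Λ y.2.1 y'.2.1 g g' w})
      (hNN (y, g) (y', g') ⟨h1, h2⟩)
    exact h3

/-- One step of the recursion: the lifts of the families of the charts of smaller rank fit together
to a family near the union of their images, which is extended over the chart. -/
theorem IsLevelOneSystem.exists_isLiftedFamily_update (hL : IsLevelOneSystem A U U' L)
    (hU : A.StronglyIntersecting U) (hUH : A.IsHausdorff U) (hr : ∀ y x, r y < r x → A.le y x)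
    (hri : Function.Injective r) (hKc : ∀ x, IsCompact (K x)) (hK : ∀ x, K x ⊆ U' x)
    (hKi : ∀ x, (A.chart x).Invariant (K x)) {x : A.S}
    (hΛ : ∀ y, r y < r x → A.IsLiftedFamily L U' K r lvl Λ y)
    {𝒯 : Set (∀ z, (A.chart x).Fib z)} (h𝒯f : 𝒯.Finite)
    (h𝒯 : ∀ t ∈ 𝒯, ∀ z, (A.chart x).bundle.SmoothAt t z)
    (hspan : ∀ w ∈ U' x, (A.chart x).bundle.SpansJets 𝒯 w) {j : (A.chart x).Grp → 𝒯 → ι}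
    (hj : Function.Injective fun p : (A.chart x).Grp × 𝒯 => j p.1 p.2)
    (hjl : ∀ g t, lvl (j g t) = r x) [DecidableEq A.S] :
    ∃ Λx, A.IsLiftedFamily L U' K r lvl (Function.update Λ x Λx) x := by
  classical
  have hfin : Finite A.S := A.S_finite
  obtain ⟨N, hN, hCN, hNN⟩ := hL.exists_nhds_liftsAgree hU hUH hr hri hKc hK hKi hΛ
  let P := {y : A.S // A.I y x ∧ r y < r x} × (A.chart x).Grp
  let R : Set (A.chart x).Base := {w | ∃ p : P, p.2⁻¹ • w ∈ N p.1}
  -- the family given by the lifts, where one of them is defined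
  let ΛR : (ι → ℝ) → (A.chart x).Tot → ℚ := fun a v =>
    if h : ∃ p : P, p.2⁻¹ • v.proj ∈ N p.1 then
      (L _ x h.choose.1.2.1).lift (Λ h.choose.1 a) (h.choose.2⁻¹ • v) else 0
  have hΛR : ∀ (p : P) a v, p.2⁻¹ • v.proj ∈ N p.1 →
      ΛR a v = (L _ x p.1.2.1).lift (Λ p.1 a) (p.2⁻¹ • v) := by
    intro p a v hv
    have h : ∃ p : P, p.2⁻¹ • v.proj ∈ N p.1 := ⟨p, hv⟩
    change (if h : ∃ p : P, p.2⁻¹ • v.proj ∈ N p.1 then _ else _) = _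
    rw [dif_pos h]
    exact (hNN _ _ _ _ _ h.choose_spec hv).2.2 a v rfl
  have hNW : ∀ y, N y ⊆ (L _ x y.2.1).W := fun y w hw => by
    have h1 := (hNN y y 1 1 w (by rwa [inv_one, one_smul]) (by rwa [inv_one, one_smul])).1
    rwa [inv_one, one_smul] at h1
  have hRo : IsOpen R := by
    have h1 : R = ⋃ p : P, (fun w => p.2⁻¹ • w) ⁻¹' N p.1 := by
      ext w
      simp only [R, mem_iUnion]
      rfl
    rw [h1]
    exact isOpen_iUnion fun p => (hN p.1).preimage ((A.chart x).continuous_smul _)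
  have hRi : (A.chart x).Invariant R := by
    rintro g w ⟨p, hp⟩
    refine ⟨(p.1, g * p.2), ?_⟩
    change (g * p.2)⁻¹ • g • w ∈ N p.1
    rwa [mul_inv_rev, mul_smul, inv_smul_smul]
  have hRfam : IsLinearFamilyOn (A.chart x).bundle (A.chart x).s {i | lvl i < r x} ΛR R := by
    refine IsLinearFamilyOn.of_local ?_
    rintro w ⟨p, hp⟩
    refine ⟨(fun w => p.2⁻¹ • w) ⁻¹' N p.1, hp, fun w' hw' => ⟨p, hw'⟩, ?_⟩
    have hchg := hL.change p.1 x p.1.2.1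
    have h1 := hchg.isLinearFamilyOn_lift ((hΛ p.1 p.1.2.2).linear.mono
      (J' := {i | lvl i < r x}) (fun i hi => lt_of_le_of_lt hi p.1.2.2) hchg.isOpen_domIn
      (fun z hz => hz.1) (fun _ _ _ => rfl))
    exact (h1.translate p.2).mono subset_rfl ((hN p.1).preimage
      ((A.chart x).continuous_smul _)) (preimage_mono (hNW p.1)) fun a v hv => hΛR p a v hv
  have hRinv : ∀ a (g : (A.chart x).Grp) (v : (A.chart x).Tot), v.proj ∈ R →
      ΛR a (g • v) = ΛR a v := by
    rintro a g v ⟨p, hp⟩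
    rw [hΛR p a v hp, hΛR (p.1, g * p.2) a (g • v)]
    · rw [mul_inv_rev, mul_smul, inv_smul_smul]
    · change (g * p.2)⁻¹ • (g • v).proj ∈ N p.1
      rwa [(A.chart x).proj_smul, mul_inv_rev, mul_smul, inv_smul_smul]
  have hKc' : IsCompact (⋃ y : {y : A.S // A.I y x ∧ r y < r x},
      (A.chg y x y.2.1).φ '' A.domIn K y x y.2.1) :=
    isCompact_iUnion fun y => hUH.isCompact_image hKc
      (fun x => (hK x).trans (hL.shrinking.subset x)) hKi _ x y.2.1
  obtain ⟨Λx, N', hN', hKN', hlin, hinv, heq⟩ :=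
    (A.chart x).exists_linearFamily_extension (hL.shrinking.isOpen x) hRo hRi hKc'
      (iUnion_subset fun y w hw => ⟨(y, 1), by
        change (1 : (A.chart x).Grp)⁻¹ • w ∈ N y
        rw [inv_one, one_smul]
        exact hCN y hw⟩) hRfam hRinv h𝒯f h𝒯 hspan hj (J' := {i | lvl i ≤ r x})
      (fun g t h => lt_irrefl _ ((hjl g t).symm.trans_lt h))
      (fun i hi => show lvl i ≤ r x from (show lvl i < r x from hi).le)
      (fun g t => (hjl g t).le)
  refine ⟨Λx, ?_, ?_, fun y h hy => ?_⟩
  · rwa [Function.update_self]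
  · rwa [Function.update_self]
  · have hyx : y ≠ x := by
      rintro rfl
      exact lt_irrefl _ hy
    rw [Function.update_self, Function.update_of_ne hyx]
    refine ⟨N ⟨y, h, hy⟩ ∩ N', (hN _).inter hN', subset_inter (hCN ⟨y, h, hy⟩) ?_,
      inter_subset_left.trans (hNW ⟨y, h, hy⟩), fun a v hv => ?_⟩
    · exact (subset_iUnion (fun y : {y : A.S // A.I y x ∧ r y < r x} =>
        (A.chg y x y.2.1).φ '' A.domIn K y x y.2.1) ⟨y, h, hy⟩).trans hKN'
    · rw [heq a v hv.2, hΛR (⟨y, h, hy⟩, 1) a v (by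
        change (1 : (A.chart x).Grp)⁻¹ • v.proj ∈ _
        rw [inv_one, one_smul]
        exact hv.1)]
      rw [inv_one, one_smul]

theorem GoodCoordinateSystem.IsLiftedFamily.congr
    {Λ' : ∀ x : A.S, (ι → ℝ) → (A.chart x).Tot → ℚ} {x : A.S}
    (h : A.IsLiftedFamily L U' K r lvl Λ x) (hΛ : ∀ y, r y ≤ r x → Λ' y = Λ y) :
    A.IsLiftedFamily L U' K r lvl Λ' x where
  linear := by rw [hΛ x le_rfl]; exact h.linear
  invariant := by rw [hΛ x le_rfl]; exact h.invariant
  lifted y hy hyx := by rw [hΛ x le_rfl, hΛ y hyx.le]; exact h.lifted y hy hyx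

/-- There are families of multisections on all charts which are lifted from each other. -/
theorem IsLevelOneSystem.exists_isLiftedFamily (hL : IsLevelOneSystem A U U' L)
    (hU : A.StronglyIntersecting U) (hUH : A.IsHausdorff U) (hr : ∀ y x, r y < r x → A.le y x)
    (hri : Function.Injective r) (hKc : ∀ x, IsCompact (K x)) (hK : ∀ x, K x ⊆ U' x)
    (hKi : ∀ x, (A.chart x).Invariant (K x)) :
    ∃ (ι : Type u) (_ : Fintype ι) (lvl : ι → ℕ)
      (Λ : ∀ x : A.S, (ι → ℝ) → (A.chart x).Tot → ℚ),
      ∀ x, A.IsLiftedFamily L U' K r lvl Λ x := by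
  classical
  have hfin : Finite A.S := A.S_finite
  have hex : ∀ x : A.S, ∃ 𝒯 : Set (∀ z, (A.chart x).Fib z), 𝒯.Finite ∧
      (∀ t ∈ 𝒯, ∀ z, (A.chart x).bundle.SmoothAt t z) ∧
        ∀ w ∈ U' x, (A.chart x).bundle.SpansJets 𝒯 w := fun x => by
    obtain ⟨𝒯, h1, h2, h3⟩ := (A.chart x).bundle.exists_finite_spansJets (hL.shrinking.compact x)
    exact ⟨𝒯, h1, h2, fun w hw => h3 w (subset_closure hw)⟩
  choose 𝒯 h𝒯f h𝒯 hspan using hex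
  have hfin𝒯 : ∀ x, Finite (𝒯 x) := fun x => (h𝒯f x).to_subtype
  -- the parameters on the chart `x` are the coefficients of the translates of its spanning sections
  let ι := Σ x : A.S, (A.chart x).Grp × 𝒯 x
  have hι : Fintype ι := Fintype.ofFinite ι
  let lvl : ι → ℕ := fun i => r i.1
  have key : ∀ n : ℕ, ∃ Λ : ∀ x : A.S, (ι → ℝ) → (A.chart x).Tot → ℚ,
      ∀ x, r x < n → A.IsLiftedFamily L U' K r lvl Λ x := by
    intro n
    induction n with
    | zero => exact ⟨fun _ _ _ => 0, fun x hx => absurd hx (Nat.not_lt_zero _)⟩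
    | succ n ih =>
      obtain ⟨Λ, hΛ⟩ := ih
      by_cases hx : ∃ x, r x = n
      · obtain ⟨x, rfl⟩ := hx
        obtain ⟨Λx, hΛx⟩ := hL.exists_isLiftedFamily_update hU hUH hr hri hKc hK hKi hΛ (h𝒯f x)
          (h𝒯 x) (hspan x) (j := fun g t => ⟨x, g, t⟩) (fun p p' h => by
            have h1 := eq_of_heq (Sigma.mk.inj h).2
            exact h1) (fun _ _ => rfl)
        refine ⟨Function.update Λ x Λx, fun y hy => ?_⟩
        rcases Nat.lt_succ_iff_lt_or_eq.1 hy with hy | hy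
        · refine IsLiftedFamily.congr (hΛ y hy) fun z hz => Function.update_of_ne ?_ _ _
          rintro rfl
          omega
        · obtain rfl := hri hy
          exact hΛx
      · refine ⟨Λ, fun x hx' => hΛ x (lt_of_le_of_ne (Nat.lt_succ_iff.1 hx') fun h => hx ⟨x, h⟩)⟩
  obtain ⟨n, hn⟩ := (Set.finite_range r).bddAbove
  obtain ⟨Λ, hΛ⟩ := key (n + 1)
  exact ⟨ι, hι, lvl, Λ, fun x => hΛ x (Nat.lt_succ_of_le (hn (mem_range_self x)))⟩

end Recursion

/-! ### Solution sets -/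

section Solutions

open GoodCoordinateSystem MeasureTheory

variable {X : Type u} [TopologicalSpace X]

/-- Over the image of the coordinate change the lift has the weights of the given multisection. -/
theorem IsLevelOneChange.lift_hat {Cy Cx : KuranishiChart X} {c : CoordChange Cy Cx}
    {L : LevelOneData c} {Uy Uy' : Set Cy.Base} {Ux Ux' : Set Cx.Base}
    (hL : IsLevelOneChange L Uy Uy' Ux Ux') (Λ : Cy.Tot → ℚ) {v : Cy.Tot}
    (hv : v.proj ∈ c.domIn Uy' Ux') : L.lift Λ (c.hat v) = Λ v := by
  have hin : L.InSub (c.hat v) := by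
    refine ⟨(hL.image_mem _ hv).1, ?_⟩
    change _ ∈ L.sub (c.φ v.proj)
    rw [hL.sub_image _ hv]
    exact ⟨v.2, rfl⟩
  rw [LevelOneData.lift, if_pos hin, hL.T_image v hv]

theorem KuranishiChart.smul_neg_s (C : KuranishiChart X) (g : C.Grp) (z : C.Base) :
    g • (⟨z, -C.s z⟩ : C.Tot) = ⟨g • z, -C.s (g • z)⟩ := by
  rw [C.smul_mk, map_neg, C.smulFib_apply, C.translate_s]

theorem CoordChange.hat_neg_s {Cy Cx : KuranishiChart X} (c : CoordChange Cy Cx) {z : Cy.Base}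
    (hz : z ∈ c.dom) : c.hat ⟨z, -Cy.s z⟩ = ⟨c.φ z, -Cx.s (c.φ z)⟩ := by
  change (⟨c.φ z, c.Φ z (-Cy.s z)⟩ : Cx.Tot) = _
  rw [map_neg, c.section_comp z hz]

theorem CoordChange.isOpen_domIn {Cy Cx : KuranishiChart X} (c : CoordChange Cy Cx)
    {Vy : Set Cy.Base} {Vx : Set Cx.Base} (hy : IsOpen Vy) (hx : IsOpen Vx) :
    IsOpen (c.domIn Vy Vx) :=
  hy.inter (c.φ_smooth.continuousOn.isOpen_inter_preimage c.dom_open hx)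

variable {A : GoodCoordinateSystem X} {U U' K V : A.Fam}
  {L : ∀ (y x : A.S) (h : A.I y x), LevelOneData (A.chg y x h)} {ι : Type*} [Fintype ι]
  {r : A.S → ℕ} {lvl : ι → ℕ} {Λ : ∀ x : A.S, (ι → ℝ) → (A.chart x).Tot → ℚ}

theorem GoodCoordinateSystem.IsLiftedFamily.coherent (hL : IsLevelOneSystem A U U' L)
    (hK : ∀ x, K x ⊆ U' x) {x : A.S} (hΛ : A.IsLiftedFamily L U' K r lvl Λ x) {y : A.S}
    (h : A.I y x) (hyx : r y < r x) (a : ι → ℝ) {v : (A.chart y).Tot}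
    (hv : v.proj ∈ A.domIn K y x h) : Λ x a ((A.chg y x h).hat v) = Λ y a v := by
  obtain ⟨N, -, hKN, -, hlift⟩ := hΛ.lifted y h hyx
  rw [hlift a _ (hKN ⟨v.proj, hv, rfl⟩)]
  exact (hL.change y x h).lift_hat _ ⟨hK _ hv.1, hv.2.1, hK _ hv.2.2⟩

/-- A solution over `K` near a zero of the section of a chart is identified with a solution in the
given family `V` of open sets whose coverages cover `X`. -/
theorem IsLevelOneSystem.eventually_exists_solution (hL : IsLevelOneSystem A U U' L)
    (hr : ∀ y x, r y < r x → A.le y x) (hri : Function.Injective r)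
    (hK : ∀ x, K x ⊆ U' x) (hKi : ∀ x, (A.chart x).Invariant (K x)) (hVo : ∀ x, IsOpen (V x))
    (hVi : ∀ x, (A.chart x).Invariant (V x)) (hVK : ∀ x, V x ⊆ K x)
    (hcov : ∀ q : X, ∃ x, q ∈ (A.chart x).footprint (V x))
    (hΛ : ∀ x, A.IsLiftedFamily L U' K r lvl Λ x) {x : A.S} {z₀ : (A.chart x).Base}
    (hz₀ : z₀ ∈ K x) (h0 : (A.chart x).s z₀ = 0) :
    ∀ᶠ w in 𝓝 z₀, w ∈ K x → ∀ a, Λ x a ⟨w, -(A.chart x).s w⟩ ≠ 0 →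
      ∃ (x' : A.S) (w' : (A.chart x').Base), w' ∈ V x' ∧ A.Ident U' ⟨x, w⟩ ⟨x', w'⟩ ∧
        Λ x' a ⟨w', -(A.chart x').s w'⟩ ≠ 0 := by
  obtain ⟨x', ⟨z', hz'0⟩, hz'V, hψ⟩ := hcov ((A.chart x).ψ ⟨z₀, h0⟩)
  simp only [mem_ofPred_eq] at hz'V
  have hfx : (A.chart x).ψ ⟨z₀, h0⟩ ∈ (A.chart x).footprint univ := ⟨_, trivial, rfl⟩
  have hfx' : (A.chart x).ψ ⟨z₀, h0⟩ ∈ (A.chart x').footprint univ := ⟨_, trivial, hψ⟩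
  rcases lt_trichotomy (r x') (r x) with hlt | heq | hlt
  · -- `z₀` comes from `x'`; near it the family is lifted, so a solution has `s_x` in the subbundle
    -- and hence lies in the image of the coordinate change
    have hI : A.I x' x := ⟨hr _ _ hlt, _, hfx', hfx⟩
    have hd : z' ∈ (A.chg x' x hI).dom :=
      (A.chg x' x hI).overlap_subset_dom ⟨z', hz'0⟩ (by rw [hψ]; exact hfx)
    have hφ0 : (A.chart x).s ((A.chg x' x hI).φ z') = 0 := by
      rw [← (A.chg x' x hI).section_comp z' hd, hz'0, map_zero]
    obtain ⟨g, hg⟩ := ((A.chart x).ψ_eq_iff ⟨_, hφ0⟩ ⟨z₀, h0⟩).1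
      (((A.chg x' x hI).ψ_comp ⟨z', hz'0⟩ ⟨_, hφ0⟩ hd rfl).trans hψ)
    simp only at hg
    have hg' : g⁻¹ • z₀ = (A.chg x' x hI).φ z' := by rw [hg, inv_smul_smul]
    have hz'K : z' ∈ A.domIn K x' x hI := ⟨hVK _ hz'V, hd, hg' ▸ hKi x _ _ hz₀⟩
    obtain ⟨N, hN, hKN, hNW, hlift⟩ := (hΛ x).lifted x' hI hlt
    have hchg := hL.change x' x hI
    have himg := hchg.image_mem z' ⟨hK _ hz'K.1, hd, hK _ hz'K.2.2⟩
    have hopen : IsOpen (N ∩ ((L x' x hI).W ∩ (L x' x hI).p ⁻¹' V x')) :=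
      hN.inter (hchg.continuousOn_p.isOpen_inter_preimage hchg.W_open (hVo x'))
    have hmem : g⁻¹ • z₀ ∈ N ∩ ((L x' x hI).W ∩ (L x' x hI).p ⁻¹' V x') := by
      rw [hg']
      exact ⟨hKN ⟨z', hz'K, rfl⟩, himg.1, by rw [mem_preimage, himg.2]; exact hz'V⟩
    filter_upwards [KuranishiChart.eventually_smul_mem hopen hmem] with w hw hwK a ha
    rw [← (hΛ x).invariant a g⁻¹, KuranishiChart.smul_neg_s, hlift a _ hw.1] at ha
    have hs : (A.chart x).s (g⁻¹ • w) ∈ (L x' x hI).sub (g⁻¹ • w) := by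
      by_contra hs
      refine ha (if_neg fun hin => hs ?_)
      exact (Submodule.neg_mem_iff _).1 hin.2
    obtain ⟨b, hb, hbw⟩ := (hchg.quotient_zeros _ hw.2.1).1 hs
    have hbV : b ∈ V x' := by
      have h1 := hw.2.2
      rwa [mem_preimage, ← hbw, (hchg.image_mem b hb).2] at h1
    refine ⟨x', b, hbV, ?_, ?_⟩
    · have h1 := ident_smul (V := U') (x := x) g⁻¹ (hK x hwK) (hchg.W_subset hw.2.1)
      rw [← hbw] at h1
      exact Relation.EqvGen.trans _ _ _ h1 (Relation.EqvGen.symm _ _ (ident_φ hI hb))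
    · rwa [← hbw, ← (A.chg x' x hI).hat_neg_s hb.2.1, hchg.lift_hat _ hb] at ha
  · obtain rfl := hri heq
    obtain ⟨g, hg⟩ := ((A.chart x').ψ_eq_iff ⟨z', hz'0⟩ ⟨z₀, h0⟩).1 hψ
    simp only at hg
    have hz₀V : z₀ ∈ V x' := hg ▸ hVi x' g _ hz'V
    filter_upwards [(hVo x').mem_nhds hz₀V] with w hw _ a ha
    exact ⟨x', w, hw, Relation.EqvGen.refl _, ha⟩
  · have hI : A.I x x' := ⟨hr _ _ hlt, _, hfx, hfx'⟩
    have hd : z₀ ∈ (A.chg x x' hI).dom :=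
      (A.chg x x' hI).overlap_subset_dom ⟨z₀, h0⟩ hfx'
    have hφ0 : (A.chart x').s ((A.chg x x' hI).φ z₀) = 0 := by
      rw [← (A.chg x x' hI).section_comp z₀ hd, h0, map_zero]
    obtain ⟨g, hg⟩ := ((A.chart x').ψ_eq_iff ⟨z', hz'0⟩ ⟨_, hφ0⟩).1
      (hψ.trans ((A.chg x x' hI).ψ_comp ⟨z₀, h0⟩ ⟨_, hφ0⟩ hd rfl).symm)
    simp only at hg
    have hmem : z₀ ∈ (A.chg x x' hI).dom ∩ (A.chg x x' hI).φ ⁻¹' V x' :=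
      ⟨hd, by rw [mem_preimage, hg]; exact hVi x' g _ hz'V⟩
    filter_upwards [((A.chg x x' hI).φ_smooth.continuousOn.isOpen_inter_preimage
      (A.chg x x' hI).dom_open (hVo x')).mem_nhds hmem] with w hw hwK a ha
    refine ⟨x', (A.chg x x' hI).φ w, hw.2,
      ident_φ hI ⟨hK x hwK, hw.1, hK _ (hVK _ hw.2)⟩, ?_⟩
    rw [← (A.chg x x' hI).hat_neg_s hw.1,
      (hΛ x').coherent hL hK hI hlt a (v := ⟨w, -(A.chart x).s w⟩) ⟨hwK, hw.1, hVK _ hw.2⟩]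
    exact ha

/-- For small parameters the branches lie in given neighbourhoods of the zero sections, and every
solution over `K` is identified with a solution in `V`: away from the zeros of the sections there
are no solutions. -/
theorem IsLevelOneSystem.eventually_small (hL : IsLevelOneSystem A U U' L)
    (hr : ∀ y x, r y < r x → A.le y x) (hri : Function.Injective r)
    (hKc : ∀ x, IsCompact (K x))
    (hK : ∀ x, K x ⊆ U' x) (hKi : ∀ x, (A.chart x).Invariant (K x)) (hVo : ∀ x, IsOpen (V x))
    (hVi : ∀ x, (A.chart x).Invariant (V x)) (hVK : ∀ x, V x ⊆ K x)
    (hcov : ∀ q : X, ∃ x, q ∈ (A.chart x).footprint (V x))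
    (hΛ : ∀ x, A.IsLiftedFamily L U' K r lvl Λ x) {O : ∀ x : A.S, Set (A.chart x).Tot}
    (hO : ∀ x, IsOpen (O x)) (hO0 : ∀ x (z : (A.chart x).Base), ⟨z, 0⟩ ∈ O x) :
    ∀ᶠ a in 𝓝 (0 : ι → ℝ), ∀ x, ∀ w ∈ K x, (∀ e, Λ x a ⟨w, e⟩ ≠ 0 → ⟨w, e⟩ ∈ O x) ∧
      (Λ x a ⟨w, -(A.chart x).s w⟩ ≠ 0 →
      ∃ (x' : A.S) (w' : (A.chart x').Base), w' ∈ V x' ∧ A.Ident U' ⟨x, w⟩ ⟨x', w'⟩ ∧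
        Λ x' a ⟨w', -(A.chart x').s w'⟩ ≠ 0) := by
  have hfin : Finite A.S := A.S_finite
  refine eventually_all.2 fun x => ?_
  suffices h : ∀ᶠ a in 𝓝 (0 : ι → ℝ), ∀ w ∈ K x, w ∈ K x →
      (∀ e, Λ x a ⟨w, e⟩ ≠ 0 → ⟨w, e⟩ ∈ O x) ∧
      (Λ x a ⟨w, -(A.chart x).s w⟩ ≠ 0 →
      ∃ (x' : A.S) (w' : (A.chart x').Base), w' ∈ V x' ∧ A.Ident U' ⟨x, w⟩ ⟨x', w'⟩ ∧
        Λ x' a ⟨w', -(A.chart x').s w'⟩ ≠ 0) from h.mono fun a ha w hw => ha w hw hw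
  refine (hKc x).eventually_forall_of_forall_eventually fun z hz => ?_
  have hlin := (hΛ x).linear
  have h1 := hlin.eventually_mem (a := 0) (hK x hz) (hO x) (fun e he => by
    rw [hlin.eq_zero_of_weight_zero_ne_zero (hK x hz) he]
    exact hO0 x z)
  by_cases h0 : (A.chart x).s z = 0
  · have h2 : ∀ᶠ p : (ι → ℝ) × (A.chart x).Base in 𝓝 (0, z), _ := continuousAt_snd.eventually
      (hL.eventually_exists_solution hr hri hK hKi hVo hVi hVK hcov hΛ hz h0)
    filter_upwards [h1, h2] with p hp hp' hpK
    exact ⟨hp, hp' hpK p.1⟩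
  · have h2 := hlin.eventually_weight_eq_zero (a := 0) (A.chart x).s_smoothAt (hK x hz) (by
      by_contra hne
      exact h0 (neg_eq_zero.1 (hlin.eq_zero_of_weight_zero_ne_zero (hK x hz) hne)))
    filter_upwards [h1, h2] with p hp hp' _
    exact ⟨hp, fun h => absurd hp' h⟩

/-- The solution set is compact: its image in `M(U')` is also the image of the solutions over the
compact sets `K x`. -/
theorem GoodCoordinateSystem.isCompact_solutionSet
    (hKc : ∀ x, IsCompact (K x)) (hK : ∀ x, K x ⊆ U' x) (hVK : ∀ x, V x ⊆ K x)
    (hΛ : ∀ x, A.IsLiftedFamily L U' K r lvl Λ x) (hVU : ∀ x, V x ⊆ U' x) {a : ι → ℝ}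
    (ha : ∀ x, ∀ w ∈ K x, Λ x a ⟨w, -(A.chart x).s w⟩ ≠ 0 →
      ∃ (x' : A.S) (w' : (A.chart x').Base), w' ∈ V x' ∧ A.Ident U' ⟨x, w⟩ ⟨x', w'⟩ ∧
        Λ x' a ⟨w', -(A.chart x').s w'⟩ ≠ 0) :
    @IsCompact _ (A.relTop hVU) (solutionSet A V fun x => Λ x a) := by
  have hfin : Finite A.S := A.S_finite
  let _ : TopologicalSpace (A.IdSpace U') := A.quotTop U'
  let _ : TopologicalSpace (A.IdSpace V) := A.relTop hVU
  have hind : IsInducing (A.natMap hVU) := ⟨rfl⟩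
  rw [hind.isCompact_iff]
  have hcont : ∀ x, Continuous fun z : U' x => A.toId U' ⟨⟨x, z⟩, z.2⟩ := fun x => by
    have h0 : Continuous fun z : U' x => (⟨x, z.1⟩ : A.Pt) :=
      (continuous_sigmaMk (σ := fun x : A.S => (A.chart x).Base)).comp continuous_subtype_val
    have h1 : Continuous fun z : U' x => (⟨⟨x, z⟩, z.2⟩ : A.PtIn U') := h0.subtype_mk _
    exact continuous_coinduced_rng.comp h1
  let T : ∀ x, Set (U' x) := fun x => {z | z.1 ∈ K x ∧ Λ x a ⟨z.1, -(A.chart x).s z.1⟩ ≠ 0}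
  have hT : ∀ x, IsCompact (T x) := fun x => by
    rw [Subtype.isCompact_iff]
    have h1 : Subtype.val '' T x = {z | z ∈ K x ∧ Λ x a ⟨z, -(A.chart x).s z⟩ ≠ 0} := by
      ext z
      constructor
      · rintro ⟨z, hz, rfl⟩
        exact hz
      · exact fun hz => ⟨⟨z, hK x hz.1⟩, hz, rfl⟩
    rw [h1]
    refine (hKc x).of_isClosed_subset ?_ fun z hz => hz.1
    rw [← isOpen_compl_iff, isOpen_iff_mem_nhds]
    intro z hz
    by_cases hzK : z ∈ K x
    · have h2 : Λ x a ⟨z, -(A.chart x).s z⟩ = 0 := by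
        by_contra hne
        exact hz ⟨hzK, hne⟩
      have h3 := ((hΛ x).linear.eventually_weight_eq_zero (A.chart x).s_smoothAt (hK x hzK)
        h2).curry_nhds.self_of_nhds
      filter_upwards [h3] with w hw hw'
      exact hw'.2 hw
    · filter_upwards [(hKc x).isClosed.isOpen_compl.mem_nhds hzK] with w hw hw'
      exact hw hw'.1
  have himg : A.natMap hVU '' solutionSet A V (fun x => Λ x a) =
      ⋃ x, (fun z : U' x => A.toId U' ⟨⟨x, z⟩, z.2⟩) '' T x := by
    ext p
    simp only [mem_iUnion]
    constructor
    · rintro ⟨_, ⟨⟨⟨x, z⟩, hz⟩, hsol, rfl⟩, rfl⟩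
      exact ⟨x, ⟨z, hVU x hz⟩, ⟨hVK x hz, hsol⟩, rfl⟩
    · rintro ⟨x, z, hz, rfl⟩
      obtain ⟨x', w', hw', hid, hsol⟩ := ha x z.1 hz.1 hz.2
      refine ⟨_, ⟨⟨⟨x', w'⟩, hw'⟩, hsol, rfl⟩, ?_⟩
      exact Quotient.sound (s := A.identSetoid U') (Relation.EqvGen.symm _ _ hid)
  rw [himg]
  exact isCompact_iUnion fun x => (hT x).image (hcont x)

/-- A member of a lifted family is an invariant perturbation. -/
theorem GoodCoordinateSystem.IsLiftedFamily.coherent_of_I (hL : IsLevelOneSystem A U U' L)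
    (hr : ∀ y x, r y < r x → A.le y x) (hri : Function.Injective r) (hK : ∀ x, K x ⊆ U' x)
    (hVi : ∀ x, (A.chart x).Invariant (V x)) (hVK : ∀ x, V x ⊆ K x)
    (hΛ : ∀ x, A.IsLiftedFamily L U' K r lvl Λ x) (a : ι → ℝ) (y x : A.S) (h : A.I y x)
    (v : (A.chart y).Tot) (hv : v.proj ∈ A.domIn V y x h) :
    Λ x a ((A.chg y x h).hat v) = Λ y a v := by
  have hlow : ∀ (y x : A.S) (h : A.I y x), r y < r x → ∀ v : (A.chart y).Tot,
      v.proj ∈ A.domIn V y x h → Λ x a ((A.chg y x h).hat v) = Λ y a v := fun y x h hyx v hv =>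
    (hΛ x).coherent hL hK h hyx a ⟨hVK _ hv.1, hv.2.1, hVK _ hv.2.2⟩
  rcases lt_trichotomy (r y) (r x) with hlt | heq | hlt
  · exact hlow y x h hlt v hv
  · obtain rfl := hri heq
    exact coherent_self (Λ := fun x => Λ x a) h (fun g v _ => (hΛ y).invariant a g v) v hv
  · have h' : A.I x y := ⟨hr _ _ hlt, by rw [inter_comm]; exact h.2⟩
    exact coherent_symm (Λ := fun x => Λ x a) hVi h' h (fun g v _ => (hΛ y).invariant a g v)
      (hlow x y h' hlt) v hv

theorem GoodCoordinateSystem.IsLiftedFamily.isLiftedNearImages (hL : IsLevelOneSystem A U U' L)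
    (hr : ∀ y x, r y < r x → A.le y x) (hri : Function.Injective r) (hK : ∀ x, K x ⊆ U' x)
    (hVo : ∀ x, IsOpen (V x)) (hVi : ∀ x, (A.chart x).Invariant (V x)) (hVK : ∀ x, V x ⊆ K x)
    (hΛ : ∀ x, A.IsLiftedFamily L U' K r lvl Λ x) (a : ι → ℝ) :
    IsLiftedNearImages A V L fun x => Λ x a := by
  intro y x h
  have hchg := hL.change y x h
  -- it suffices to find a neighbourhood without control on the projection
  suffices hN : ∃ N : Set (A.chart x).Base, IsOpen N ∧ (A.chg y x h).φ '' A.domIn V y x h ⊆ N ∧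
      ∀ v : (A.chart x).Tot, v.proj ∈ N → v.proj ∈ (L y x h).W →
        (L y x h).p v.proj ∈ A.domIn V y x h → Λ x a v = (L y x h).lift (Λ y a) v by
    obtain ⟨N, hN, hVN, hlift⟩ := hN
    refine ⟨N ∩ V x ∩ ((L y x h).W ∩ (L y x h).p ⁻¹' A.domIn V y x h),
      (hN.inter (hVo x)).inter (hchg.continuousOn_p.isOpen_inter_preimage hchg.W_open
        ((A.chg y x h).isOpen_domIn (hVo y) (hVo x))), fun w hw => hw.2.1, fun w hw => hw.1.2,
      ?_, fun w hw => hw.2.2, fun v hv => hlift v hv.1.1 hv.2.1 hv.2.2⟩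
    rintro _ ⟨z, hz, rfl⟩
    have himg := hchg.image_mem z ⟨hK _ (hVK _ hz.1), hz.2.1, hK _ (hVK _ hz.2.2)⟩
    exact ⟨⟨hVN ⟨z, hz, rfl⟩, hz.2.2⟩, himg.1, by rw [mem_preimage, himg.2]; exact hz⟩
  rcases lt_or_ge (r y) (r x) with hlt | hge
  · obtain ⟨N, hN, hKN, -, hlift⟩ := (hΛ x).lifted y h hlt
    refine ⟨N, hN, ?_, fun v hv _ _ => hlift a v hv⟩
    rintro _ ⟨z, hz, rfl⟩
    exact hKN ⟨z, ⟨hVK _ hz.1, hz.2.1, hVK _ hz.2.2⟩, rfl⟩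
  · have h' : A.I x y := by
      rcases hge.lt_or_eq with hlt | heq
      · exact ⟨hr _ _ hlt, by rw [inter_comm]; exact h.2⟩
      · obtain rfl := hri heq
        exact h
    refine ⟨univ, isOpen_univ, subset_univ _, fun v _ hv hpv => ?_⟩
    exact hL.lift_eq_of_mutual (Λ := fun x => Λ x a) h h'
      (IsLiftedFamily.coherent_of_I hL hr hri hK hVi hVK hΛ a y x h) hv hpv

/-- There are arbitrarily small transverse perturbations lifted along the level-1 structure: a
generic small parameter of a lifted family is one. -/
theorem IsLevelOneSystem.exists_perturbation [CompactSpace X] (hL : IsLevelOneSystem A U U' L)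
    (hU : A.StronglyIntersecting U) (hUH : A.IsHausdorff U) :
    ∃ (V : A.Fam) (hV : A.IsPrecompactShrinking V U'), ∀ O : ∀ x : A.S, Set (A.chart x).Tot,
      (∀ x, IsOpen (O x)) → (∀ x (z : (A.chart x).Base), ⟨z, 0⟩ ∈ O x) →
      ∃ Λ : WeightFamily A, IsInvariantPerturbation A V Λ ∧ IsControlledBy A V Λ O ∧
        (∀ x, IsTransverseOn (A.chart x).bundle (A.chart x).s (Λ x) (V x)) ∧
        IsLiftedNearImages A V L Λ ∧ @IsCompact _ (A.relTop hV.subset) (solutionSet A V Λ) := by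
  have hfin : Finite A.S := A.S_finite
  obtain ⟨V, hV⟩ := exists_isPrecompactShrinking hL.shrinking.toIsShrinking
  refine ⟨V, hV, fun O hO hO0 => ?_⟩
  obtain ⟨r, hri, hr⟩ := A.exists_rank
  have hVK : ∀ x, V x ⊆ closure (V x) := fun x => subset_closure
  have hKi : ∀ x, (A.chart x).Invariant (closure (V x)) := fun x => (hV.invariant x).closure
  obtain ⟨ι, hι, lvl, Λ, hΛ⟩ := hL.exists_isLiftedFamily (K := fun x => closure (V x)) hU hUH hr hri
    hV.compact hV.closure_subset hKi
  have hae : ∀ᵐ a : ι → ℝ, ∀ x, IsTransverseOn (A.chart x).bundle (A.chart x).s (Λ x a) (V x) :=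
    ae_all_iff.2 fun x => (hΛ x).linear.ae_isTransverseOn (hV.compact x) (hV.closure_subset x)
      (hV.isOpen x) (hVK x)
  have hsmall := hL.eventually_small hr hri hV.compact hV.closure_subset hKi hV.isOpen hV.invariant
    hVK hV.cover hΛ hO hO0
  obtain ⟨a, htr, ha⟩ := (Measure.dense_of_ae hae).inter_nhds_nonempty hsmall
  refine ⟨fun x => Λ x a, ⟨fun x => (htr x).isMultisectionOn,
    fun x g v _ => (hΛ x).invariant a g v,
    IsLiftedFamily.coherent_of_I hL hr hri hV.closure_subset hV.invariant hVK hΛ a⟩,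
    fun x v hv => (ha x v.proj (hVK x hv)).1 v.2, htr,
    IsLiftedFamily.isLiftedNearImages hL hr hri hV.closure_subset hV.isOpen hV.invariant hVK hΛ a,
    ?_⟩
  exact isCompact_solutionSet hV.compact hV.closure_subset hVK hΛ hV.subset
    fun x w hw => (ha x w hw).2

end Solutions

end Kuranishi

end

theorem mainTheorem4 {X : Type*} [TopologicalSpace X] [CompactSpace X]
    [TopologicalSpace.MetrizableSpace X]
    (A : Kuranishi.GoodCoordinateSystem X) (U U' : A.Fam)
    (hU : A.IsShrinking U A.full) (hU_compact : ∀ x, IsCompact (closure (U x)))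
    (hU_strong : A.StronglyIntersecting U) (hU_hausdorff : A.IsHausdorff U)
    (L : ∀ (y x : A.S) (h : A.I y x), Kuranishi.LevelOneData (A.chg y x h))
    (hL : Kuranishi.IsLevelOneSystem A U U' L) :
    (∀ (y x : A.S) (h : A.I y x) (τ : (A.chart y).Tot → ℚ),
      Kuranishi.IsTransverseOn (A.chart y).bundle (A.chart y).s τ (A.domIn U' y x h) →
      Kuranishi.IsTransverseOn (A.chart x).bundle (A.chart x).s ((L y x h).lift τ)
        (L y x h).W) ∧
    ∃ (U'' : A.Fam) (hU'' : A.IsPrecompactShrinking U'' U'),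
      ∀ O : ∀ x : A.S, Set (A.chart x).Tot,
        (∀ x, IsOpen (O x)) → (∀ x (z : (A.chart x).Base), ⟨z, 0⟩ ∈ O x) →
        ∃ Λ : Kuranishi.WeightFamily A,
          Kuranishi.IsInvariantPerturbation A U'' Λ ∧
          Kuranishi.IsControlledBy A U'' Λ O ∧
          (∀ x, Kuranishi.IsTransverseOn (A.chart x).bundle (A.chart x).s (Λ x) (U'' x)) ∧
          Kuranishi.IsLiftedNearImages A U'' L Λ ∧
          @IsCompact _ (A.relTop hU''.subset) (Kuranishi.solutionSet A U'' Λ) :=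
  ⟨fun y x h _ hτ => (hL.change y x h).isTransverseOn_lift hτ,
    hL.exists_perturbation hU_strong hU_hausdorff⟩
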